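/- A polygon is a simple polygon in the plane none of whose vertices has a straight angle; it is orthogonal if each of its edges is horizontal or vertical. (An orthogonal $n$-gon exists only for even $n\ge 4$.) A standard pocket of a polygon $P$ is a chain of edges of $P$ with at least one inner vertex that meets the boundary of the convex hull $\operatorname{conv}(P)$ exactly in its two endpoints. An extended pocket is a chain of at least two edges of $P$ that joins two consecutive vertices of $\operatorname{conv}(P)$ and contains no other vertex of $\operatorname{conv}(P)$. The lid of a pocket is the segment between its endpoints. A standard (extended) flipturn rotates a standard (extended) pocket by $180^\circ$ about the midpoint of its lid; vertices that acquire a straight angle are then no longer counted as vertices. A standard (extended) convexifying flipturn sequence for $P$ is a finite sequence of standard (extended) flipturns that transforms $P$ into a convex polygon; its length is the number of flipturns. A symmetric comb with $k\ge 1$ teeth is the orthogonal $4k$-gon bounded from below by a horizontal segment and from above by the graph of a positive step function with $2k-1$ steps, alternately teeth and gaps, beginning and ending with a tooth, every gap lower than every tooth, symmetric about a vertical line, such that from either side towards the middle the teeth get strictly shorter and the gaps strictly shallower. (For $k=1$ this is a rectangle.) **Theorem.** For every even $n\ge 4$ there is an orthogonal $n$-gon $P$ such that $P$ has a standard and an extended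 convexifying flipturn sequence, and every standard convexifying flipturn sequence for $P$ and every extended convexifying flipturn sequence for $P$ has length exactly $\lfloor 3(n-4)/4\rfloor$. If $4\mid n$, then $P$ can be taken to be a symmetric comb with $n/4$ teeth; otherwise $P$ can be taken to be a symmetric comb with $\lfloor n/4\rfloor$ teeth from which a rectangular notch has been cut at the lower right corner, of width less than that of the last tooth and of height less than that of every gap and tooth. In particular, at least $\lfloor 3(n-4)/4\rfloor$ standard flipturns, and at least as many extended flipturns, are sometimes necessary to convexify an orthogonal $n$-gon. -/

import Mathlib

namespace Flipturn

/-- Points of the plane. Only its affine structure and topology are used. -/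
abbrev Point := ℝ × ℝ

/-! A polygon is given by the list of its vertices in cyclic order; the starting vertex is
immaterial (flipturns below are defined up to rotation of the list). The number of vertices may
drop in a flipturn, hence lists rather than families over a fixed index type. -/

/-- The edges of a closed polygon: each entry of the list with its cyclic successor. -/
def edges {α : Type*} (P : List α) : List (α × α) :=
  P.zip (P.rotate 1)

/-- The corners of a closed polygon: each entry of the list, in the order of the list, as the
middle component of the triple (cyclic predecessor, entry, cyclic successor). -/
def corners {α : Type*} (P : List α) : List (α × α × α) :=
  (P.rotate (P.length - 1)).zip (edges P)

/-- The determinant of `b - a` and `c - b`; it vanishes iff `a`, `b`, `c` are collinear. -/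
def turn (a b c : Point) : ℝ :=
  (b.1 - a.1) * (c.2 - b.2) - (b.2 - a.2) * (c.1 - b.1)

/-- A simple polygon: at least three vertices, pairwise distinct, none of them with a straight
angle, and two different edges meet at most in a common endpoint. -/
structure IsSimplePolygon (P : List Point) : Prop where
  three_le : 3 ≤ P.length
  nodup : P.Nodup
  turn_ne : ∀ c ∈ corners P, turn c.1 c.2.1 c.2.2 ≠ 0
  inter_subset : (edges P).Pairwise fun e f =>
    segment ℝ e.1 e.2 ∩ segment ℝ f.1 f.2 ⊆ {e.1, e.2} ∩ {f.1, f.2}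

/-- An orthogonal `n`-gon: a simple polygon with `n` vertices whose edges are all vertical or
horizontal. -/
structure IsOrthogonalGon (n : ℕ) (P : List Point) : Prop where
  simple : IsSimplePolygon P
  length_eq : P.length = n
  orthogonal : ∀ e ∈ edges P, e.1.1 = e.2.1 ∨ e.1.2 = e.2.2

/-- The convex hull of a polygon. -/
def hull (P : List Point) : Set Point :=
  convexHull ℝ {p | p ∈ P}

/-- The vertices of the convex hull of a polygon. -/
def hullVertices (P : List Point) : Set Point :=
  (hull P).extremePoints ℝ

/-- A (simple) polygon is convex iff each of its vertices is a vertex of its convex hull. -/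
def IsConvexPolygon (P : List Point) : Prop :=
  ∀ p ∈ P, p ∈ hullVertices P

/-- The two kinds of pockets and flipturns. -/
inductive Kind
  | standard
  | extended

/-- The boundary points of the hull at which the pockets of a given kind begin and end: the whole
boundary of the hull for standard pockets, only the hull vertices for extended pockets. -/
def lidPoints (P : List Point) : Kind → Set Point
  | Kind.standard => frontier (hull P)
  | Kind.extended => hullVertices P

/-- For a polygon `P` that runs from `a` through the vertices in `m` to `b`: this chain of edges
is a pocket of `P` with lid `ab`. It has at least two edges. For a standard pocket the chain meets
the boundary of the convex hull of `P` exactly in its endpoints; for an extended pocket it joins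
two consecutive vertices of the convex hull. -/
structure IsPocket (K : Kind) (P : List Point) (a : Point) (m : List Point) (b : Point) :
    Prop where
  ne_nil : m ≠ []
  left_mem : a ∈ lidPoints P K
  right_mem : b ∈ lidPoints P K
  notMem : ∀ p ∈ m, p ∉ lidPoints P K

/-- The inner vertices of the chain `a, m, b` rotated by 180 degrees about the midpoint of `ab`,
in the order in which the rotated chain runs from `a` to `b`. -/
def flipChain (a : Point) (m : List Point) (b : Point) : List Point :=
  (m.map fun p => a + b - p).reverse

/-- `p ↦ a + b - p` is the rotation by 180 degrees about the midpoint of `ab`. -/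
theorem add_sub_eq_pointReflection (a b p : Point) :
    a + b - p = Equiv.pointReflection (midpoint ℝ a b) p := by
  have h : midpoint ℝ a b + midpoint ℝ a b = a + b := midpoint_add_self ℝ a b
  rw [Equiv.pointReflection_apply, vsub_eq_sub, vadd_eq_add, ← h]
  abel

open Classical in
/-- Delete the vertices at which the polygon has a straight angle. -/
noncomputable def tidy (P : List Point) : List Point :=
  ((corners P).filter fun c => turn c.1 c.2.1 c.2.2 ≠ 0).map fun c => c.2.1

/-- `Step K P Q`: the polygon `Q` results from `P` by one flipturn of kind `K`. -/
def Step (K : Kind) (P Q : List Point) : Prop :=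
  ∃ (a : Point) (m : List Point) (b : Point) (r : List Point),
    P.IsRotated (a :: (m ++ b :: r)) ∧ IsPocket K P a m b ∧
      Q = tidy (a :: (flipChain a m b ++ b :: r))

/-- `FlipturnSeq K l P Q`: a sequence of `l` flipturns of kind `K` leads from `P` to `Q`. -/
inductive FlipturnSeq (K : Kind) : ℕ → List Point → List Point → Prop
  | refl (P : List Point) : FlipturnSeq K 0 P P
  | step {l : ℕ} {P Q R : List Point} :
      Step K P Q → FlipturnSeq K l Q R → FlipturnSeq K (l + 1) P R

/-- The data of a symmetric comb with `k` teeth standing on the line `y = 0`. Its `2 * k - 1`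
columns are bounded by the abscissas `x 0 < x 1 < ... < x (2 * k - 1)`; the column between `x j`
and `x (j + 1)` has height `h j`. Columns with even `j` are teeth, columns with odd `j` are gaps.
The comb is symmetric about a vertical line, and from either side towards the middle (column
`k - 1`) the teeth get shorter and the gaps shallower. -/
structure IsSymmetricComb (k : ℕ) (x h : ℕ → ℝ) : Prop where
  x_lt : ∀ j < 2 * k - 1, x j < x (j + 1)
  h_pos : ∀ j < 2 * k - 1, 0 < h j
  gap_lt_tooth : ∀ i < 2 * k - 1, ∀ j < 2 * k - 1, Odd i → Even j → h i < h j
  x_symm : ∀ i j, i + j = 2 * k - 1 → x i + x j = x 0 + x (2 * k - 1)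
  h_symm : ∀ i j, i + j = 2 * k - 2 → h i = h j
  tooth_anti : ∀ j, Even j → j + 2 ≤ k - 1 → h (j + 2) < h j
  gap_mono : ∀ j, Odd j → j + 2 ≤ k - 1 → h j < h (j + 2)

/-- The vertices of a comb, from the lower left corner over the teeth to the end of the last
tooth; the lower right corner is missing. -/
def combChain (k : ℕ) (x h : ℕ → ℝ) : List Point :=
  (x 0, 0) :: (List.range (2 * k - 1)).flatMap fun j => [(x j, h j), (x (j + 1), h j)]

/-- `P` is a symmetric comb with `k` teeth. -/
def IsPlainComb (k : ℕ) (P : List Point) : Prop :=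
  ∃ x h : ℕ → ℝ, IsSymmetricComb k x h ∧ P = combChain k x h ++ [(x (2 * k - 1), 0)]

/-- `P` is a symmetric comb with `k` teeth from which a rectangular notch of width `u` and height
`v` has been cut at the lower right corner; the notch lies in the foot of the last tooth. -/
def IsNotchedComb (k : ℕ) (P : List Point) : Prop :=
  ∃ (x h : ℕ → ℝ) (u v : ℝ), IsSymmetricComb k x h ∧
    0 < u ∧ u < x (2 * k - 1) - x (2 * k - 2) ∧ 0 < v ∧ (∀ j < 2 * k - 1, v < h j) ∧
    P = combChain k x h ++
      [(x (2 * k - 1), v), (x (2 * k - 1) - u, v), (x (2 * k - 1) - u, 0)]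

end Flipturn

/-! A closed polygon is recorded by a starting point and the word of its edge vectors. Rotating a
chain by 180 degrees about the midpoint of its lid reverses the corresponding subword
(`cons_flipChain`, `Step.exists_pocketWord`), so the geometry enters only through the question which
subwords are pockets.

All polygons reachable from the combs have one form (`Shape`): an ascending staircase `A`, a top `T`
that is a nested comb of depth `j`, a descending staircase `B`, possibly a notch `N`, and a bottom
edge. The weight `A.length + B.length + 6 * j + N.length` drops by exactly 2 in every flipturn
(`Shape.step_word`): a pocket in `A` or `B` creates two straight angles, and its staircase loses two
edges (`flip_A`, `flip_B`); the notch disappears with its two edges (`flip_N`); a flipturn of the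
top keeps all vertices, but turns the outermost level of nesting into two additional edges on each
staircase, which changes the weight by 4 - 6 (`flip_T`). The turned inner comb is a nested comb
again because a nest read backwards is a nest starting in the other direction (`reverse_nest`). Thus
each level of nesting, worth four vertices, costs three flipturns, whatever choices are made. The
two kinds of flipturn differ only in whether the outer teeth of the top take part (`T_ends`), which
merely exchanges their widths.

The weight 2 forces a rectangle (`Shape.isConvexPolygon`). With a larger weight some vertex lies in
the interior of the hull (`Shape.exists_interior`), so the polygon is not convex and has a pocket
(`exists_pocketWord`). Hence every sequence can be continued until the weight is 2, and its length
is determined by the initial weight: `6 * m + 2` for the plain comb and `6 * m + 4` for the notched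
one, each with `m + 1` teeth.

Flipturns and convexity refer only to the vertex list and its hull, so simplicity is verified for
the initial polygons alone. -/

namespace Flipturn

/-! ### Closed polygons as words of edge vectors -/

/-- The starting points of the edges of the walk that starts at `p` and has the given edge
vectors. -/
def path : Point → List Point → List Point
  | _, [] => []
  | p, e :: w => p :: path (p + e) w

/-- The corners of a walk from `p` with edge vectors `w` that reaches `p` with the vector `e`. -/
def pathCorners : Point → Point → List Point → List (Point × Point × Point)
  | _, _, [] => []
  | e, p, f :: w => (p - e, p, p + f) :: pathCorners f (p + f) w

open Classical in
/-- The starting points of those edges of a walk which do not prolong the preceding edge. -/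
noncomputable def tidyPath (e p : Point) (w : List Point) : List Point :=
  ((pathCorners e p w).filter fun c => turn c.1 c.2.1 c.2.2 ≠ 0).map fun c => c.2.1

@[simp] theorem path_nil (p : Point) : path p [] = [] := rfl

@[simp] theorem path_cons (p e : Point) (w : List Point) :
    path p (e :: w) = p :: path (p + e) w := rfl

@[simp] theorem length_path (p : Point) (w : List Point) : (path p w).length = w.length := by
  induction w generalizing p with
  | nil => rfl
  | cons e w ih => simp [ih]

theorem path_append (p : Point) (u v : List Point) :
    path p (u ++ v) = path p u ++ path (p + u.sum) v := by
  induction u generalizing p with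
  | nil => simp
  | cons e u ih => simp [ih, add_assoc]

theorem path_eq_append {p : Point} {w X Y : List Point} (h : path p w = X ++ Y) :
    ∃ u v, w = u ++ v ∧ X = path p u ∧ Y = path (p + u.sum) v := by
  induction X generalizing p w with
  | nil => exact ⟨[], w, by simp, by simp, by simpa using h.symm⟩
  | cons x X ih =>
    cases w with
    | nil => simp at h
    | cons e w =>
      simp only [path_cons, List.cons_append, List.cons.injEq] at h
      obtain ⟨u, v, rfl, rfl, rfl⟩ := ih h.2
      exact ⟨e :: u, v, by simp, by simp [h.1], by simp [add_assoc]⟩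

theorem mem_path {p q : Point} {w : List Point} :
    q ∈ path p w ↔ ∃ u e v, w = u ++ e :: v ∧ q = p + u.sum := by
  constructor
  · intro h
    obtain ⟨X, Y, h⟩ := List.append_of_mem h
    obtain ⟨u, v, rfl, -, hv⟩ := path_eq_append h
    cases v with
    | nil => simp at hv
    | cons e v =>
      simp only [path_cons, List.cons.injEq] at hv
      exact ⟨u, e, v, rfl, hv.1⟩
  · rintro ⟨u, e, v, rfl, rfl⟩
    simp [path_append]

/-- The rotated chain has the same edge vectors, in the opposite order. -/
theorem cons_flipChain (a : Point) (m w : List Point) (h : a :: m = path a w) :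
    a :: flipChain a m (a + w.sum) = path a w.reverse := by
  -- The induction on `w` moves the start `a` of the walk, so the start `c` of the reversed walk has
  -- to be independent of it. The end `b` is appended because its reflection is `c`, the first
  -- vertex of the reversed walk.
  have key : ∀ (w : List Point) (a b : Point), a + w.sum = b →
      ∀ c, path c w.reverse = (((path a w).tail ++ if w = [] then [] else [b]).map
        fun p => c + b - p).reverse := by
    intro w
    induction w with
    | nil => intros; simp
    | cons e w ih =>
      intro a b hab c
      have hab' : a + e + w.sum = b := by rw [← hab, List.sum_cons, add_assoc]
      rw [List.reverse_cons, path_append, ih (a + e) b hab' c]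
      cases w with
      | nil =>
        simp at hab' ⊢
      | cons f w =>
        have : c + b - (a + e) = c + (f + w.sum) := by
          rw [← hab']; simp only [List.sum_cons]; abel
        simp [this, List.sum_reverse, add_comm f]
  cases w with
  | nil => simp at h
  | cons e w =>
    simp only [path_cons, List.cons.injEq, true_and] at h
    rw [key (e :: w) a _ rfl a]
    simp [flipChain, h]

theorem tidyPath_nil (e p : Point) : tidyPath e p [] = [] := rfl

theorem turn_eq (e p f : Point) : turn (p - e) p (p + f) = e.1 * f.2 - e.2 * f.1 := by
  simp [turn]

open Classical in
theorem tidyPath_cons (e p f : Point) (w : List Point) :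
    tidyPath e p (f :: w) =
      (if e.1 * f.2 - e.2 * f.1 = 0 then [] else [p]) ++ tidyPath f (p + f) w := by
  unfold tidyPath
  simp only [pathCorners, List.filter_cons, turn_eq]
  split_ifs <;> simp_all

theorem zip_pathCorners (e p : Point) (w : List Point) :
    (path (p - e) (e :: w)).zip ((path p w).zip ((path p w).tail ++ [p + w.sum])) =
      pathCorners e p w := by
  induction w generalizing e p with
  | nil => rfl
  | cons f w ih =>
    have h := ih f (p + f)
    rw [add_sub_cancel_right] at h
    cases w with
    | nil => simp [pathCorners]
    | cons g w =>
      simp only [path_cons, List.tail_cons, List.cons_append, List.zip_cons_cons, pathCorners,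
        List.sum_cons, sub_add_cancel] at h ⊢
      rw [← h]
      simp [add_assoc]

theorem edges_path {z : Point} {w : List Point} (hs : w.sum = 0) (hw : w ≠ []) :
    edges (path z w) = (path z w).zip ((path z w).tail ++ [z + w.sum]) := by
  obtain ⟨f, w, rfl⟩ := List.exists_cons_of_ne_nil hw
  simp [edges, hs]

/-- The last edge vector `e` leads back to `z`, so the corner at `z` is entered along `e`; rotating
the vertex list by its length minus one means starting the walk one edge earlier, at `z - e`. -/
theorem corners_path {z e : Point} {w : List Point} (hs : (w ++ [e]).sum = 0) :
    corners (path z (w ++ [e])) = pathCorners e z (w ++ [e]) := by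
  have hz : z + w.sum = z - e := by
    have : w.sum = -e := by simpa [add_eq_zero_iff_eq_neg] using hs
    rw [this, sub_eq_add_neg]
  have hzip : ∀ (x y : List Point) (l : List (Point × Point)), x.length = l.length →
      x.zip l = (x ++ y).zip l := by
    intro x y l h
    simpa using (List.zip_append (r₁ := y) (r₂ := []) h).symm
  rw [corners, edges_path hs (by simp), ← zip_pathCorners, length_path]
  have : (path z (w ++ [e])).rotate ((w ++ [e]).length - 1) = path (z - e) (e :: w) := by
    have := List.rotate_append_length_eq (path z w) [z - e]
    simpa [path_append, hz] using this
  rw [this, ← List.cons_append, path_append (z - e) (e :: w) [e]]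
  refine hzip _ _ _ ?_
  simp

theorem tidy_path {z e : Point} {w : List Point} (hs : (w ++ [e]).sum = 0) :
    tidy (path z (w ++ [e])) = tidyPath e z (w ++ [e]) := by
  rw [tidy, corners_path hs, tidyPath]

theorem sub_mem_of_mem_edges {z : Point} {w : List Point} (hs : w.sum = 0) {E : Point × Point}
    (hE : E ∈ edges (path z w)) : E.2 - E.1 ∈ w := by
  have key : ∀ (w : List Point) (z : Point),
      E ∈ (path z w).zip ((path z w).tail ++ [z + w.sum]) → E.2 - E.1 ∈ w := by
    intro w
    induction w with
    | nil => simp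
    | cons f w ih =>
      intro z h
      cases w with
      | nil => simp at h; simp [h]
      | cons g w =>
        simp only [path_cons, List.tail_cons, List.cons_append, List.zip_cons_cons,
          List.mem_cons] at h ih ⊢
        rcases h with rfl | h
        · simp
        · right
          exact ih (z + f) (by simpa [add_assoc] using h)
  rcases eq_or_ne w [] with rfl | hw
  · simp [edges] at hE
  · exact key w z (by rwa [edges_path hs hw] at hE)

/-! ### Rotations of the list of vertices -/

theorem rotate_zip {α β : Type*} (l : List α) (l' : List β) (n : ℕ) (h : l.length = l'.length) :
    (l.zip l').rotate n = (l.rotate n).zip (l'.rotate n) :=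
  List.zipWith_rotate_distrib _ l l' n h

theorem corners_rotate {α : Type*} (P : List α) (n : ℕ) :
    corners (P.rotate n) = (corners P).rotate n := by
  unfold corners edges
  rw [rotate_zip _ _ _ (by simp), rotate_zip _ _ _ (by simp)]
  simp only [List.rotate_rotate, List.length_rotate, add_comm]

open List in
theorem filter_isRotated {α : Type*} {l l' : List α} (p : α → Bool) (h : l ~r l') :
    l.filter p ~r l'.filter p := by
  obtain ⟨n, hn, rfl⟩ := List.isRotated_iff_mod.1 h
  rw [List.rotate_eq_drop_append_take hn, List.filter_append]
  conv_lhs => rw [← List.take_append_drop n l, List.filter_append]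
  exact List.isRotated_append

open List in
theorem tidy_isRotated {P Q : List Point} (h : P ~r Q) : tidy P ~r tidy Q := by
  obtain ⟨n, rfl⟩ := h
  unfold tidy
  rw [corners_rotate]
  exact (filter_isRotated _ ⟨n, rfl⟩).map _

theorem lidPoints_congr {P Q : List Point} (h : ∀ p, p ∈ P ↔ p ∈ Q) (K : Kind) :
    lidPoints P K = lidPoints Q K := by
  have : hull P = hull Q := by simp only [hull, h]
  cases K <;> simp only [lidPoints, hullVertices, this]

/-! ### Pockets as subwords -/

/-- The word `w` of edge vectors of a closed polygon, cut into three pieces of which the middle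
one is a pocket. -/
structure IsPocketWord (S : Set Point) (z : Point) (w w₁ w₂ w₃ : List Point) : Prop where
  eq : w = w₁ ++ (w₂ ++ w₃)
  two_le : 2 ≤ w₂.length
  left_mem : z + w₁.sum ∈ S
  right_mem : z + (w₁ ++ w₂).sum ∈ S
  notMem : ∀ c d, w₂ = c ++ d → c ≠ [] → d ≠ [] → z + (w₁ ++ c).sum ∉ S

open List in
/-- A flipturn reverses the word of edge vectors of a pocket. -/
theorem Step.exists_pocketWord {K : Kind} {P Q : List Point} {z : Point} {w : List Point}
    (hP : P ~r path z w) (hs : w.sum = 0) (hz : z ∈ lidPoints (path z w) K)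
    (h : Step K P Q) : ∃ w₁ w₂ w₃, IsPocketWord (lidPoints (path z w) K) z w w₁ w₂ w₃ ∧
      Q ~r tidy (path z (w₁ ++ (w₂.reverse ++ w₃))) := by
  obtain ⟨a, m, b, r, hr, hp, rfl⟩ := h
  have hS := lidPoints_congr (fun p => hP.mem_iff) K
  have hl := hS ▸ hp.left_mem
  have hr' := hS ▸ hp.right_mem
  have hn := hS ▸ hp.notMem
  have hrot : path z w ~r a :: (m ++ b :: r) := hP.symm.trans hr
  obtain ⟨s, t, hst, hts⟩ : ∃ s t, path z w = s ++ (a :: m ++ t) ∧ t ++ s = b :: r := by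
    obtain ⟨n, hk, hrot⟩ := List.isRotated_iff_mod.1 hrot
    rw [List.rotate_eq_drop_append_take hk] at hrot
    have hL := List.take_append_drop n (path z w)
    set X := take n (path z w)
    set Y := drop n (path z w)
    have hrot : Y ++ X = (a :: m) ++ b :: r := hrot
    rcases List.append_eq_append_iff.1 hrot with ⟨c, h1, h2⟩ | ⟨c, h1, h2⟩
    · rcases Y with _ | ⟨y, Y⟩
      · refine ⟨[], b :: r, ?_, by simp⟩
        rw [← hL]; simp at h1; simp [h2, h1]
      · rcases c with _ | ⟨x, c⟩
        · refine ⟨b :: r, [], ?_, by simp⟩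
          rw [← hL, h2, h1]; simp
        -- Otherwise the starting point `z` of the word is an inner vertex of the pocket, but it is
        -- a lid point. So the pocket is a contiguous piece of the word.
        · exfalso
          rw [List.cons_append, List.cons.injEq] at h1
          have : x = z := by
            cases w with
            | nil => simp at hL hrot
            | cons e w => rw [h2] at hL; simp at hL; exact hL.1
          exact hn x (by simp [h1]) (this ▸ hz)
    · refine ⟨X, c, ?_, h2.symm⟩
      rw [← hL, h1]
  obtain ⟨w₁, v, rfl, rfl, hv⟩ := path_eq_append hst
  obtain ⟨w₂, w₃, rfl, h2, rfl⟩ := path_eq_append hv.symm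
  have ha : a = z + w₁.sum := by
    cases w₂ with
    | nil => simp at h2
    | cons e w => simp at h2; exact h2.1
  subst ha
  have hb : b = z + w₁.sum + w₂.sum := by
    -- If nothing follows the pocket, it ends at the starting point of the closed walk.
    cases w₃ with
    | nil =>
      simp only [List.append_nil, List.sum_append] at hs
      rw [add_assoc, hs]
      cases w₁ with
      | nil => simp at hts
      | cons e w => simp at hts; simp [hts.1]
    | cons e w => simp at hts; rw [← hts.1]
  have hlen : m.length + 1 = w₂.length := by
    have := congrArg List.length h2; simpa using this
  have hm := List.length_pos_of_ne_nil hp.ne_nil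
  refine ⟨w₁, w₂, w₃, ⟨rfl, by omega, hl, ?_, ?_⟩, ?_⟩
  · rw [List.sum_append, ← add_assoc, ← hb]; exact hr'
  · rintro c d rfl hc hd
    refine hn _ ?_
    rw [path_append] at h2
    obtain ⟨e, c, rfl⟩ := List.exists_cons_of_ne_nil hc
    obtain ⟨f, d, rfl⟩ := List.exists_cons_of_ne_nil hd
    simp only [path_cons, List.cons_append, List.cons.injEq, true_and] at h2
    rw [h2]
    simp [add_assoc]
  · refine tidy_isRotated ?_
    have h3 := cons_flipChain _ m w₂ h2
    rw [← hb] at h3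
    rw [path_append, path_append, ← h3, List.sum_reverse, ← hts, ← List.cons_append,
      ← List.append_assoc]
    exact List.isRotated_append.trans (by rfl)

open List in
-- A nonempty `w₁` guarantees that, after the start of the pocket is rotated to the front, the
-- cyclic list still has a separate entry for its end, even if `w₃` is empty.
theorem IsPocketWord.step {K : Kind} {P : List Point} {z : Point} {w w₁ w₂ w₃ : List Point}
    (hP : P ~r path z w) (hs : w.sum = 0) (h₁ : w₁ ≠ [])
    (h : IsPocketWord (lidPoints (path z w) K) z w w₁ w₂ w₃) : ∃ Q, Step K P Q := by
  obtain ⟨rfl, h2, hl, hr, hn⟩ := h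
  obtain ⟨e, w₂, rfl⟩ : ∃ e w, w₂ = e :: w :=
    List.exists_cons_of_ne_nil (by rintro rfl; simp at h2)
  obtain ⟨f, w₁, rfl⟩ := List.exists_cons_of_ne_nil h₁
  obtain ⟨b, r, hbr, hb⟩ : ∃ b r,
      path (z + (f :: w₁).sum + (e :: w₂).sum) w₃ ++ path z (f :: w₁) = b :: r ∧
        b = z + (f :: w₁ ++ e :: w₂).sum := by
    cases w₃ with
    | nil => exact ⟨_, _, rfl, by simpa using hs⟩
    | cons g w₃ => exact ⟨_, _, rfl, by simp [add_assoc]⟩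
  refine ⟨_, z + (f :: w₁).sum, path (z + (f :: w₁).sum + e) w₂, b, r, ?_, ⟨?_, ?_, ?_, ?_⟩, rfl⟩
  · refine hP.trans ?_
    rw [path_append, path_append]
    change _ ~r (_ :: path _ w₂) ++ b :: r
    rw [← path_cons, ← hbr, ← List.append_assoc (path _ (e :: w₂))]
    exact List.isRotated_append
  · cases w₂ with
    | nil => simp at h2
    | cons => simp
  · rwa [lidPoints_congr (fun p => hP.mem_iff) K]
  · rwa [lidPoints_congr (fun p => hP.mem_iff) K, hb]
  · rw [lidPoints_congr (fun p => hP.mem_iff) K]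
    intro p hp
    obtain ⟨u, g, v, rfl, rfl⟩ := mem_path.1 hp
    have := hn (e :: u) (g :: v) (by simp) (by simp) (by simp)
    simpa [add_assoc] using this

/-! ### Axis-parallel edge vectors and the merging of collinear edges -/

/-- The edge vector points to the right. -/
def IsR (e : Point) : Prop := 0 < e.1 ∧ e.2 = 0

/-- The edge vector points to the left. -/
def IsL (e : Point) : Prop := e.1 < 0 ∧ e.2 = 0

/-- The edge vector points upwards. -/
def IsU (e : Point) : Prop := e.1 = 0 ∧ 0 < e.2

/-- The edge vector points downwards. -/
def IsD (e : Point) : Prop := e.1 = 0 ∧ e.2 < 0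

/-- One of the vectors is horizontal, the other one vertical. -/
def Alt (e f : Point) : Prop :=
  (e.1 = 0 ∧ e.2 ≠ 0 ∧ f.1 ≠ 0 ∧ f.2 = 0) ∨ (e.1 ≠ 0 ∧ e.2 = 0 ∧ f.1 = 0 ∧ f.2 ≠ 0)

/-- Two horizontal or vertical vectors with the same direction. -/
def SameDir (e f : Point) : Prop :=
  (e.1 = 0 ∧ f.1 = 0 ∧ 0 < e.2 * f.2) ∨ (e.2 = 0 ∧ f.2 = 0 ∧ 0 < e.1 * f.1)

theorem Alt.symm {e f : Point} (h : Alt e f) : Alt f e := by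
  unfold Alt at *; tauto

theorem Alt.cross_ne {e f : Point} (h : Alt e f) : e.1 * f.2 - e.2 * f.1 ≠ 0 := by
  rcases h with ⟨h1, h2, h3, h4⟩ | ⟨h1, h2, h3, h4⟩ <;> simp [*]

theorem SameDir.symm {e f : Point} (h : SameDir e f) : SameDir f e := by
  unfold SameDir at *
  rcases h with ⟨h1, h2, h3⟩ | ⟨h1, h2, h3⟩
  · exact Or.inl ⟨h2, h1, by linarith⟩
  · exact Or.inr ⟨h2, h1, by linarith⟩

theorem SameDir.cross_eq {e f : Point} (h : SameDir e f) : e.1 * f.2 - e.2 * f.1 = 0 := by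
  rcases h with ⟨h1, h2, h3⟩ | ⟨h1, h2, h3⟩ <;> simp [*]

/-- Vectors of the same direction do not cancel, so a merged edge is perpendicular to the same
neighbours as before. -/
theorem SameDir.alt_add {x p b : Point} (h : SameDir p b) (hx : Alt x p) : Alt x (p + b) := by
  have add_ne : ∀ s t : ℝ, 0 < s * t → s + t ≠ 0 := by
    intro s t h h'
    have : t = -s := by linarith
    subst this
    nlinarith [sq_nonneg s]
  rcases hx with ⟨h1, h2, h3, h4⟩ | ⟨h1, h2, h3, h4⟩ <;>
    rcases h with ⟨h5, h6, h7⟩ | ⟨h5, h6, h7⟩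
  · exact absurd h5 h3
  · exact Or.inl ⟨h1, h2, add_ne _ _ h7, by simp [h5, h6]⟩
  · exact Or.inr ⟨h1, h2, by simp [h5, h6], add_ne _ _ h7⟩
  · exact absurd h5 h4

theorem SameDir.alt_add' {x p b : Point} (h : SameDir p b) (hx : Alt x b) : Alt x (p + b) :=
  add_comm b p ▸ h.symm.alt_add hx

theorem isChain_alt_reverse {w : List Point} : w.reverse.IsChain Alt ↔ w.IsChain Alt := by
  rw [List.isChain_reverse]
  exact ⟨fun h => h.imp fun _ _ => Alt.symm, fun h => h.imp fun _ _ => Alt.symm⟩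

theorem isChain_append_singleton_imp {l : List Point} {a b : Point}
    (h : (l ++ [a]).IsChain Alt) (hab : ∀ x, Alt x a → Alt x b) : (l ++ [b]).IsChain Alt := by
  rw [List.isChain_append] at *
  refine ⟨h.1, by simp, fun x hx y hy => ?_⟩
  have := h.2.2 x hx a (by simp)
  simp at hy
  exact hy ▸ hab x this

theorem isChain_cons_imp {l : List Point} {a b : Point}
    (h : (a :: l).IsChain Alt) (hab : ∀ x, Alt x a → Alt x b) : (b :: l).IsChain Alt := by
  rw [← isChain_alt_reverse, List.reverse_cons] at *
  exact isChain_append_singleton_imp h hab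

theorem tidyPath_of_isChain {e p : Point} {w : List Point} (h : (e :: w).IsChain Alt) :
    tidyPath e p w = path p w := by
  induction w generalizing e p with
  | nil => rfl
  | cons f w ih =>
    rw [List.isChain_cons_cons] at h
    rw [tidyPath_cons, ih h.2, if_neg h.1.cross_ne, path_cons, List.singleton_append]

theorem tidyPath_append_cons (e p f : Point) (u v : List Point) :
    tidyPath e p (u ++ f :: v) = tidyPath e p (u ++ [f]) ++ tidyPath f (p + u.sum + f) v := by
  induction u generalizing e p with
  | nil => simp [tidyPath_cons, tidyPath_nil]
  | cons g u ih => simp [tidyPath_cons, ih, add_assoc]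

theorem tidyPath_cons_of_sameDir {e p f : Point} {w : List Point} (h : SameDir e f) :
    tidyPath e p (f :: w) = tidyPath f (p + f) w := by
  rw [tidyPath_cons, if_pos h.cross_eq, List.nil_append]

/-- Reversing `b₁, M, b₂` destroys only the two adjacencies at its ends; these are the three pieces
whose alternation survives. -/
theorem isChain_parts {e p b₁ b₂ q : Point} {X M Y : List Point}
    (h : (e :: (X ++ p :: b₁ :: (M ++ b₂ :: q :: Y))).IsChain Alt) :
    (e :: (X ++ [p])).IsChain Alt ∧ (b₂ :: (M.reverse ++ [b₁])).IsChain Alt ∧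
      (q :: Y).IsChain Alt := by
  rw [← List.cons_append, List.isChain_append_cons_cons] at h
  obtain ⟨h1, -, h2⟩ := h
  rw [← List.cons_append, List.isChain_append_cons_cons] at h2
  refine ⟨h1, ?_, h2.2.2⟩
  have := isChain_alt_reverse.2 h2.1
  simpa using this

/-- The only straight angles after the reversal are at the junctions of `p` with `b₂` and of `b₁`
with `q`; deleting these vertices adds the edge vectors. -/
theorem tidyPath_merge {e p b₁ b₂ q z : Point} {X M Y : List Point}
    (h : (e :: (X ++ p :: b₁ :: (M ++ b₂ :: q :: Y))).IsChain Alt)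
    (hp : SameDir p b₂) (hq : SameDir b₁ q) :
    tidyPath e z (X ++ p :: b₂ :: (M.reverse ++ b₁ :: q :: Y)) =
      path z (X ++ (p + b₂) :: (M.reverse ++ (b₁ + q) :: Y)) := by
  obtain ⟨h1, h2, h3⟩ := isChain_parts h
  rw [tidyPath_append_cons, tidyPath_of_isChain h1, tidyPath_cons_of_sameDir hp,
    tidyPath_append_cons, tidyPath_of_isChain h2, tidyPath_cons_of_sameDir hq,
    tidyPath_of_isChain h3]
  simp [path_append, add_assoc]

theorem isChain_merge {e p b₁ b₂ q : Point} {X M Y : List Point}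
    (h : (e :: (X ++ p :: b₁ :: (M ++ b₂ :: q :: Y))).IsChain Alt)
    (hp : SameDir p b₂) (hq : SameDir b₁ q) :
    (e :: (X ++ (p + b₂) :: (M.reverse ++ (b₁ + q) :: Y))).IsChain Alt := by
  obtain ⟨h1, h2, h3⟩ := isChain_parts h
  rw [← List.cons_append, List.isChain_split, List.cons_append]
  refine ⟨isChain_append_singleton_imp (l := e :: X) h1 fun _ => hp.alt_add, ?_⟩
  rw [← List.cons_append, List.isChain_split, List.cons_append]
  refine ⟨?_, isChain_cons_imp h3 fun _ => hq.alt_add'⟩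
  refine isChain_cons_imp ?_ fun _ => hp.alt_add'
  exact isChain_append_singleton_imp (l := b₂ :: M.reverse) h2 fun _ => hq.alt_add

/-- The case in which both new junctions are proper corners, so that no vertex is lost. -/
theorem isChain_flip {e p b₁ b₂ q : Point} {X M Y : List Point}
    (h : (e :: (X ++ p :: b₁ :: (M ++ b₂ :: q :: Y))).IsChain Alt)
    (hp : Alt p b₂) (hq : Alt b₁ q) :
    (e :: (X ++ p :: b₂ :: (M.reverse ++ b₁ :: q :: Y))).IsChain Alt := by
  obtain ⟨h1, h2, h3⟩ := isChain_parts h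
  rw [← List.cons_append, List.isChain_append_cons_cons, List.cons_append]
  refine ⟨h1, hp, ?_⟩
  rw [← List.cons_append, List.isChain_append_cons_cons, List.cons_append]
  exact ⟨h2, hq, h3⟩

/-- Alternation depends only on directions, so `(-1, 0)` serves as a placeholder for the last edge
of the closed word, which points to the left. In this way a linear chain condition expresses cyclic
alternation. -/
theorem isChain_cons_of_isL {c : Point} {w : List Point} (hc : IsL c)
    (h : ((-1, 0) :: w : List Point).IsChain Alt) : (c :: w).IsChain Alt := by
  refine isChain_cons_imp h fun x hx => ?_
  rcases hx with ⟨h1, h2, h3, h4⟩ | ⟨h1, h2, h3, h4⟩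
  · exact Or.inl ⟨h1, h2, hc.1.ne, hc.2⟩
  · simp at h4

theorem tidy_path_of_isChain {c z : Point} {w : List Point} (hc : IsL c)
    (hs : (w ++ [c]).sum = 0) (h : ((-1, 0) :: (w ++ [c]) : List Point).IsChain Alt) :
    tidy (path z (w ++ [c])) = path z (w ++ [c]) := by
  rw [tidy_path hs, tidyPath_of_isChain (isChain_cons_of_isL hc h)]

/-- Tidying a closed polygon after a flipturn of a pocket with an even number of edges. -/
theorem tidy_path_merge {p b₁ b₂ q c z : Point} {X M Y V : List Point}
    (h : ((-1, 0) :: (X ++ p :: b₁ :: (M ++ b₂ :: q :: Y)) : List Point).IsChain Alt)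
    (hs : (X ++ p :: b₁ :: (M ++ b₂ :: q :: Y)).sum = 0)
    (hp : SameDir p b₂) (hq : SameDir b₁ q) (hY : q :: Y = V ++ [c]) (hc : IsL c) :
    tidy (path z (X ++ p :: b₂ :: (M.reverse ++ b₁ :: q :: Y))) =
      path z (X ++ (p + b₂) :: (M.reverse ++ (b₁ + q) :: Y)) := by
  rw [← tidyPath_merge (isChain_cons_of_isL hc h) hp hq, hY]
  have : X ++ p :: b₂ :: (M.reverse ++ b₁ :: (V ++ [c])) =
      (X ++ p :: b₂ :: (M.reverse ++ b₁ :: V)) ++ [c] := by simp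
  rw [this]
  apply tidy_path
  rw [← this, ← hY, ← hs]
  simp only [List.sum_append, List.sum_cons, List.sum_reverse]
  abel

/-! ### The boundary of the convex hull -/

theorem subset_hull {P : List Point} {p : Point} (h : p ∈ P) : p ∈ hull P :=
  subset_convexHull ℝ _ h

theorem not_mem_interior_of_mem_hullVertices {P : List Point} {p : Point}
    (h : p ∈ hullVertices P) : p ∉ interior (hull P) := fun h' => by
  have : Disjoint (interior (hull P)) (Set.extremePoints ℝ (hull P)) :=
    disjoint_interior_extremePoints ..
  exact Set.disjoint_left.1 this h' h

theorem not_mem_lidPoints {P : List Point} {p : Point} (h : p ∈ interior (hull P)) (K : Kind) :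
    p ∉ lidPoints P K := by
  cases K with
  | standard => exact fun h' => h'.2 h
  | extended => exact fun h' => not_mem_interior_of_mem_hullVertices h' h

theorem mem_lidPoints {P : List Point} {p : Point} (h : p ∈ hullVertices P) (K : Kind) :
    p ∈ lidPoints P K := by
  cases K with
  | standard => exact ⟨subset_closure h.1, not_mem_interior_of_mem_hullVertices h⟩
  | extended => exact h

/-- A point that is maximal among the vertices in a lexicographic order is a hull vertex. -/
theorem mem_hullVertices_of_lex {P : List Point} {p : Point} (f g : Point →ₗ[ℝ] ℝ) (hp : p ∈ P)
    (hfg : ∀ q, f q = f p → g q = g p → q = p)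
    (h : ∀ q ∈ P, f q < f p ∨ (f q = f p ∧ g q ≤ g p)) : p ∈ hullVertices P := by
  -- The points lexicographically at most `p` form a convex set, which therefore contains the hull.
  have hC : hull P ⊆ {q | f q < f p ∨ (f q = f p ∧ g q ≤ g p)} := by
    refine convexHull_min h ?_
    rintro x hx y hy s t hs ht hst
    have key : ∀ (φ : Point →ₗ[ℝ] ℝ), φ (s • x + t • y) = s * φ x + t * φ y := by simp
    simp only [Set.mem_ofPred_eq, key] at *
    have hp' : f p = s * f p + t * f p := by rw [← add_mul, hst, one_mul]
    have hg' : g p = s * g p + t * g p := by rw [← add_mul, hst, one_mul]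
    rcases hs.eq_or_lt with rfl | hs'
    · have : t = 1 := by linarith
      subst this; simpa using hy
    rcases ht.eq_or_lt with rfl | ht'
    · have : s = 1 := by linarith
      subst this; simpa using hx
    rcases hx with hx | ⟨hx, hx'⟩ <;> rcases hy with hy | ⟨hy, hy'⟩
    · left; nlinarith
    · left; rw [hy]; nlinarith
    · left; rw [hx]; nlinarith
    · right; rw [hx, hy]; exact ⟨by linarith, by nlinarith⟩
  refine mem_extremePoints.2 ⟨subset_hull hp, fun x hx y hy hxy => ?_⟩
  obtain ⟨s, t, hs, ht, hst, rfl⟩ := hxy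
  have key : ∀ (φ : Point →ₗ[ℝ] ℝ), φ (s • x + t • y) = s * φ x + t * φ y := by simp
  replace hx := hC hx
  replace hy := hC hy
  simp only [Set.mem_ofPred_eq, key] at *
  have ht1 : t = 1 - s := by linarith
  subst ht1
  -- Neither of `x`, `y` exceeds their proper convex combination lexicographically. So their
  -- `f`-values agree, and after that their `g`-values.
  have hf : f x = f y := by
    rcases hx with hx | ⟨hx, -⟩ <;> rcases hy with hy | ⟨hy, -⟩ <;> nlinarith
  rw [hf] at hx hy
  have hg : g x = g y := by
    rcases hx with hx | ⟨-, hx⟩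
    · nlinarith
    rcases hy with hy | ⟨-, hy⟩ <;> nlinarith
  constructor
  · exact hfg x (by rw [hf]; ring) (by rw [hg]; ring)
  · exact hfg y (by rw [hf]; ring) (by rw [hg]; ring)

/-- A point with points of the hull on a horizontal ray, on a vertical ray, and in the opposite
open quadrant lies in the interior of the hull. -/
theorem mem_interior_hull {P : List Point} {p q₁ q₂ q₃ : Point} (h₁ : q₁ ∈ hull P)
    (h₂ : q₂ ∈ hull P) (h₃ : q₃ ∈ hull P) (e₁ : q₁.2 = p.2) (e₂ : q₂.1 = p.1)
    (hx : (q₁.1 - p.1) * (q₃.1 - p.1) < 0) (hy : (q₂.2 - p.2) * (q₃.2 - p.2) < 0) :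
    p ∈ interior (hull P) := by
  set s := q₁.1 - p.1 with hs
  set t := q₂.2 - p.2 with ht
  set a := q₃.1 - p.1 with ha
  set b := q₃.2 - p.2 with hb
  have hs0 : s ≠ 0 := by rintro h; simp [h] at hx
  have ht0 : t ≠ 0 := by rintro h; simp [h] at hy
  have has : a / s < 0 := by
    rw [div_neg_iff]; rcases mul_neg_iff.1 hx with h | h <;> tauto
  have hbt : b / t < 0 := by
    rw [div_neg_iff]; rcases mul_neg_iff.1 hy with h | h <;> tauto
  set N := 1 - a / s - b / t with hN
  have hN0 : 0 < N := by linarith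
  -- `l₁`, `l₂`, `τ` are the barycentric coordinates with respect to the triangle `q₁`, `q₂`, `q₃`.
  -- They are continuous, and positive at `p` because `a / s` and `b / t` are negative; hence a
  -- neighbourhood of `p` lies in the triangle.
  let τ : Point → ℝ := fun z => (1 - (z.1 - p.1) / s - (z.2 - p.2) / t) / N
  let l₁ : Point → ℝ := fun z => ((z.1 - p.1) - τ z * a) / s
  let l₂ : Point → ℝ := fun z => ((z.2 - p.2) - τ z * b) / t
  have hτ : Continuous τ := by fun_prop
  have hl₁ : Continuous l₁ := by fun_prop
  have hl₂ : Continuous l₂ := by fun_prop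
  refine mem_interior.2 ⟨{z | 0 < τ z} ∩ ({z | 0 < l₁ z} ∩ {z | 0 < l₂ z}), ?_, ?_, ?_⟩
  · rintro z ⟨hz0, hz1, hz2⟩
    simp only [Set.mem_ofPred_eq] at hz0 hz1 hz2
    have hsum : l₁ z + l₂ z + τ z = 1 := by
      have h1 : τ z * N = 1 - (z.1 - p.1) / s - (z.2 - p.2) / t :=
        div_mul_cancel₀ _ hN0.ne'
      have h2 : l₁ z + l₂ z + τ z = (z.1 - p.1) / s + (z.2 - p.2) / t + τ z * N := by
        simp only [l₁, l₂, hN]; ring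
      rw [h2, h1]; ring
    have hl1 : l₁ z * s = (z.1 - p.1) - τ z * a := div_mul_cancel₀ _ hs0
    have hl2 : l₂ z * t = (z.2 - p.2) - τ z * b := div_mul_cancel₀ _ ht0
    have hcomb : z = l₁ z • q₁ + l₂ z • q₂ + τ z • q₃ := by
      have e1 : q₁.1 = p.1 + s := by linarith
      have e2 : q₂.2 = p.2 + t := by linarith
      have e3 : q₃.1 = p.1 + a := by linarith
      have e4 : q₃.2 = p.2 + b := by linarith
      ext
      · simp only [Prod.fst_add, Prod.smul_fst, smul_eq_mul, e₂, e1, e3]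
        linear_combination -p.1 * hsum - hl1
      · simp only [Prod.snd_add, Prod.smul_snd, smul_eq_mul, e₁, e2, e4]
        linear_combination -p.2 * hsum - hl2
    have hconv : Convex ℝ (hull P) := convex_convexHull ℝ _
    rw [hcomb]
    have h12 : (l₁ z / (l₁ z + l₂ z)) • q₁ + (l₂ z / (l₁ z + l₂ z)) • q₂ ∈ hull P :=
      hconv h₁ h₂ (by positivity) (by positivity) (by field_simp)
    have := hconv h12 h₃ (a := l₁ z + l₂ z) (b := τ z) (by positivity) hz0.le hsum
    have hne : l₁ z + l₂ z ≠ 0 := by positivity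
    rwa [smul_add, smul_smul, smul_smul, mul_div_cancel₀ _ hne, mul_div_cancel₀ _ hne] at this
  · exact (isOpen_lt continuous_const hτ).inter
      ((isOpen_lt continuous_const hl₁).inter (isOpen_lt continuous_const hl₂))
  · have h0 : τ p = 1 / N := by simp [τ]
    have hpos : 0 < 1 / N := by positivity
    refine ⟨by simp [h0, hN0], ?_, ?_⟩
    · have : l₁ p = 1 / N * -(a / s) := by simp only [l₁, h0]; ring
      simp only [Set.mem_ofPred_eq, this]
      exact mul_pos hpos (by linarith)
    · have : l₂ p = 1 / N * -(b / t) := by simp only [l₂, h0]; ring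
      simp only [Set.mem_ofPred_eq, this]
      exact mul_pos hpos (by linarith)

/-- A point with points of the hull in all four open quadrants, the upper ones at the same
height, lies in the interior of the hull. -/
theorem mem_interior_hull_of_quadrants {P : List Point} {p a b c d : Point} (ha : a ∈ hull P)
    (hb : b ∈ hull P) (hc : c ∈ hull P) (hd : d ∈ hull P) (hab : a.2 = b.2) (ha1 : a.1 < p.1)
    (hb1 : p.1 < b.1) (hb2 : p.2 < b.2) (hc1 : c.1 < p.1) (hc2 : c.2 < p.2) (hd1 : p.1 < d.1)
    (hd2 : d.2 < p.2) : p ∈ interior (hull P) := by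
  have hconv : Convex ℝ (hull P) := convex_convexHull ℝ _
  -- The left side `ca` is cut at the height of `p` and the upper side `ab` at the abscissa of `p`;
  -- with `d` as third point `mem_interior_hull` applies.
  have h₁ : ((a.2 - p.2) / (a.2 - c.2)) • c + ((p.2 - c.2) / (a.2 - c.2)) • a ∈ hull P := by
    have : 0 < a.2 - c.2 := by linarith
    refine hconv hc ha (div_nonneg (by linarith) this.le) (div_nonneg (by linarith) this.le) ?_
    field_simp; ring
  have h₂ : ((p.1 - a.1) / (b.1 - a.1)) • b + ((b.1 - p.1) / (b.1 - a.1)) • a ∈ hull P := by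
    have : 0 < b.1 - a.1 := by linarith
    refine hconv hb ha (div_nonneg (by linarith) this.le) (div_nonneg (by linarith) this.le) ?_
    field_simp; ring
  have hac : 0 < a.2 - c.2 := by linarith
  have hba : 0 < b.1 - a.1 := by linarith
  refine mem_interior_hull h₁ h₂ hd ?_ ?_ ?_ ?_
  · simp; field_simp; ring
  · simp; field_simp; ring
  · refine mul_neg_of_neg_of_pos ?_ (by linarith)
    have : (a.2 - p.2) / (a.2 - c.2) * c.1 + (p.2 - c.2) / (a.2 - c.2) * a.1 < p.1 := by
      rw [div_mul_eq_mul_div, div_mul_eq_mul_div, ← add_div, div_lt_iff₀ hac]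
      nlinarith
    simpa using this
  · refine mul_neg_of_pos_of_neg ?_ (by linarith)
    have : p.2 < (p.1 - a.1) / (b.1 - a.1) * b.2 + (b.1 - p.1) / (b.1 - a.1) * a.2 := by
      rw [hab, div_mul_eq_mul_div, div_mul_eq_mul_div, ← add_div, lt_div_iff₀ hba]
      nlinarith
    simpa using this

/-! ### Nested combs -/

/-- The edge vectors of the upper boundary of a comb with the columns on either side given from
outside to inside; the list contains the width of the column and the height of the step to the next
one. The steps go alternately down and up, first in the direction `-σ`. -/
def nest (σ c : ℝ) : List (ℝ × ℝ) → List Point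
  | [] => [(c, 0)]
  | (t, d) :: l => (t, 0) :: (0, -(σ * d)) :: (nest (-σ) c l ++ [(0, σ * d), (t, 0)])

/-- The widths are positive; the steps decrease, starting below `D`, and are positive. -/
def Nested : ℝ → List (ℝ × ℝ) → Prop
  | D, [] => 0 < D
  | D, (t, d) :: l => 0 < t ∧ d < D ∧ Nested d l

theorem Nested.pos {D : ℝ} {l : List (ℝ × ℝ)} (h : Nested D l) : 0 < D := by
  induction l generalizing D with
  | nil => exact h
  | cons a l ih => exact (ih h.2.2).trans h.2.1

/-- The word is a palindrome up to the signs of its vertical steps. This is what makes a turned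
nested comb a nested comb again. -/
theorem reverse_nest (σ c : ℝ) (l : List (ℝ × ℝ)) : (nest σ c l).reverse = nest (-σ) c l := by
  induction l generalizing σ with
  | nil => rfl
  | cons a l ih => simp [nest, ih]

theorem sum_nest_snd (σ c : ℝ) (l : List (ℝ × ℝ)) : (nest σ c l).sum.2 = 0 := by
  induction l generalizing σ with
  | nil => simp [nest]
  | cons a l ih => simp [nest, ih]

theorem sum_nest_fst_pos {σ c D : ℝ} {l : List (ℝ × ℝ)} (hc : 0 < c) (h : Nested D l) :
    0 < (nest σ c l).sum.1 := by
  induction l generalizing σ D with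
  | nil => simpa [nest]
  | cons a l ih =>
    have := ih (σ := -σ) h.2.2
    have := h.1
    simp [nest]
    positivity

/-- After a step of size `d` the inner nest starts in the opposite direction and stays strictly
within distance `d`, so the walk does not come back to the initial level before the closing step; by
induction it stays in a strip on one side. -/
theorem nest_bounds {σ c D : ℝ} {l : List (ℝ × ℝ)} {p q : Point} (hc : 0 < c) (h : Nested D l)
    (hσ : σ * σ = 1) (hq : q ∈ path p (nest σ c l)) :
    p.1 ≤ q.1 ∧ q.1 < p.1 + (nest σ c l).sum.1 ∧ 0 ≤ σ * (p.2 - q.2) ∧ σ * (p.2 - q.2) < D := by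
  induction l generalizing σ D p with
  | nil =>
    simp [nest] at hq
    subst hq
    simpa [nest] using ⟨hc, h⟩
  | cons a l ih =>
    obtain ⟨t, d⟩ := a
    have ht : 0 < t := h.1
    have hd : d < D := h.2.1
    have hd0 := h.2.2.pos
    have hs := sum_nest_fst_pos (σ := -σ) hc h.2.2
    have hs2 := sum_nest_snd (-σ) c l
    simp only [nest, path_cons, path_append, List.mem_cons, List.mem_append, path_nil,
      List.not_mem_nil, or_false] at hq
    simp only [nest, List.sum_cons, List.sum_append, Prod.fst_add, List.sum_nil, Prod.fst_zero]
    rcases hq with rfl | rfl | hq | rfl | rfl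
    · refine ⟨le_rfl, by linarith, by simp, by simp; linarith⟩
    · refine ⟨by simp; linarith, by simp; linarith, by simp, by simp; linarith⟩
    · obtain ⟨h1, h2, h3, h4⟩ := ih h.2.2 (by linarith) hq
      simp only [Prod.fst_add, Prod.snd_add] at h1 h2 h3 h4
      have : σ * (σ * d) = d := by rw [← mul_assoc, hσ, one_mul]
      have : -σ * (p.2 + 0 + -(σ * d) - q.2) = d - σ * (p.2 - q.2) := by linear_combination this
      rw [this] at h3 h4
      exact ⟨by linarith, by linarith, by linarith, by linarith⟩
    · refine ⟨by simp; linarith, by simp; linarith, ?_, ?_⟩ <;> simp [hs2, ← mul_assoc, hσ] <;>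
        linarith
    · refine ⟨by simp; linarith, by simp; linarith, ?_, ?_⟩
      · simp [hs2]
      · simp [hs2]; linarith

/-- The edge vectors of the top of a comb, from the upper left to the upper right corner: a
single edge, or a nested comb with outer teeth of arbitrary width; `j` is the depth of the
nesting, and all gaps are shallower than `D`. -/
def IsTop (D : ℝ) (T : List Point) (j : ℕ) : Prop :=
  (j = 0 ∧ ∃ c : ℝ, 0 < c ∧ T = [(c, 0)]) ∨
  ∃ (t t' d c : ℝ) (l : List (ℝ × ℝ)), 0 < t ∧ 0 < t' ∧ 0 < c ∧ d < D ∧ Nested d l ∧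
    T = (t, 0) :: (0, -d) :: (nest (-1) c l ++ [(0, d), (t', 0)]) ∧ j = l.length + 1

theorem isTop_nest {c D : ℝ} {l : List (ℝ × ℝ)} (hc : 0 < c) (h : Nested D l) :
    IsTop D (nest 1 c l) l.length := by
  cases l with
  | nil => exact Or.inl ⟨rfl, c, hc, rfl⟩
  | cons a l =>
    exact Or.inr ⟨a.1, a.1, a.2, c, l, h.1, h.1, hc, h.2.1, h.2.2, by simp [nest], rfl⟩

/-- A flipturn in the adjacent staircase may lengthen the first edge of the top; the width of an
outer tooth is irrelevant, so the result is still a top of the same depth. -/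
theorem IsTop.exists_cons {D : ℝ} {T : List Point} {j : ℕ} (h : IsTop D T j) :
    ∃ r T', T = r :: T' ∧ IsR r ∧ ∀ s, IsR s → IsTop D (s :: T') j := by
  rcases h with ⟨rfl, c, hc, rfl⟩ | ⟨t, t', d, c, l, ht, ht', hc, hd, hl, rfl, rfl⟩
  · exact ⟨_, _, rfl, ⟨hc, rfl⟩, fun s hs => Or.inl ⟨rfl, s.1, hs.1, by simp [← hs.2]⟩⟩
  · exact ⟨_, _, rfl, ⟨ht, rfl⟩, fun s hs =>
      Or.inr ⟨s.1, t', d, c, l, hs.1, ht', hc, hd, hl, by simp [← hs.2], rfl⟩⟩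

theorem IsTop.exists_append {D : ℝ} {T : List Point} {j : ℕ} (h : IsTop D T j) :
    ∃ T' r, T = T' ++ [r] ∧ IsR r ∧ ∀ s, IsR s → IsTop D (T' ++ [s]) j := by
  rcases h with ⟨rfl, c, hc, rfl⟩ | ⟨t, t', d, c, l, ht, ht', hc, hd, hl, rfl, rfl⟩
  · exact ⟨[], _, rfl, ⟨hc, rfl⟩, fun s hs => Or.inl ⟨rfl, s.1, hs.1, by simp [← hs.2]⟩⟩
  · exact ⟨(t, 0) :: (0, -d) :: (nest (-1) c l ++ [(0, d)]), (t', 0), by simp, ⟨ht', rfl⟩, fun s hs =>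
      Or.inr ⟨t, s.1, d, c, l, ht, hs.1, hc, hd, hl, by simp [← hs.2], rfl⟩⟩

theorem IsTop.sum_snd {D : ℝ} {T : List Point} {j : ℕ} (h : IsTop D T j) : T.sum.2 = 0 := by
  rcases h with ⟨rfl, c, hc, rfl⟩ | ⟨t, t', d, c, l, ht, ht', hc, hd, hl, rfl, rfl⟩
  · simp
  · simp [sum_nest_snd]

theorem IsTop.sum_fst_pos {D : ℝ} {T : List Point} {j : ℕ} (h : IsTop D T j) : 0 < T.sum.1 := by
  rcases h with ⟨rfl, c, hc, rfl⟩ | ⟨t, t', d, c, l, ht, ht', hc, hd, hl, rfl, rfl⟩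
  · simpa
  · have := sum_nest_fst_pos (σ := -1) hc hl
    simp
    positivity

theorem IsTop.bounds {D : ℝ} {T : List Point} {j : ℕ} (h : IsTop D T j) (hD : 0 < D)
    {p q : Point} (hq : q ∈ path p T) :
    p.1 ≤ q.1 ∧ q.1 < p.1 + T.sum.1 ∧ p.2 - D < q.2 ∧ q.2 ≤ p.2 := by
  rcases h with ⟨rfl, c, hc, rfl⟩ | ⟨t, t', d, c, l, ht, ht', hc, hd, hl, rfl, rfl⟩
  · simp at hq
    subst hq
    simpa using ⟨hc, hD⟩
  · have hs := sum_nest_fst_pos (σ := -1) hc hl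
    have hd0 := hl.pos
    simp only [path_cons, path_append, List.mem_cons, List.mem_append, path_nil,
      List.not_mem_nil, or_false] at hq
    simp only [List.sum_cons, List.sum_append, Prod.fst_add, List.sum_nil, Prod.fst_zero]
    have hs2 := sum_nest_snd (-1) c l
    rcases hq with rfl | rfl | hq | rfl | rfl
    · refine ⟨le_rfl, by linarith, by linarith, by linarith⟩
    · simp; refine ⟨by linarith, by linarith, by linarith⟩
    · obtain ⟨h1, h2, h3, h4⟩ := nest_bounds hc hl (by norm_num) hq
      simp only [Prod.fst_add, Prod.snd_add] at h1 h2 h3 h4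
      refine ⟨by linarith, by linarith, by linarith, by linarith⟩
    all_goals
      simp [hs2]
      refine ⟨by linarith, by linarith, ?_⟩
      first | constructor <;> linarith | linarith

/-! ### The polygons that arise from combs -/

/-- The closed word of edge vectors with the given left stairs, top, right stairs, notch, and
bottom edge. -/
def combWord (A T B N : List Point) (c : Point) : List Point :=
  A ++ (T ++ (B ++ (N ++ [c])))

/-- The polygons that arise from combs by flipturns: `A` is an ascending staircase, `T` the top,
`B` a descending staircase, `N` a notch of height `β` or empty, and `c` the bottom edge. -/
structure Shape (A T B N : List Point) (c : Point) (j : ℕ) (β : ℝ) : Prop where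
  sum_zero : (combWord A T B N c).sum = 0
  chain : ((-1, 0) :: combWord A T B N c : List Point).IsChain Alt
  dirA : ∀ e ∈ A, IsR e ∨ IsU e
  dirB : ∀ e ∈ B, IsR e ∨ IsD e
  lt_head : ∀ e ∈ A.head?, β < e.2
  top : IsTop (A.sum.2 - β) T j
  notch : (N = [] ∧ β = 0) ∨ ∃ u : ℝ, 0 < u ∧ 0 < β ∧ N = [(-u, 0), (0, -β)]
  left : IsL c

theorem sum_of_up {w : List Point} (h : ∀ e ∈ w, IsR e ∨ IsU e) : 0 ≤ w.sum.1 ∧ 0 ≤ w.sum.2 := by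
  induction w with
  | nil => simp
  | cons e w ih =>
    have h1 := ih fun f hf => h f (by simp [hf])
    simp only [List.sum_cons, Prod.fst_add, Prod.snd_add]
    rcases h e (by simp) with ⟨h2, h3⟩ | ⟨h2, h3⟩ <;> constructor <;> linarith

theorem sum_of_down {w : List Point} (h : ∀ e ∈ w, IsR e ∨ IsD e) :
    0 ≤ w.sum.1 ∧ w.sum.2 ≤ 0 := by
  induction w with
  | nil => simp
  | cons e w ih =>
    have h1 := ih fun f hf => h f (by simp [hf])
    simp only [List.sum_cons, Prod.fst_add, Prod.snd_add]
    rcases h e (by simp) with ⟨h2, h3⟩ | ⟨h2, h3⟩ <;> constructor <;> linarith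

theorem Alt.isU {e f : Point} (h : Alt e f) (he : IsR e ∨ IsU e) (hf : f.2 = 0) : IsU e := by
  rcases he with he | he
  · rcases h with h | h
    · exact absurd h.1 he.1.ne'
    · exact absurd hf h.2.2.2
  · exact he

theorem Alt.isD {e f : Point} (h : Alt e f) (he : IsR e ∨ IsD e) (hf : f.2 = 0) : IsD e := by
  rcases he with he | he
  · rcases h with h | h
    · exact absurd h.1 he.1.ne'
    · exact absurd hf h.2.2.2
  · exact he

theorem Alt.isR_of_up {e f : Point} (h : Alt e f) (he : IsR e ∨ IsU e) (hf : f.1 = 0) : IsR e := by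
  rcases he with he | he
  · exact he
  · rcases h with h | h
    · exact absurd hf h.2.2.1
    · exact absurd he.1 h.1

theorem Alt.isR_of_down {e f : Point} (h : Alt e f) (he : IsR e ∨ IsD e) (hf : f.1 = 0) :
    IsR e := by
  rcases he with he | he
  · exact he
  · rcases h with h | h
    · exact absurd hf h.2.2.1
    · exact absurd he.1 h.1

theorem alt_of_isChain_append {X Y : List Point} {e f : Point}
    (h : (X ++ e :: f :: Y).IsChain Alt) : Alt e f :=
  (List.isChain_append_cons_cons.1 h).2.1

/-- Before a horizontal edge a staircase must end with a vertical one, hence it rises strictly. -/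
theorem sum_snd_pos {w Z : List Point} {r : Point} (h : ∀ e ∈ w, IsR e ∨ IsU e) (hw : w ≠ [])
    (hc : (w ++ r :: Z).IsChain Alt) (hr : r.2 = 0) : 0 < w.sum.2 := by
  obtain ⟨x, f, rfl⟩ := List.eq_nil_or_concat' w |>.resolve_left hw
  rw [List.append_assoc] at hc
  have hf := (alt_of_isChain_append hc).isU (h f (by simp)) hr
  have := (sum_of_up (w := x) fun e he => h e (by simp [he])).2
  simp
  linarith [hf.2]

theorem sum_snd_neg {w Z : List Point} {r : Point} (h : ∀ e ∈ w, IsR e ∨ IsD e) (hw : w ≠ [])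
    (hc : (w ++ r :: Z).IsChain Alt) (hr : r.2 = 0) : w.sum.2 < 0 := by
  obtain ⟨x, f, rfl⟩ := List.eq_nil_or_concat' w |>.resolve_left hw
  rw [List.append_assoc] at hc
  have hf := (alt_of_isChain_append hc).isD (h f (by simp)) hr
  have := (sum_of_down (w := x) fun e he => h e (by simp [he])).2
  simp
  linarith [hf.2]

theorem sum_fst_pos {w Z : List Point} {d : Point} (h : ∀ e ∈ w, IsR e ∨ IsD e) (hw : w ≠ [])
    (hc : (w ++ d :: Z).IsChain Alt) (hd : d.1 = 0) : 0 < w.sum.1 := by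
  obtain ⟨x, f, rfl⟩ := List.eq_nil_or_concat' w |>.resolve_left hw
  rw [List.append_assoc] at hc
  have hf := (alt_of_isChain_append hc).isR_of_down (h f (by simp)) hd
  have := (sum_of_down (w := x) fun e he => h e (by simp [he])).1
  simp
  linarith [hf.1]

/-! ### Ends of the staircases and coordinate bounds -/

namespace Shape

variable {A T B N : List Point} {c : Point} {j : ℕ} {β : ℝ}

theorem exists_bottom (h : Shape A T B N c j β) : ∃ l Y, N ++ [c] = l :: Y ∧ IsL l := by
  rcases h.notch with ⟨rfl, -⟩ | ⟨u, hu, -, rfl⟩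
  · exact ⟨c, [], rfl, h.left⟩
  · exact ⟨_, _, rfl, by simpa [IsL]⟩

/-- The left staircase lies between the bottom edge, represented by `(-1, 0)`, and the first edge of
the top. Both are horizontal, so by alternation it is nonempty and starts, as well as ends, with a
vertical edge. -/
theorem exists_A_cons (h : Shape A T B N c j β) :
    ∃ u A', A = u :: A' ∧ IsU u ∧ β < u.2 := by
  obtain ⟨r, T', rfl, hr, -⟩ := h.top.exists_cons
  have hc := h.chain
  cases A with
  | nil =>
    have := (List.isChain_cons_cons.1 hc).1
    simp [Alt, hr.2] at this
  | cons u A' =>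
    refine ⟨u, A', rfl, ?_, h.lt_head u (by simp)⟩
    exact (List.isChain_cons_cons.1 hc).1.symm.isU (h.dirA u (by simp)) rfl

theorem exists_A_append (h : Shape A T B N c j β) : ∃ A' u, A = A' ++ [u] ∧ IsU u := by
  obtain ⟨r, T', rfl, hr, -⟩ := h.top.exists_cons
  obtain ⟨u₀, A₀, rfl, -, -⟩ := h.exists_A_cons
  obtain ⟨A', u, hA⟩ := List.eq_nil_or_concat' (u₀ :: A₀) |>.resolve_left (by simp)
  refine ⟨A', u, hA, ?_⟩
  have hc := h.chain
  rw [combWord, hA, List.append_assoc, ← List.cons_append] at hc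
  exact (alt_of_isChain_append hc).isU (h.dirA u (by simp [hA])) hr.2

theorem exists_B_cons (h : Shape A T B N c j β) : ∃ d B', B = d :: B' ∧ IsD d := by
  obtain ⟨T', r, rfl, hr, -⟩ := h.top.exists_append
  have hc := h.chain
  have e : ∀ Z, (-1, 0) :: (A ++ (T' ++ [r] ++ Z)) = ((-1, 0) :: A ++ T') ++ r :: Z := by simp
  rw [combWord, e] at hc
  cases B with
  | nil =>
    obtain ⟨l, Y, hl, hl'⟩ := h.exists_bottom
    rw [List.nil_append, hl] at hc
    have := alt_of_isChain_append hc
    simp [Alt, hl'.2, hr.2] at this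
  | cons d B' =>
    exact ⟨d, B', rfl, (alt_of_isChain_append hc).symm.isD (h.dirB d (by simp)) hr.2⟩

theorem exists_B_append (h : Shape A T B N c j β) : ∃ B' d, B = B' ++ [d] ∧ IsD d := by
  obtain ⟨d₀, B₀, rfl, -⟩ := h.exists_B_cons
  obtain ⟨B', d, hB⟩ := List.eq_nil_or_concat' (d₀ :: B₀) |>.resolve_left (by simp)
  refine ⟨B', d, hB, ?_⟩
  obtain ⟨l, Y, hl, hl'⟩ := h.exists_bottom
  have hc := h.chain
  have e : (-1, 0) :: (A ++ (T ++ (B' ++ [d] ++ l :: Y))) =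
    ((-1, 0) :: A ++ T ++ B') ++ d :: l :: Y := by simp
  rw [combWord, hB, hl, e] at hc
  exact (alt_of_isChain_append hc).isD (h.dirB d (by simp [hB])) hl'.2

theorem beta_nonneg (h : Shape A T B N c j β) : 0 ≤ β := by
  rcases h.notch with ⟨-, h⟩ | ⟨u, -, h, -⟩ <;> linarith

theorem sum_N (h : Shape A T B N c j β) : N.sum.1 ≤ 0 ∧ N.sum.2 = -β := by
  rcases h.notch with ⟨rfl, rfl⟩ | ⟨u, hu, hβ, rfl⟩
  · simp
  · simp; linarith

theorem sum_B (h : Shape A T B N c j β) : B.sum.2 = β - A.sum.2 := by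
  have h1 := congrArg Prod.snd h.sum_zero
  have h2 := h.top.sum_snd
  have h3 := h.sum_N.2
  have h4 := h.left.2
  simp [combWord] at h1
  linarith

theorem sum_fst (h : Shape A T B N c j β) :
    A.sum.1 + T.sum.1 + B.sum.1 + N.sum.1 = -c.1 := by
  have h1 := congrArg Prod.fst h.sum_zero
  simp [combWord] at h1
  linarith

theorem sum_eq (h : Shape A T B N c j β) : A.sum + T.sum + B.sum + N.sum = -c := by
  have h1 := h.sum_zero
  simp only [combWord, List.sum_append, List.sum_cons, List.sum_nil, add_zero] at h1
  rw [eq_neg_iff_add_eq_zero, ← h1]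
  abel

/-- The lower bound `β` holds because already the first edge rises above the notch. The last clause
reflects that the second edge leaves the line `x = 0` for good. -/
theorem A_bounds (h : Shape A T B N c j β) {q : Point} (hq : q ∈ path 0 A) :
    q = 0 ∨ (0 ≤ q.1 ∧ q.1 ≤ A.sum.1 ∧ β < q.2 ∧ q.2 < A.sum.2 ∧
      (q.1 = 0 → ∀ e ∈ A.head?, q = e)) := by
  obtain ⟨r, T', rfl, hr, -⟩ := h.top.exists_cons
  obtain ⟨u, e, v, rfl, rfl⟩ := mem_path.1 hq
  rw [zero_add]
  have hc := h.chain
  have hβ := h.lt_head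
  cases u with
  | nil => exact Or.inl rfl
  | cons f u =>
    right
    have h1 := sum_of_up (w := u) fun e he => h.dirA e (by simp [he])
    have h2 := sum_of_up (w := e :: v) fun e he => h.dirA e (by simp at he ⊢; tauto)
    have hf : IsU f := (List.isChain_cons_cons.1 hc).1.symm.isU (h.dirA f (by simp)) rfl
    have h3 : 0 < (e :: v).sum.2 := by
      refine sum_snd_pos (r := r) (Z := T' ++ (B ++ (N ++ [c])))
        (fun e he => h.dirA e (by simp at he ⊢; tauto)) (by simp) ?_ hr.2
      have e : ((-1, 0) :: combWord (f :: u ++ e :: v) (r :: T') B N c) =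
        ((-1, 0) :: f :: u) ++ ((e :: v) ++ r :: (T' ++ (B ++ (N ++ [c])))) := by
        simp [combWord]
      rw [e] at hc
      exact hc.right_of_append
    have h4 := hβ f (by simp)
    have e2 : (f :: u ++ e :: v).sum = (f :: u).sum + (e :: v).sum := by rw [List.sum_append]
    rw [e2]
    simp only [List.sum_cons, Prod.fst_add, Prod.snd_add] at h1 h2 h3 ⊢
    refine ⟨by linarith [hf.1], by linarith [hf.1], by linarith, by linarith, fun h0 => ?_⟩
    cases u with
    | nil => simp
    | cons g u =>
      exfalso
      have hg : IsR g :=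
        (alt_of_isChain_append (X := [(-1, 0)]) hc).symm.isR_of_up (h.dirA g (by simp)) hf.1
      have h5 := sum_of_up (w := u) fun e he => h.dirA e (by simp [he])
      simp at h0
      linarith [hg.1, hf.1]

theorem beta_lt (h : Shape A T B N c j β) : β < A.sum.2 := by
  obtain ⟨u, A', rfl, hu, hβ⟩ := h.exists_A_cons
  have h1 := sum_of_up (w := A') fun e he => h.dirA e (by simp [he])
  simp
  linarith

theorem T_bounds (h : Shape A T B N c j β) {q : Point} (hq : q ∈ path A.sum T) :
    A.sum.1 ≤ q.1 ∧ q.1 < A.sum.1 + T.sum.1 ∧ β < q.2 ∧ q.2 ≤ A.sum.2 := by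
  have := h.top.bounds (by linarith [h.beta_lt]) hq
  refine ⟨this.1, this.2.1, by linarith, this.2.2.2⟩

/-- The last two clauses locate the contacts with the bounding box: the first edge descends from the
top line at once, and only the last edge runs along the right side. -/
theorem B_bounds (h : Shape A T B N c j β) {q : Point} (hq : q ∈ path (A.sum + T.sum) B) :
    A.sum.1 + T.sum.1 ≤ q.1 ∧ q.1 ≤ A.sum.1 + T.sum.1 + B.sum.1 ∧ β < q.2 ∧ q.2 ≤ A.sum.2 ∧
      (q.2 = A.sum.2 → q = A.sum + T.sum) ∧
      (q.1 = A.sum.1 + T.sum.1 + B.sum.1 → ∀ d ∈ B.getLast?, q + d = A.sum + T.sum + B.sum) := by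
  obtain ⟨l, Y, hl, hl'⟩ := h.exists_bottom
  have hsB := h.sum_B
  have hsT := h.top.sum_snd
  obtain ⟨d₀, B₀, hB₀, hd₀⟩ := h.exists_B_cons
  obtain ⟨B₁, d₁, hB₁, hd₁⟩ := h.exists_B_append
  obtain ⟨u, e, v, rfl, rfl⟩ := mem_path.1 hq
  have hc := h.chain
  have hw : ((-1, 0) :: combWord A T (u ++ e :: v) N c) =
      ((-1, 0) :: (A ++ T ++ u)) ++ ((e :: v) ++ l :: Y) := by
    simp [combWord, hl]
  rw [hw] at hc
  replace hc := hc.right_of_append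
  have h1 := sum_of_down (w := u) fun e he => h.dirB e (by simp [he])
  have h2 := sum_of_down (w := e :: v) fun e he => h.dirB e (by simp at he ⊢; tauto)
  have h3 : (e :: v).sum.2 < 0 :=
    sum_snd_neg (fun e he => h.dirB e (by simp at he ⊢; tauto)) (by simp) hc hl'.2
  have e2 : (u ++ e :: v).sum = u.sum + (e :: v).sum := by rw [List.sum_append]
  rw [e2] at hsB ⊢
  simp only [Prod.fst_add, Prod.snd_add] at *
  refine ⟨by linarith, by linarith, by linarith, by linarith, fun h0 => ?_, fun h0 => ?_⟩
  · cases u with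
    | nil => simp
    | cons f u =>
      exfalso
      simp only [List.cons_append, List.cons.injEq] at hB₀
      have h5 := sum_of_down (w := u) fun e he => h.dirB e (by simp [he])
      simp only [List.sum_cons, Prod.snd_add] at h0
      linarith [hB₀.1 ▸ hd₀.2]
  · obtain ⟨v', f, hv⟩ := List.eq_nil_or_concat' (e :: v) |>.resolve_left (by simp)
    have hf : f = d₁ := by
      rw [hv, ← List.append_assoc] at hB₁
      simpa using (List.append_inj' hB₁ rfl).2
    subst hf
    rw [hv] at h0 hc ⊢
    have hv' : v' = [] := by
      by_contra hne
      rw [List.append_assoc] at hc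
      have h6 := sum_fst_pos (fun e he => h.dirB e (by rw [hv]; simp [he])) hne hc hd₁.1
      simp at h0
      linarith [hd₁.1]
    subst hv'
    intro d hd
    simp at hd
    simp [hd, add_assoc]

theorem N_bounds (h : Shape A T B N c j β) {q : Point} (hq : q ∈ path (A.sum + T.sum + B.sum) N) :
    0 < β ∧ q.2 = β ∧ (q = A.sum + T.sum + B.sum ∨ q.1 < A.sum.1 + T.sum.1 + B.sum.1) ∧
      -c.1 ≤ q.1 := by
  have h1 := h.sum_fst
  have h2 := h.sum_B
  have h3 := h.top.sum_snd
  rcases h.notch with ⟨rfl, -⟩ | ⟨u, hu, hβ, rfl⟩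
  · simp at hq
  · simp at hq h1
    rcases hq with rfl | rfl
    · refine ⟨hβ, ?_, Or.inl rfl, ?_⟩ <;> simp <;> linarith
    · refine ⟨hβ, ?_, Or.inr ?_, ?_⟩ <;> simp <;> linarith

theorem mem_path_combWord (h : Shape A T B N c j β) {q : Point} :
    q ∈ path 0 (combWord A T B N c) ↔ q ∈ path 0 A ∨ q ∈ path A.sum T ∨
      q ∈ path (A.sum + T.sum) B ∨ q ∈ path (A.sum + T.sum + B.sum) N ∨ q = -c := by
  simp [combWord, path_append, ← h.sum_eq]

end Shape

/-! ### Hull vertices that separate the pieces of the word -/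

theorem mem_hullVertices_fst {P : List Point} {p : Point} {σ τ : ℝ} (hσ : σ ≠ 0) (hτ : τ ≠ 0)
    (hp : p ∈ P) (h : ∀ q ∈ P, σ * q.1 ≤ σ * p.1 ∧ (q.1 = p.1 → τ * q.2 ≤ τ * p.2)) :
    p ∈ hullVertices P := by
  refine mem_hullVertices_of_lex (σ • LinearMap.fst ℝ ℝ ℝ) (τ • LinearMap.snd ℝ ℝ ℝ) hp ?_ ?_
  · intro q h1 h2
    simp [hσ, hτ] at h1 h2
    exact Prod.ext h1 h2
  · intro q hq
    obtain ⟨h1, h2⟩ := h q hq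
    rcases h1.lt_or_eq with h1 | h1
    · exact Or.inl h1
    · exact Or.inr ⟨h1, h2 (mul_left_cancel₀ hσ h1)⟩

theorem mem_hullVertices_snd {P : List Point} {p : Point} {σ τ : ℝ} (hσ : σ ≠ 0) (hτ : τ ≠ 0)
    (hp : p ∈ P) (h : ∀ q ∈ P, σ * q.2 ≤ σ * p.2 ∧ (q.2 = p.2 → τ * q.1 ≤ τ * p.1)) :
    p ∈ hullVertices P := by
  refine mem_hullVertices_of_lex (σ • LinearMap.snd ℝ ℝ ℝ) (τ • LinearMap.fst ℝ ℝ ℝ) hp ?_ ?_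
  · intro q h1 h2
    simp [hσ, hτ] at h1 h2
    exact Prod.ext h2 h1
  · intro q hq
    obtain ⟨h1, h2⟩ := h q hq
    rcases h1.lt_or_eq with h1 | h1
    · exact Or.inl h1
    · exact Or.inr ⟨h1, h2 (mul_left_cancel₀ hσ h1)⟩

theorem sum_mem_path {w u v : List Point} (h : w = u ++ v) (hv : v ≠ []) : u.sum ∈ path 0 w := by
  obtain ⟨e, v, rfl⟩ := List.exists_cons_of_ne_nil hv
  exact mem_path.2 ⟨u, e, v, h, (zero_add _).symm⟩

namespace Shape

variable {A T B N : List Point} {c : Point} {j : ℕ} {β : ℝ}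

theorem bounds (h : Shape A T B N c j β) : 0 ≤ A.sum.1 ∧ 0 ≤ B.sum.1 ∧ 0 ≤ β ∧ β < A.sum.2 ∧
    0 < T.sum.1 ∧ T.sum.2 = 0 ∧ B.sum.2 = β - A.sum.2 ∧ N.sum.1 ≤ 0 ∧ N.sum.2 = -β ∧
    A.sum.1 + T.sum.1 + B.sum.1 + N.sum.1 = -c.1 ∧ c.1 < 0 ∧ c.2 = 0 :=
  ⟨(sum_of_up h.dirA).1, (sum_of_down h.dirB).1, h.beta_nonneg, h.beta_lt, h.top.sum_fst_pos,
    h.top.sum_snd, h.sum_B, h.sum_N.1, h.sum_N.2, h.sum_fst, h.left.1, h.left.2⟩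

theorem zero_mem (h : Shape A T B N c j β) : 0 ∈ hullVertices (path 0 (combWord A T B N c)) := by
  obtain ⟨h1, h2, h3, h4, h5, h6, h7, h8, h9, h10, h11, h12⟩ := h.bounds
  refine mem_hullVertices_fst (σ := -1) (τ := -1) (by simp) (by simp)
    (sum_mem_path (u := []) rfl (by simp)) fun q hq => ?_
  simp only [Prod.fst_zero, Prod.snd_zero]
  rcases h.mem_path_combWord.1 hq with hq | hq | hq | hq | rfl
  · rcases h.A_bounds hq with rfl | hb
    · simp
    · exact ⟨by linarith, fun _ => by linarith⟩
  · have := h.T_bounds hq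
    exact ⟨by linarith, fun _ => by linarith⟩
  · have := h.B_bounds hq
    exact ⟨by linarith, fun _ => by linarith⟩
  · have := h.N_bounds hq
    exact ⟨by linarith, fun _ => by linarith⟩
  · simp only [Prod.fst_neg, Prod.snd_neg]
    exact ⟨by linarith, fun _ => by linarith⟩

theorem head_mem {u : Point} (h : Shape (u :: A) T B N c j β) :
    u ∈ hullVertices (path 0 (combWord (u :: A) T B N c)) := by
  obtain ⟨h1, h2, h3, h4, h5, h6, h7, h8, h9, h10, h11, h12⟩ := h.bounds
  have hc := h.chain
  have hu : IsU u := (List.isChain_cons_cons.1 hc).1.symm.isU (h.dirA u (by simp)) rfl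
  have hA : (u :: A).sum.1 = 0 → (u :: A).sum.2 = u.2 := by
    cases A with
    | nil => simp
    | cons r A =>
      intro h0
      have hr : IsR r :=
        (alt_of_isChain_append (X := [(-1, 0)]) hc).symm.isR_of_up (h.dirA r (by simp)) hu.1
      have := sum_of_up (w := A) fun e he => h.dirA e (by simp [he])
      simp at h0
      linarith [hr.1, hu.1]
  have hu1 := hu.1
  have hu2 := hu.2
  refine mem_hullVertices_fst (σ := -1) (τ := 1) (by simp) (by simp)
    (by
      simpa using sum_mem_path (w := combWord (u :: A) T B N c) (u := [u])
        (v := combWord A T B N c) rfl (by simp [combWord])) fun q hq => ?_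
  rcases h.mem_path_combWord.1 hq with hq | hq | hq | hq | rfl
  · rcases h.A_bounds hq with rfl | hb
    · simp only [Prod.fst_zero, Prod.snd_zero]
      exact ⟨by linarith, fun _ => by linarith⟩
    · exact ⟨by linarith, fun hq' => by
        rw [hb.2.2.2.2 (by linarith) u (by simp)]⟩
  · have := h.T_bounds hq
    refine ⟨by linarith, fun hq' => ?_⟩
    linarith [hA (by linarith)]
  · have := h.B_bounds hq
    exact ⟨by linarith, fun _ => by linarith⟩
  · have := h.N_bounds hq
    exact ⟨by linarith, fun _ => by linarith⟩
  · simp only [Prod.fst_neg, Prod.snd_neg]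
    exact ⟨by linarith, fun _ => by linarith⟩

theorem topLeft_mem (h : Shape A T B N c j β) :
    A.sum ∈ hullVertices (path 0 (combWord A T B N c)) := by
  obtain ⟨h1, h2, h3, h4, h5, h6, h7, h8, h9, h10, h11, h12⟩ := h.bounds
  refine mem_hullVertices_snd (σ := 1) (τ := -1) (by simp) (by simp)
    (sum_mem_path (u := A) rfl (by simp)) fun q hq => ?_
  rcases h.mem_path_combWord.1 hq with hq | hq | hq | hq | rfl
  · rcases h.A_bounds hq with rfl | hb
    · simp only [Prod.fst_zero, Prod.snd_zero]
      exact ⟨by linarith, fun _ => by linarith⟩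
    · exact ⟨by linarith, fun _ => by linarith⟩
  · have := h.T_bounds hq
    exact ⟨by linarith, fun _ => by linarith⟩
  · have := h.B_bounds hq
    exact ⟨by linarith, fun _ => by linarith⟩
  · have := h.N_bounds hq
    exact ⟨by linarith, fun _ => by linarith⟩
  · simp only [Prod.fst_neg, Prod.snd_neg]
    exact ⟨by linarith, fun _ => by linarith⟩

theorem topRight_mem (h : Shape A T B N c j β) :
    A.sum + T.sum ∈ hullVertices (path 0 (combWord A T B N c)) := by
  obtain ⟨h1, h2, h3, h4, h5, h6, h7, h8, h9, h10, h11, h12⟩ := h.bounds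
  refine mem_hullVertices_snd (σ := 1) (τ := 1) (by simp) (by simp)
    (by
      simpa using sum_mem_path (w := combWord A T B N c) (u := A ++ T) (v := B ++ (N ++ [c]))
        (by simp [combWord]) (by simp)) fun q hq => ?_
  simp only [Prod.fst_add, Prod.snd_add]
  rcases h.mem_path_combWord.1 hq with hq | hq | hq | hq | rfl
  · rcases h.A_bounds hq with rfl | hb
    · simp only [Prod.fst_zero, Prod.snd_zero]
      exact ⟨by linarith, fun _ => by linarith⟩
    · exact ⟨by linarith, fun _ => by linarith⟩
  · have := h.T_bounds hq
    exact ⟨by linarith, fun _ => by linarith⟩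
  · have := h.B_bounds hq
    refine ⟨by linarith, fun _ => ?_⟩
    have := congrArg Prod.fst (this.2.2.2.2.1 (by linarith))
    simp at this
    linarith
  · have := h.N_bounds hq
    exact ⟨by linarith, fun _ => by linarith⟩
  · simp only [Prod.fst_neg, Prod.snd_neg]
    exact ⟨by linarith, fun _ => by linarith⟩

/-- The last edge of the right staircase lies on the right side of the bounding box, and its upper
end is the highest vertex there. -/
theorem rightTop_mem {d : Point} (h : Shape A T (B ++ [d]) N c j β) :
    A.sum + T.sum + B.sum ∈ hullVertices (path 0 (combWord A T (B ++ [d]) N c)) := by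
  obtain ⟨h1, h2, h3, h4, h5, h6, h7, h8, h9, h10, h11, h12⟩ := h.bounds
  obtain ⟨B', d', hB', hd'⟩ := h.exists_B_append
  obtain rfl : d = d' := by simpa using (List.append_inj' hB' rfl).2
  have hd1 := hd'.1
  have hd2 := hd'.2
  refine mem_hullVertices_fst (σ := 1) (τ := 1) (by simp) (by simp)
    (by
      simpa [add_assoc] using sum_mem_path (w := combWord A T (B ++ [d]) N c)
        (u := A ++ (T ++ B)) (v := d :: (N ++ [c])) (by simp [combWord]) (by simp))
    fun q hq => ?_
  have e1 : (B ++ [d]).sum.1 = B.sum.1 := by simp [hd1]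
  have e2 : (B ++ [d]).sum.2 = B.sum.2 + d.2 := by simp
  have e3 : (A.sum + T.sum + (B ++ [d]).sum).2 = A.sum.2 + T.sum.2 + (B ++ [d]).sum.2 := rfl
  rw [e1] at h2 h10
  rw [e2] at h7 e3
  simp only [Prod.fst_add, Prod.snd_add]
  rcases h.mem_path_combWord.1 hq with hq | hq | hq | hq | rfl
  · rcases h.A_bounds hq with rfl | hb
    · simp only [Prod.fst_zero, Prod.snd_zero]
      exact ⟨by linarith, fun _ => by linarith⟩
    · exact ⟨by linarith, fun _ => by linarith⟩
  · have := h.T_bounds hq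
    exact ⟨by linarith, fun _ => by linarith⟩
  · have := h.B_bounds hq
    rw [e1] at this
    refine ⟨by linarith, fun hq' => ?_⟩
    have := congrArg Prod.snd (this.2.2.2.2.2 hq' d (by simp))
    simp at this
    linarith
  · have := h.N_bounds hq
    rw [e1] at this
    refine ⟨?_, fun _ => by linarith⟩
    rcases this.2.2.1 with rfl | h
    · simp [hd1, add_assoc]
    · linarith
  · simp only [Prod.fst_neg, Prod.snd_neg]
    exact ⟨by linarith, fun _ => by linarith⟩

theorem rightBottom_mem (h : Shape A T B N c j β) :
    A.sum + T.sum + B.sum ∈ hullVertices (path 0 (combWord A T B N c)) := by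
  obtain ⟨h1, h2, h3, h4, h5, h6, h7, h8, h9, h10, h11, h12⟩ := h.bounds
  refine mem_hullVertices_fst (σ := 1) (τ := -1) (by simp) (by simp)
    (by
      simpa [add_assoc] using sum_mem_path (w := combWord A T B N c) (u := A ++ (T ++ B))
        (v := N ++ [c]) (by simp [combWord]) (by simp)) fun q hq => ?_
  simp only [Prod.fst_add, Prod.snd_add]
  rcases h.mem_path_combWord.1 hq with hq | hq | hq | hq | rfl
  · rcases h.A_bounds hq with rfl | hb
    · simp only [Prod.fst_zero, Prod.snd_zero]
      exact ⟨by linarith, fun _ => by linarith⟩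
    · exact ⟨by linarith, fun _ => by linarith⟩
  · have := h.T_bounds hq
    exact ⟨by linarith, fun _ => by linarith⟩
  · have := h.B_bounds hq
    exact ⟨by linarith, fun _ => by linarith⟩
  · have := h.N_bounds hq
    refine ⟨?_, fun _ => by linarith⟩
    rcases this.2.2.1 with rfl | h
    · simp [add_assoc]
    · linarith
  · simp only [Prod.fst_neg, Prod.snd_neg]
    refine ⟨by linarith, fun hq' => ?_⟩
    -- Without a notch the two points have the same height; with a notch of width `u` the bottom
    -- edge ends strictly further left.
    rcases h.notch with ⟨-, hβ⟩ | ⟨u, hu, hβ, rfl⟩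
    · linarith
    · simp at h10
      linarith

theorem bottomRight_mem (h : Shape A T B N c j β) :
    -c ∈ hullVertices (path 0 (combWord A T B N c)) := by
  obtain ⟨h1, h2, h3, h4, h5, h6, h7, h8, h9, h10, h11, h12⟩ := h.bounds
  refine mem_hullVertices_snd (σ := -1) (τ := 1) (by simp) (by simp)
    (h.mem_path_combWord.2 (by simp)) fun q hq => ?_
  simp only [Prod.fst_neg, Prod.snd_neg]
  rcases h.mem_path_combWord.1 hq with hq | hq | hq | hq | rfl
  · rcases h.A_bounds hq with rfl | hb
    · simp only [Prod.fst_zero, Prod.snd_zero]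
      exact ⟨by linarith, fun _ => by linarith⟩
    · exact ⟨by linarith, fun _ => by linarith⟩
  · have := h.T_bounds hq
    exact ⟨by linarith, fun _ => by linarith⟩
  · have := h.B_bounds hq
    exact ⟨by linarith, fun _ => by linarith⟩
  · have := h.N_bounds hq
    exact ⟨by linarith, fun _ => by linarith⟩
  · simp

/-- A reflex corner of the left staircase: the preceding vertex lies to its left, the following one
above it, and the lower end of the right side is in the opposite open quadrant. Only corners where
the path turns from up to right can thus be ends of a pocket. -/
theorem interior_of_A {X Y : List Point} {r u : Point} (h : Shape A T B N c j β)
    (hA : A = X ++ r :: u :: Y) (hr : IsR r) (hu : IsU u) :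
    (X ++ [r]).sum ∈ interior (hull (path 0 (combWord A T B N c))) := by
  obtain ⟨h1, h2, h3, h4, h5, h6, h7, h8, h9, h10, h11, h12⟩ := h.bounds
  have hX := sum_of_up (w := X) fun e he => h.dirA e (by simp [hA, he])
  have hp : (X ++ [r]).sum ∈ path 0 A := sum_mem_path (v := u :: Y) (by simp [hA]) (by simp)
  have hr1 := hr.1
  have hu2 := hu.2
  have hb := (h.A_bounds hp).resolve_left fun h0 => by
    have := congrArg Prod.fst h0
    simp at this
    linarith
  refine mem_interior_hull (q₁ := X.sum) (q₂ := (X ++ [r, u]).sum)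
    (q₃ := A.sum + T.sum + B.sum)
    (subset_hull (sum_mem_path (v := r :: u :: Y ++ (T ++ (B ++ (N ++ [c]))))
      (by simp [combWord, hA]) (by simp)))
    (subset_hull (sum_mem_path (v := Y ++ (T ++ (B ++ (N ++ [c])))) (by simp [combWord, hA])
      (by simp))) h.rightBottom_mem.1 ?_ ?_ ?_ ?_
  · simp [hr.2]
  · simp [hu.1]
  · refine mul_neg_of_neg_of_pos ?_ ?_
    · simpa using hr1
    · rw [Prod.fst_add, Prod.fst_add]; linarith
  · refine mul_neg_of_pos_of_neg ?_ ?_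
    · simpa [← add_assoc] using hu2
    · rw [Prod.snd_add, Prod.snd_add]; linarith

/-- At a reflex corner of the right staircase the neighbours lie above and to the right, and the
origin is in the opposite quadrant. -/
theorem interior_of_B {X Y : List Point} {d r : Point} (h : Shape A T B N c j β)
    (hB : B = X ++ d :: r :: Y) (hd : IsD d) (hr : IsR r) :
    (A ++ (T ++ (X ++ [d]))).sum ∈ interior (hull (path 0 (combWord A T B N c))) := by
  obtain ⟨h1, h2, h3, h4, h5, h6, h7, h8, h9, h10, h11, h12⟩ := h.bounds
  have hb := h.B_bounds (q := (A ++ (T ++ (X ++ [d]))).sum)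
    (mem_path.2 ⟨X ++ [d], r, Y, by simp [hB], by simp [add_assoc]⟩)
  refine mem_interior_hull (q₁ := (A ++ (T ++ (X ++ [d, r]))).sum)
    (q₂ := (A ++ (T ++ X)).sum) (q₃ := 0)
    (subset_hull (sum_mem_path (v := Y ++ (N ++ [c])) (by simp [combWord, hB]) (by simp)))
    (subset_hull (sum_mem_path (v := d :: r :: Y ++ (N ++ [c])) (by simp [combWord, hB])
      (by simp))) h.zero_mem.1 ?_ ?_ ?_ ?_
  · simp [hr.2]
  · simp [hd.1]
  · refine mul_neg_of_pos_of_neg ?_ ?_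
    · simpa using hr.1
    · rw [Prod.fst_zero]; linarith
  · refine mul_neg_of_pos_of_neg ?_ ?_
    · simpa using hd.2
    · rw [Prod.snd_zero]; linarith

/-- The neighbours of the inner corner of the notch lie to the right and below. The opposite
quadrant contains the end of the first edge of `A`, since `lt_head` puts it above the notch. -/
theorem interior_of_N {r d : Point} (h : Shape A T B [r, d] c j β) :
    (A ++ (T ++ (B ++ [r]))).sum ∈ interior (hull (path 0 (combWord A T B [r, d] c))) := by
  obtain ⟨h1, h2, h3, h4, h5, h6, h7, h8, h9, h10, h11, h12⟩ := h.bounds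
  obtain ⟨u₀, A', rfl, hu₀, hβ⟩ := h.exists_A_cons
  obtain ⟨hN, -⟩ | ⟨u, hu, hβ0, hN⟩ := h.notch
  · exact absurd hN (by simp)
  simp only [List.cons.injEq, and_true] at hN
  obtain ⟨rfl, rfl⟩ := hN
  simp at h10
  refine mem_interior_hull (q₁ := (u₀ :: A').sum + T.sum + B.sum) (q₂ := -c) (q₃ := u₀)
    h.rightBottom_mem.1 h.bottomRight_mem.1 h.head_mem.1 ?_ ?_ ?_ ?_
  · simp [add_assoc]
  · simp; linarith
  · refine mul_neg_of_pos_of_neg ?_ ?_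
    · simp [← add_assoc]; linarith
    · simp [hu₀.1] at h10 ⊢; linarith
  · refine mul_neg_of_neg_of_pos ?_ ?_
    · simp at h7 ⊢; linarith
    · simp at h7 ⊢; linarith

/-- Apart from the ends of the two outer tooth edges, the vertices of the top lie strictly below the
top line and above the notch, and horizontally strictly between the top corners. So four hull
vertices surround them. -/
theorem interior_of_T {X Y : List Point} {t t' d k : ℝ} {l : List (ℝ × ℝ)}
    (h : Shape A T B N c j β) (ht : 0 < t) (ht' : 0 < t') (hk : 0 < k) (hl : Nested d l)
    (hT : T = (t, 0) :: (X ++ (Y ++ [(t', 0)]))) (hX : X ≠ []) (hY : Y ≠ [])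
    (hXY : X ++ Y = (0, -d) :: (nest (-1) k l ++ [(0, d)])) :
    (A ++ (t, 0) :: X).sum ∈ interior (hull (path 0 (combWord A T B N c))) := by
  obtain ⟨h1, h2, h3, h4, h5, h6, h7, h8, h9, h10, h11, h12⟩ := h.bounds
  obtain ⟨Y', y, rfl⟩ := List.eq_nil_or_concat' Y |>.resolve_left hY
  obtain ⟨x, X', rfl⟩ := List.exists_cons_of_ne_nil hX
  have hb := h.T_bounds (q := (A ++ (t, 0) :: x :: X').sum) (by
    refine mem_path.2 ?_
    cases Y' with
    | nil => exact ⟨(t, 0) :: x :: X', y, [(t', 0)], by simp [hT], by simp⟩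
    | cons z Y' =>
      exact ⟨(t, 0) :: x :: X', z, Y' ++ [y, (t', 0)], by simp [hT], by simp⟩)
  rw [← List.append_assoc] at hXY
  simp only [List.cons_append, List.cons.injEq] at hXY
  obtain ⟨rfl, hXY⟩ := hXY
  replace ⟨hXY, hy⟩ := List.append_inj' hXY rfl
  obtain rfl : y = (0, d) := by simpa using hy
  have hsum := sum_nest_snd (-1) k l
  have hpos := sum_nest_fst_pos (σ := -1) hk hl
  have hd := hl.pos
  have hTs : T.sum.1 = t + (nest (-1) k l).sum.1 + t' := by
    rw [← hXY, hT]
    simp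
    ring
  have key : 0 ≤ X'.sum.1 ∧ X'.sum.1 ≤ (nest (-1) k l).sum.1 ∧ X'.sum.2 < d := by
    cases Y' with
    | nil =>
      rw [List.append_nil] at hXY
      rw [hXY]
      exact ⟨hpos.le, le_rfl, by linarith⟩
    | cons z Y' =>
      have := nest_bounds (p := 0) hk hl (by norm_num) (sum_mem_path hXY.symm (by simp))
      simp at this
      exact ⟨by linarith, by linarith, by linarith⟩
  refine mem_interior_hull_of_quadrants h.topLeft_mem.1 h.topRight_mem.1 h.zero_mem.1
    h.rightBottom_mem.1 ?_ ?_ ?_ ?_ ?_ ?_ ?_ ?_ <;> simp at hb ⊢ <;> linarith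

end Shape

/-! ### The invariant and the effect of each flipturn on it -/

theorem Nested.mono {D E : ℝ} {l : List (ℝ × ℝ)} (h : Nested D l) (hDE : D ≤ E) : Nested E l := by
  cases l with
  | nil => exact lt_of_lt_of_le h hDE
  | cons a l => exact ⟨h.1, h.2.1.trans_le hDE, h.2.2⟩

theorem IsTop.mono {D E : ℝ} {T : List Point} {j : ℕ} (h : IsTop D T j) (hDE : D ≤ E) :
    IsTop E T j := by
  rcases h with h | ⟨t, t', d, c, l, ht, ht', hc, hd, hl, hT, hj⟩
  · exact Or.inl h
  · exact Or.inr ⟨t, t', d, c, l, ht, ht', hc, hd.trans_le hDE, hl, hT, hj⟩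

theorem mem_frontier_hull {P : List Point} {p : Point} (hp : p ∈ hull P)
    (h : ∀ q ∈ P, q.2 ≤ p.2) : p ∈ frontier (hull P) := by
  refine ⟨subset_closure hp, fun hi => ?_⟩
  have h1 : hull P ⊆ {q | q.2 ≤ p.2} := by
    refine convexHull_min h ?_
    exact convex_halfSpace_le (LinearMap.snd ℝ ℝ ℝ).isLinear p.2
  have h2 : p.2 ∈ interior (Set.Iic p.2) := by
    have h3 := isOpenMap_snd.image_interior_subset {q : ℝ × ℝ | q.2 ≤ p.2}
      (Set.mem_image_of_mem Prod.snd (interior_mono h1 hi))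
    refine interior_mono ?_ h3
    rintro _ ⟨q, hq, rfl⟩
    exact hq
  simp at h2

open List in
/-- `P` arises from a comb by flipturns, and `μ` is twice the number of flipturns that are
needed to convexify it. -/
def State (P : List Point) (μ : ℕ) : Prop :=
  ∃ A T B N c j β, Shape A T B N c j β ∧ A.length + B.length + 6 * j + N.length = μ + 2 ∧
    P ~r path 0 (combWord A T B N c)

/-- A pocket does not pass over a lid point. -/
theorem IsPocketWord.split {S : Set Point} {w w₁ w₂ w₃ X Y : List Point}
    (h : IsPocketWord S 0 w w₁ w₂ w₃) (hw : w = X ++ Y) (hX : X.sum ∈ S) :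
    (∃ C, X = w₁ ++ (w₂ ++ C) ∧ w₃ = C ++ Y) ∨ ∃ C, w₁ = X ++ C ∧ Y = C ++ (w₂ ++ w₃) := by
  rw [h.eq] at hw
  rcases List.append_eq_append_iff.1 hw with ⟨C, h1, h2⟩ | ⟨C, h1, h2⟩
  · rcases List.append_eq_append_iff.1 h2 with ⟨D, h3, h4⟩ | ⟨D, h3, h4⟩
    · exact Or.inl ⟨D, by rw [h1, h3], h4⟩
    · rcases eq_or_ne C [] with rfl | hC
      · exact Or.inr ⟨[], by simp [h1], by simp_all⟩
      rcases eq_or_ne D [] with rfl | hD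
      · exact Or.inl ⟨[], by simp_all, by simp_all⟩
      · exact absurd hX (by simpa [h1] using h.notMem C D h3 hC hD)
  · exact Or.inr ⟨C, h1, h2⟩

namespace Shape

variable {A T B N : List Point} {c : Point} {j μ : ℕ} {β : ℝ}

/-- The ends of the pocket are not reflex corners, so `p` and `b₂` point up while `b₁` and the edge
after `b₂` point right. After the reversal both pairs are collinear and merge. -/
theorem flip_A {X M C : List Point} {p b₁ b₂ : Point} (h : Shape A T B N c j β)
    (hμ : A.length + B.length + 6 * j + N.length = μ + 2)
    (hA : A = X ++ p :: b₁ :: (M ++ b₂ :: C))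
    (hl : (X ++ [p]).sum ∉ interior (hull (path 0 (combWord A T B N c))))
    (hr : (X ++ p :: b₁ :: (M ++ [b₂])).sum ∉ interior (hull (path 0 (combWord A T B N c)))) :
    ∃ μ', μ = μ' + 2 ∧ State (tidy (path 0
      (X ++ p :: b₂ :: (M.reverse ++ b₁ :: (C ++ (T ++ (B ++ (N ++ [c])))))))) μ' := by
  have hch := h.chain
  have hs := h.sum_zero
  have hpos : 0 < B.length := by
    obtain ⟨_, _, rfl, -⟩ := h.exists_B_cons
    simp
  have hdp := h.dirA p (by simp [hA])
  have hdb₁ := h.dirA b₁ (by simp [hA])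
  have hdb₂ := h.dirA b₂ (by simp [hA])
  have hpb : Alt p b₁ := by
    have e : ((-1, 0) :: combWord A T B N c : List Point) =
      ((-1, 0) :: X) ++ p :: b₁ :: (M ++ b₂ :: C ++ (T ++ (B ++ (N ++ [c])))) := by
      simp [combWord, hA]
    rw [e] at hch
    exact alt_of_isChain_append hch
  have hp : IsU p := by
    refine hdp.resolve_left fun hp => hl ?_
    refine h.interior_of_A hA hp (hdb₁.resolve_left fun hb => ?_)
    rcases hpb with h | h
    · exact hp.1.ne' h.1
    · exact h.2.2.2 hb.2
  have hb₁ : IsR b₁ := hpb.symm.isR_of_up hdb₁ hp.1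
  obtain ⟨r, T', hT, hrR, hrT⟩ := h.top.exists_cons
  -- A pocket that reaches the upper left corner is followed by the first edge of the top; then `b₁`
  -- leaves the staircase and is absorbed into the top. Otherwise both merged edges stay in the
  -- staircase.
  cases C with
  | nil =>
    have e : combWord A T B N c =
        X ++ p :: b₁ :: (M ++ b₂ :: r :: (T' ++ (B ++ (N ++ [c])))) := by
      simp [combWord, hA, hT]
    rw [e] at hch hs
    have hb₂ : IsU b₂ := by
      have e : ((-1, 0) :: (X ++ p :: b₁ :: (M ++ b₂ :: r :: (T' ++ (B ++ (N ++ [c])))))) =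
        ((-1, 0) :: X ++ p :: b₁ :: M) ++ b₂ :: r :: (T' ++ (B ++ (N ++ [c]))) := by simp
      rw [e] at hch
      exact (alt_of_isChain_append hch).isU hdb₂ hrR.2
    have hpp : SameDir p b₂ := Or.inl ⟨hp.1, hb₂.1, mul_pos hp.2 hb₂.2⟩
    have hqq : SameDir b₁ r := Or.inr ⟨hb₁.2, hrR.2, mul_pos hb₁.1 hrR.1⟩
    refine ⟨μ - 2, ?_,
      X ++ (p + b₂) :: M.reverse, (b₁ + r) :: T', B, N, c, j, β, ⟨?_, ?_, ?_, h.dirB, ?_, ?_,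
      h.notch, h.left⟩, ?_, ?_⟩
    · simp [hA] at hμ; omega
    · rw [← hs]
      simp only [combWord, List.sum_append, List.sum_cons, List.sum_reverse, List.cons_append]
      abel
    · simpa [combWord] using isChain_merge hch hpp hqq
    · intro e he
      simp only [List.mem_append, List.mem_cons, List.mem_reverse] at he
      rcases he with he | rfl | he
      · exact h.dirA e (by simp [hA, he])
      · exact Or.inr ⟨by simp [hp.1, hb₂.1], by simpa using add_pos hp.2 hb₂.2⟩
      · exact h.dirA e (by simp [hA, he])
    · intro f he
      cases X with
      | nil =>
        simp at he
        have := h.lt_head p (by simp [hA])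
        rw [← he, Prod.snd_add]
        linarith [hb₂.2]
      | cons x X => exact h.lt_head f (by simpa [hA] using he)
    · have : (X ++ (p + b₂) :: M.reverse).sum.2 = A.sum.2 := by
        simp [hA, hb₁.2, List.sum_reverse]
        ring
      rw [this]
      exact hrT _ ⟨by simpa using add_pos hb₁.1 hrR.1, by simp [hb₁.2, hrR.2]⟩
    · simp [hA] at hμ ⊢; omega
    · rw [hT, List.nil_append, List.cons_append,
        tidy_path_merge (V := r :: (T' ++ (B ++ N))) hch hs hpp hqq (by simp) h.left]
      simpa [combWord] using List.IsRotated.refl _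
  | cons q C =>
    have hdq := h.dirA q (by simp [hA])
    have e : combWord A T B N c =
        X ++ p :: b₁ :: (M ++ b₂ :: q :: (C ++ (T ++ (B ++ (N ++ [c]))))) := by
      simp [combWord, hA]
    have hbq : Alt b₂ q := by
      have e : ((-1, 0) :: combWord A T B N c : List Point) =
        ((-1, 0) :: X ++ p :: b₁ :: M) ++ b₂ :: q :: (C ++ (T ++ (B ++ (N ++ [c])))) := by
        simp [combWord, hA]
      rw [e] at hch
      exact alt_of_isChain_append hch
    have hb₂ : IsU b₂ := by
      refine hdb₂.resolve_left fun hb => hr ?_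
      have hq : IsU q := hdq.resolve_left fun hq => by
        rcases hbq with h | h
        · exact hb.1.ne' h.1
        · exact h.2.2.2 hq.2
      have := h.interior_of_A (X := X ++ p :: b₁ :: M) (Y := C) (by simp [hA]) hb hq
      simpa using this
    have hq : IsR q := hbq.symm.isR_of_up hdq hb₂.1
    rw [e] at hch hs
    have hpp : SameDir p b₂ := Or.inl ⟨hp.1, hb₂.1, mul_pos hp.2 hb₂.2⟩
    have hqq : SameDir b₁ q := Or.inr ⟨hb₁.2, hq.2, mul_pos hb₁.1 hq.1⟩
    refine ⟨μ - 2, ?_,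
      X ++ (p + b₂) :: (M.reverse ++ (b₁ + q) :: C), T, B, N, c, j, β, ⟨?_, ?_, ?_, h.dirB, ?_,
      ?_, h.notch, h.left⟩, ?_, ?_⟩
    · simp [hA] at hμ; omega
    · rw [← hs]
      simp only [combWord, List.sum_append, List.sum_cons, List.sum_reverse]
      abel
    · simpa [combWord] using isChain_merge hch hpp hqq
    · intro e he
      simp only [List.mem_append, List.mem_cons, List.mem_reverse] at he
      rcases he with he | rfl | he | rfl | he
      · exact h.dirA e (by simp [hA, he])
      · exact Or.inr ⟨by simp [hp.1, hb₂.1], by simpa using add_pos hp.2 hb₂.2⟩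
      · exact h.dirA e (by simp [hA, he])
      · exact Or.inl ⟨by simpa using add_pos hb₁.1 hq.1, by simp [hb₁.2, hq.2]⟩
      · exact h.dirA e (by simp [hA, he])
    · intro f he
      cases X with
      | nil =>
        simp at he
        have := h.lt_head p (by simp [hA])
        rw [← he, Prod.snd_add]
        linarith [hb₂.2]
      | cons x X => exact h.lt_head f (by simpa [hA] using he)
    · have : (X ++ (p + b₂) :: (M.reverse ++ (b₁ + q) :: C)).sum.2 = A.sum.2 := by
        simp [hA, List.sum_reverse]
        ring
      rw [this]
      exact h.top
    · simp [hA] at hμ ⊢; omega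
    · rw [List.cons_append, tidy_path_merge (V := q :: (C ++ (T ++ (B ++ N)))) hch hs hpp hqq
        (by simp) h.left]
      simpa [combWord] using List.IsRotated.refl _

/-- The mirror image of `flip_A`: the edge `q` after the pocket always belongs to the staircase,
whereas the edge before it may be the last edge of the top. -/
theorem flip_B {W M C : List Point} {b₁ b₂ q : Point} (h : Shape A T B N c j β)
    (hμ : A.length + B.length + 6 * j + N.length = μ + 2)
    (hB : B = W ++ b₁ :: (M ++ b₂ :: q :: C))
    (hl : (A ++ (T ++ W)).sum ∉ interior (hull (path 0 (combWord A T B N c))))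
    (hr : (A ++ (T ++ (W ++ b₁ :: (M ++ [b₂])))).sum ∉
      interior (hull (path 0 (combWord A T B N c)))) :
    ∃ μ', μ = μ' + 2 ∧ State (tidy (path 0
      (A ++ (T ++ (W ++ b₂ :: (M.reverse ++ b₁ :: q :: (C ++ (N ++ [c])))))))) μ' := by
  have hch := h.chain
  have hs := h.sum_zero
  have hpos : 0 < A.length := by
    obtain ⟨_, _, rfl, -⟩ := h.exists_A_cons
    simp
  have hdq := h.dirB q (by simp [hB])
  have hdb₁ := h.dirB b₁ (by simp [hB])
  have hdb₂ := h.dirB b₂ (by simp [hB])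
  have hbq : Alt b₂ q := by
    have e : ((-1, 0) :: combWord A T B N c : List Point) =
      ((-1, 0) :: A ++ (T ++ (W ++ b₁ :: M))) ++ b₂ :: q :: (C ++ (N ++ [c])) := by
      simp [combWord, hB]
    rw [e] at hch
    exact alt_of_isChain_append hch
  have hb₂ : IsR b₂ := by
    refine hdb₂.resolve_right fun hb => hr ?_
    have hq : IsR q := hdq.resolve_right fun hq => by
      rcases hbq with h | h
      · exact h.2.2.1 hq.1
      · exact h.1 hb.1
    have := h.interior_of_B (X := W ++ b₁ :: M) (Y := C) (by simp [hB]) hb hq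
    simpa using this
  have hq : IsD q := hbq.symm.isD hdq hb₂.2
  obtain ⟨T', r, hT, hrR, hrT⟩ := h.top.exists_append
  rcases List.eq_nil_or_concat' W with rfl | ⟨X, p, rfl⟩
  · have e : combWord A T B N c =
        (A ++ T') ++ r :: b₁ :: (M ++ b₂ :: q :: (C ++ (N ++ [c]))) := by
      simp [combWord, hB, hT]
    rw [e] at hch hs
    have hb₁ : IsD b₁ := by
      rw [← List.cons_append] at hch
      exact (alt_of_isChain_append hch).symm.isD hdb₁ hrR.2
    have hpp : SameDir r b₂ := Or.inr ⟨hrR.2, hb₂.2, mul_pos hrR.1 hb₂.1⟩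
    have hqq : SameDir b₁ q := Or.inl ⟨hb₁.1, hq.1, mul_pos_of_neg_of_neg hb₁.2 hq.2⟩
    refine ⟨μ - 2, ?_,
      A, T' ++ [r + b₂], M.reverse ++ (b₁ + q) :: C, N, c, j, β, ⟨?_, ?_, h.dirA, ?_, h.lt_head,
      ?_, h.notch, h.left⟩, ?_, ?_⟩
    · simp [hB] at hμ; omega
    · rw [← hs]
      simp only [combWord, List.sum_append, List.sum_cons, List.sum_reverse, List.sum_nil]
      abel
    · simpa [combWord] using isChain_merge hch hpp hqq
    · intro e he
      simp only [List.mem_append, List.mem_cons, List.mem_reverse] at he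
      rcases he with he | rfl | he
      · exact h.dirB e (by simp [hB, he])
      · exact Or.inr ⟨by simp [hb₁.1, hq.1], by simpa using add_neg hb₁.2 hq.2⟩
      · exact h.dirB e (by simp [hB, he])
    · exact hrT _ ⟨by simpa using add_pos hrR.1 hb₂.1, by simp [hrR.2, hb₂.2]⟩
    · simp [hB] at hμ ⊢; omega
    · have := tidy_path_merge (z := 0) (V := q :: (C ++ N)) hch hs hpp hqq (by simp) h.left
      have e : A ++ (T ++ ([] ++ b₂ :: (M.reverse ++ b₁ :: q :: (C ++ (N ++ [c]))))) =
        A ++ T' ++ r :: b₂ :: (M.reverse ++ b₁ :: q :: (C ++ (N ++ [c]))) := by simp [hT]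
      rw [e, this]
      simpa [combWord] using List.IsRotated.refl _
  · have hdp := h.dirB p (by simp [hB])
    have e : combWord A T B N c =
        (A ++ (T ++ X)) ++ p :: b₁ :: (M ++ b₂ :: q :: (C ++ (N ++ [c]))) := by
      simp [combWord, hB]
    rw [e] at hch hs
    have hpb : Alt p b₁ := by
      rw [← List.cons_append] at hch
      exact alt_of_isChain_append hch
    have hp : IsR p := by
      refine hdp.resolve_right fun hp => hl ?_
      refine h.interior_of_B (Y := M ++ b₂ :: q :: C) (by simp [hB]) hp
        (hdb₁.resolve_right fun hb => ?_)
      rcases hpb with h | h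
      · exact h.2.2.1 hb.1
      · exact h.1 hp.1
    have hb₁ : IsD b₁ := hpb.symm.isD hdb₁ hp.2
    have hpp : SameDir p b₂ := Or.inr ⟨hp.2, hb₂.2, mul_pos hp.1 hb₂.1⟩
    have hqq : SameDir b₁ q := Or.inl ⟨hb₁.1, hq.1, mul_pos_of_neg_of_neg hb₁.2 hq.2⟩
    refine ⟨μ - 2, ?_,
      A, T, X ++ (p + b₂) :: (M.reverse ++ (b₁ + q) :: C), N, c, j, β, ⟨?_, ?_, h.dirA, ?_,
      h.lt_head, h.top, h.notch, h.left⟩, ?_, ?_⟩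
    · simp [hB] at hμ; omega
    · rw [← hs]
      simp only [combWord, List.sum_append, List.sum_cons, List.sum_reverse]
      abel
    · simpa [combWord] using isChain_merge hch hpp hqq
    · intro e he
      simp only [List.mem_append, List.mem_cons, List.mem_reverse] at he
      rcases he with he | rfl | he | rfl | he
      · exact h.dirB e (by simp [hB, he])
      · exact Or.inl ⟨by simpa using add_pos hp.1 hb₂.1, by simp [hp.2, hb₂.2]⟩
      · exact h.dirB e (by simp [hB, he])
      · exact Or.inr ⟨by simp [hb₁.1, hq.1], by simpa using add_neg hb₁.2 hq.2⟩
      · exact h.dirB e (by simp [hB, he])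
    · simp [hB] at hμ ⊢; omega
    · have := tidy_path_merge (z := 0) (V := q :: (C ++ N)) hch hs hpp hqq (by simp) h.left
      have e : A ++ (T ++ (X ++ [p] ++ b₂ :: (M.reverse ++ b₁ :: q :: (C ++ (N ++ [c]))))) =
        A ++ (T ++ X) ++ p :: b₂ :: (M.reverse ++ b₁ :: q :: (C ++ (N ++ [c]))) := by simp
      rw [e, this]
      simpa [combWord] using List.IsRotated.refl _

/-- Turning the notch extends the last edge of the right staircase down to the bottom line and
lengthens the bottom edge. The height `β` becomes 0, which only relaxes the bounds on `A` and `T`.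
-/
theorem flip_N {r d : Point} (h : Shape A T B [r, d] c j β)
    (hμ : A.length + B.length + 6 * j + [r, d].length = μ + 2) :
    ∃ μ', μ = μ' + 2 ∧ State (tidy (path 0 (A ++ (T ++ (B ++ d :: r :: [c]))))) μ' := by
  have hch := h.chain
  have hs := h.sum_zero
  obtain ⟨B', p, rfl, hp⟩ := h.exists_B_append
  have hpos : 0 < A.length := by
    obtain ⟨_, _, rfl, -⟩ := h.exists_A_cons
    simp
  obtain ⟨hN, -⟩ | ⟨u, hu, hβ, hN⟩ := h.notch
  · exact absurd hN (by simp)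
  simp only [List.cons.injEq, and_true] at hN
  obtain ⟨rfl, rfl⟩ := hN
  have e : combWord A T (B' ++ [p]) [(-u, 0), (0, -β)] c =
      (A ++ (T ++ B')) ++ p :: (-u, 0) :: ([] ++ (0, -β) :: c :: []) := by
    simp [combWord]
  rw [e] at hch hs
  have hpp : SameDir p (0, -β) :=
    Or.inl ⟨hp.1, rfl, mul_pos_of_neg_of_neg hp.2 (by simpa using hβ)⟩
  have hqq : SameDir (-u, 0) c :=
    Or.inr ⟨rfl, h.left.2, mul_pos_of_neg_of_neg (by simpa using hu) h.left.1⟩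
  refine ⟨μ - 2, ?_, A, T, B' ++ [p + (0, -β)], [], (-u, 0) + c, j, 0,
    ⟨?_, ?_, h.dirA, ?_, fun e he => hβ.trans (h.lt_head e he), h.top.mono (by linarith),
    Or.inl ⟨rfl, rfl⟩, ?_⟩, ?_, ?_⟩
  · simp at hμ; omega
  · rw [← hs]
    simp only [combWord, List.sum_append, List.sum_cons, List.sum_nil,
      List.nil_append]
    abel
  · simpa [combWord] using isChain_merge hch hpp hqq
  · intro e he
    simp only [List.mem_append, List.mem_singleton] at he
    rcases he with he | rfl
    · exact h.dirB e (by simp [he])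
    · exact Or.inr ⟨by simp [hp.1], by simpa using hp.2.trans hβ⟩
  · exact ⟨by simpa using h.left.1.trans hu, by simp [h.left.2]⟩
  · simp at hμ ⊢; omega
  · have := tidy_path_merge (z := 0) (V := []) hch hs hpp hqq (by simp) h.left
    have e : A ++ (T ++ (B' ++ [p] ++ (0, -β) :: (-u, 0) :: [c])) =
      A ++ (T ++ B') ++ p :: (0, -β) :: ([].reverse ++ (-u, 0) :: c :: []) := by simp
    rw [e, this]
    simpa [combWord] using List.IsRotated.refl _

/-- The inner comb now rises above the former top line; the outer teeth and the outermost vertical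
steps join the staircases. The widths `t₁`, `t₂` are `t`, `t'` for a standard pocket and `t'`, `t`
for an extended one. -/
theorem flip_T {t t' t₁ t₂ d k : ℝ} {l : List (ℝ × ℝ)} (h : Shape A T B N c j β)
    (hμ : A.length + B.length + 6 * j + N.length = μ + 2) (ht₁ : 0 < t₁)
    (ht₂ : 0 < t₂) (hk : 0 < k) (hl : Nested d l)
    (hT : T = (t, 0) :: (0, -d) :: (nest (-1) k l ++ [(0, d), (t', 0)])) (hj : j = l.length + 1)
    (ht : t₁ + t₂ = t + t')
    (hch : ((-1, 0) :: (A ++ (t₁, 0) :: (0, d) :: (nest 1 k l ++ (0, -d) :: (t₂, 0) ::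
      (B ++ (N ++ [c])))) : List Point).IsChain Alt) :
    ∃ μ', μ = μ' + 2 ∧ State (tidy (path 0 (A ++ (t₁, 0) :: (0, d) :: (nest 1 k l ++
      (0, -d) :: (t₂, 0) :: (B ++ (N ++ [c])))))) μ' := by
  have hd := hl.pos
  have e : combWord (A ++ [(t₁, 0), (0, d)]) (nest 1 k l) ((0, -d) :: (t₂, 0) :: B) N c =
      A ++ (t₁, 0) :: (0, d) :: (nest 1 k l ++ (0, -d) :: (t₂, 0) :: (B ++ (N ++ [c]))) := by
    simp [combWord]
  have hsum : (combWord (A ++ [(t₁, 0), (0, d)]) (nest 1 k l) ((0, -d) :: (t₂, 0) :: B)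
      N c).sum = 0 := by
    have hs := h.sum_zero
    have hn := congrArg List.sum (reverse_nest (-1) k l)
    rw [List.sum_reverse, neg_neg] at hn
    rw [hT] at hs
    have h1 := congrArg Prod.fst hs
    have h2 := congrArg Prod.snd hs
    simp [combWord, hn] at h1 h2
    ext
    · simp [combWord]; linarith
    · simp [combWord]; linarith
  refine ⟨A.length + B.length + 6 * l.length + N.length + 2, by omega,
    A ++ [(t₁, 0), (0, d)], nest 1 k l, (0, -d) :: (t₂, 0) :: B, N, c, l.length, β,
    ⟨hsum, by rwa [e], ?_, ?_, ?_, ?_, h.notch, h.left⟩, ?_, ?_⟩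
  · intro e he
    simp only [List.mem_append, List.mem_cons, List.not_mem_nil, or_false] at he
    rcases he with he | rfl | rfl
    · exact h.dirA e he
    · exact Or.inl ⟨ht₁, rfl⟩
    · exact Or.inr ⟨rfl, hd⟩
  · intro e he
    simp only [List.mem_cons] at he
    rcases he with rfl | rfl | he
    · exact Or.inr ⟨rfl, by simpa using hd⟩
    · exact Or.inl ⟨ht₂, rfl⟩
    · exact h.dirB e he
  · intro f he
    obtain ⟨u, A', rfl, -⟩ := h.exists_A_cons
    exact h.lt_head f (by simpa using he)
  -- The new top line is higher by `d`, and the old one is above the notch, so the permitted depth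
  -- exceeds `d`.
  · refine isTop_nest hk (hl.mono ?_)
    simp
    linarith [h.beta_lt]
  · simp; omega
  · rw [← e]
    have e' : combWord (A ++ [(t₁, 0), (0, d)]) (nest 1 k l) ((0, -d) :: (t₂, 0) :: B) N c =
      ((A ++ [(t₁, 0), (0, d)]) ++ (nest 1 k l ++ ((0, -d) :: (t₂, 0) :: B ++ N))) ++ [c] := by
      simp [combWord]
    rw [e', tidy_path_of_isChain h.left (by rw [← e', hsum]) (by rwa [← e', e])]

end Shape

/-! ### Classification of the pockets -/

namespace Shape

variable {A T B N : List Point} {c : Point} {j μ : ℕ} {β : ℝ}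

theorem T_cases {U V : List Point} {t t' d k : ℝ} {l : List (ℝ × ℝ)}
    (h : Shape A T B N c j β) (ht : 0 < t) (ht' : 0 < t') (hk : 0 < k) (hl : Nested d l)
    (hT : T = (t, 0) :: (0, -d) :: (nest (-1) k l ++ [(0, d), (t', 0)])) (hUV : T = U ++ V)
    (hU : U ≠ []) (hV : V ≠ []) :
    U = [(t, 0)] ∨ V = [(t', 0)] ∨
      (A ++ U).sum ∈ interior (hull (path 0 (combWord A T B N c))) := by
  obtain ⟨x, X, rfl⟩ := List.exists_cons_of_ne_nil hU
  obtain ⟨Y, y, rfl⟩ := List.eq_nil_or_concat' V |>.resolve_left hV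
  have e : (t, 0) :: (0, -d) :: (nest (-1) k l ++ [(0, d), (t', 0)]) =
    ((t, 0) :: (0, -d) :: (nest (-1) k l ++ [(0, d)])) ++ [(t', 0)] := by simp
  have h1 := hT
  rw [e, hUV, ← List.append_assoc] at h1
  obtain ⟨h2, h3⟩ := List.append_inj' h1 rfl
  simp only [List.cons_append, List.cons.injEq] at h2
  obtain ⟨rfl, h2⟩ := h2
  obtain rfl : y = (t', 0) := by simpa using h3
  rcases eq_or_ne X [] with rfl | hX
  · exact Or.inl rfl
  rcases eq_or_ne Y [] with rfl | hY
  · exact Or.inr (Or.inl rfl)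
  exact Or.inr (Or.inr (h.interior_of_T ht ht' hk hl hUV hX hY h2))

/-- The inner end of an outer tooth edge lies strictly between the two top corners on a side of the
hull, so it is not extreme. -/
theorem flat_left_notMem {T' : List Point} {t : ℝ} (h : Shape A ((t, 0) :: T') B N c j β)
    (ht : 0 < t) (hT' : 0 < T'.sum.1) :
    (A ++ [(t, 0)]).sum ∉ hullVertices (path 0 (combWord A ((t, 0) :: T') B N c)) := by
  intro hmem
  have hs := h.top.sum_snd
  simp at hs
  have h1 := (mem_extremePoints.1 hmem).2 _ h.topLeft_mem.1 _ h.topRight_mem.1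
    ⟨T'.sum.1 / (t + T'.sum.1), t / (t + T'.sum.1), by positivity, by positivity,
      by field_simp; ring, by ext <;> simp [hs] <;> field_simp <;> ring⟩
  have := congrArg Prod.fst h1.1
  simp at this
  exact ht.ne' this

theorem flat_right_notMem {T' : List Point} {t : ℝ} (h : Shape A (T' ++ [(t, 0)]) B N c j β)
    (ht : 0 < t) (hT' : 0 < T'.sum.1) :
    (A ++ T').sum ∉ hullVertices (path 0 (combWord A (T' ++ [(t, 0)]) B N c)) := by
  intro hmem
  have hs := h.top.sum_snd
  simp at hs
  have h1 := (mem_extremePoints.1 hmem).2 _ h.topLeft_mem.1 _ h.topRight_mem.1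
    ⟨t / (t + T'.sum.1), T'.sum.1 / (t + T'.sum.1), by positivity, by positivity,
      by field_simp, by (ext <;> simp [hs] <;> field_simp); ring⟩
  have := congrArg Prod.fst h1.2
  simp at this
  exact ht.ne' this

theorem snd_le (h : Shape A T B N c j β) {q : Point} (hq : q ∈ path 0 (combWord A T B N c)) :
    q.2 ≤ A.sum.2 := by
  obtain ⟨h1, h2, h3, h4, h5, h6, h7, h8, h9, h10, h11, h12⟩ := h.bounds
  rcases h.mem_path_combWord.1 hq with hq | hq | hq | hq | rfl
  · rcases h.A_bounds hq with rfl | hb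
    · simp; linarith
    · linarith
  · exact (h.T_bounds hq).2.2.2
  · exact (h.B_bounds hq).2.2.2.1
  · linarith [(h.N_bounds hq).2.1]
  · simp; linarith

theorem flat_mem_frontier {U V : List Point} (h : Shape A T B N c j β) (hT : T = U ++ V)
    (hU : U.sum.2 = 0) : (A ++ U).sum ∈ frontier (hull (path 0 (combWord A T B N c))) := by
  refine mem_frontier_hull (subset_hull (sum_mem_path (v := V ++ (B ++ (N ++ [c])))
    (by simp [combWord, hT]) (by simp))) fun q hq => ?_
  simpa [hU] using h.snd_le hq

/-- The one place where the kinds of pocket differ: the inner ends of the outer tooth edges are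
boundary points of the hull, but not hull vertices. A standard pocket therefore begins and ends
there, an extended one runs from corner to corner. -/
theorem T_ends {K : Kind} {t t' d k : ℝ} {l : List (ℝ × ℝ)} {W₁ w₂ W₃ : List Point}
    (h : Shape A T B N c j β) (ht : 0 < t) (ht' : 0 < t') (hk : 0 < k) (hl : Nested d l)
    (hT : T = (t, 0) :: (0, -d) :: (nest (-1) k l ++ [(0, d), (t', 0)]))
    (hw : IsPocketWord (lidPoints (path 0 (combWord A T B N c)) K) 0 (combWord A T B N c)
      (A ++ W₁) w₂ (W₃ ++ (B ++ (N ++ [c])))) (hW : T = W₁ ++ (w₂ ++ W₃)) :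
    (W₁ = [(t, 0)] ∧ W₃ = [(t', 0)]) ∨ (W₁ = [] ∧ W₃ = []) := by
  have hlen := hw.two_le
  have hpos := sum_nest_fst_pos (σ := -1) hk hl
  have hl1 := hw.left_mem
  have hr1 := hw.right_mem
  have hn := hw.notMem
  rw [zero_add] at hl1 hr1
  simp only [zero_add] at hn
  have hw₂ : w₂ ≠ [] := by rintro rfl; simp at hlen
  have hleft : W₁ ≠ [] → W₁ = [(t, 0)] := fun hne => by
    rcases h.T_cases ht ht' hk hl hT hW hne (by simp [hw₂]) with h1 | h1 | h1
    · exact h1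
    · have := congrArg List.length h1
      simp at this; omega
    · exact absurd hl1 (not_mem_lidPoints h1 K)
  have hright : W₃ ≠ [] → W₃ = [(t', 0)] := fun hne => by
    rcases h.T_cases (U := W₁ ++ w₂) (V := W₃) ht ht' hk hl hT (by simp [hW]) (by simp [hw₂])
      hne with h1 | h1 | h1
    · have := congrArg List.length h1
      simp at this; omega
    · exact h1
    · exact absurd hr1 (by simpa using not_mem_lidPoints h1 K)
  have e : T = ((t, 0) :: (0, -d) :: (nest (-1) k l ++ [(0, d)])) ++ [(t', 0)] := by simp [hT]
  have hsl : 0 < ((0, -d) :: (nest (-1) k l ++ [(0, d), (t', 0)]) : List Point).sum.1 := by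
    simp; positivity
  have hsr : 0 < ((t, 0) :: (0, -d) :: (nest (-1) k l ++ [(0, d)]) : List Point).sum.1 := by
    simp; positivity
  have hs2 : ((t, 0) :: (0, -d) :: (nest (-1) k l ++ [(0, d)]) : List Point).sum.2 = 0 := by
    simp [sum_nest_snd]
  cases K with
  | standard =>
    left
    constructor
    · refine hleft ?_
      rintro rfl
      cases w₂ with
      | nil => simp at hlen
      | cons x w₂ =>
        have hx : x = (t, 0) := by
          rw [hT] at hW; simp at hW; exact hW.1.symm
        refine hn [x] w₂ rfl (by simp) (by rintro rfl; simp at hlen) ?_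
        rw [List.append_nil, hx]
        exact h.flat_mem_frontier hT (by simp)
    · refine hright ?_
      rintro rfl
      obtain ⟨y, x, rfl⟩ := List.eq_nil_or_concat' w₂ |>.resolve_left hw₂
      refine hn y [x] rfl (by rintro rfl; simp at hlen) (by simp) ?_
      rw [e, List.append_nil, ← List.append_assoc] at hW
      have := (List.append_inj' hW rfl).1
      rw [List.append_assoc, ← this]
      exact h.flat_mem_frontier e hs2
  | extended =>
    right
    constructor
    · by_contra hne
      rw [hleft hne] at hl1
      subst hT
      exact h.flat_left_notMem ht hsl hl1
    · by_contra hne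
      rw [hright hne, e] at hW
      rw [← List.append_assoc] at hW
      have := (List.append_inj' hW rfl).1
      rw [List.append_assoc, ← this] at hr1
      subst e
      exact h.flat_right_notMem ht' hsr hr1

/-- Every flipturn of a polygon arising from a comb decreases the number of
flipturns that are needed by one. -/
theorem step_word {K : Kind} {w₁ w₂ w₃ : List Point} (h : Shape A T B N c j β)
    (hμ : A.length + B.length + 6 * j + N.length = μ + 2)
    (hw : IsPocketWord (lidPoints (path 0 (combWord A T B N c)) K) 0 (combWord A T B N c)
      w₁ w₂ w₃) :
    ∃ μ', μ = μ' + 2 ∧ State (tidy (path 0 (w₁ ++ (w₂.reverse ++ w₃)))) μ' := by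
  have hlen := hw.two_le
  have hl1 := hw.left_mem
  have hr1 := hw.right_mem
  rw [zero_add] at hl1 hr1
  have hint : ∀ {p}, p ∈ lidPoints (path 0 (combWord A T B N c)) K →
      p ∉ interior (hull (path 0 (combWord A T B N c))) := fun hp hi =>
    not_mem_lidPoints hi K hp
  obtain ⟨b₁, M, b₂, rfl⟩ : ∃ b₁ M b₂, w₂ = b₁ :: (M ++ [b₂]) := by
    cases w₂ with
    | nil => simp at hlen
    | cons b₁ w₂ =>
      obtain ⟨M, b₂, rfl⟩ := List.eq_nil_or_concat' w₂ |>.resolve_left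
        (by rintro rfl; simp at hlen)
      exact ⟨b₁, M, b₂, rfl⟩
  -- A pocket does not pass over a hull vertex. The upper left, upper right, lower right and bottom
  -- right ones cut the word into `A`, `T`, `B`, `N` and the bottom edge, and the pocket lies within
  -- one of these pieces.
  rcases hw.split (X := A) rfl (mem_lidPoints h.topLeft_mem K) with
    ⟨C, hA, rfl⟩ | ⟨W, rfl, hW⟩
  · -- the pocket lies in the left stairs
    obtain ⟨u₀, A', rfl, -, -⟩ := h.exists_A_cons
    -- The end of the first edge of `A` is a hull vertex as well, so an edge of `A` precedes the
    -- pocket.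
    obtain ⟨D, hD, -⟩ | ⟨D, rfl, hD⟩ := hw.split (X := [u₀]) (Y := combWord A' T B N c) rfl
      (by simpa using mem_lidPoints h.head_mem K)
    · have := congrArg List.length hD
      simp at this; omega
    obtain ⟨X, p, hXp⟩ := List.eq_nil_or_concat' ([u₀] ++ D) |>.resolve_left (by simp)
    rw [hXp] at hA hl1 hr1 ⊢
    have := h.flip_A (X := X) (p := p) (b₁ := b₁) (M := M) (b₂ := b₂) (C := C) hμ
      (by simpa using hA) (hint hl1) (by simpa using hint hr1)
    simpa using this
  rcases hw.split (X := A ++ T) (Y := B ++ (N ++ [c])) (by simp [combWord])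
      (by simpa using mem_lidPoints h.topRight_mem K) with ⟨C, hT, rfl⟩ | ⟨W', hWA, hW'⟩
  · -- the pocket lies in the top
    rw [List.append_assoc, List.append_cancel_left_eq] at hT
    rcases h.top with ⟨rfl, k, hk, hTk⟩ | ⟨t, t', d, k, l, ht, ht', hk, -, hl, hTk, hj⟩
    · rw [hTk] at hT
      have := congrArg List.length hT
      simp at this; omega
    have hch := h.chain
    have hrev := reverse_nest (-1) k l
    rw [neg_neg] at hrev
    rcases h.T_ends ht ht' hk hl hTk hw hT with ⟨rfl, rfl⟩ | ⟨rfl, rfl⟩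
    · rw [hTk] at hT
      have e : (0, -d) :: (nest (-1) k l ++ [(0, d)]) ++ [((t', 0) : Point)] =
          b₁ :: (M ++ [b₂]) ++ [(t', 0)] := by
        simpa using hT
      have e2 := List.append_cancel_right e
      rw [← e2]
      have e3 : (-1, 0) :: combWord A T B N c =
          (-1, 0) :: (A ++ (t, 0) :: (0, -d) :: (nest (-1) k l ++ (0, d) :: (t', 0) ::
            (B ++ (N ++ [c])))) := by
        simp [combWord, hTk]
      rw [e3] at hch
      have := isChain_flip hch (Or.inr ⟨ht.ne', rfl, rfl, hl.pos.ne'⟩)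
        (Or.inl ⟨rfl, by simpa using hl.pos.ne', ht'.ne', rfl⟩)
      rw [hrev] at this
      have := h.flip_T hμ ht ht' hk hl hTk hj rfl this
      simpa [hrev] using this
    -- For an extended pocket the whole top is reversed and the outer teeth change places. The
    -- adjacent stair edges are vertical, so no straight angle arises.
    · rw [List.nil_append, List.append_nil] at hT
      rw [← hT]
      obtain ⟨A', u, hA', hu⟩ := h.exists_A_append
      obtain ⟨v, B', hB', hv⟩ := h.exists_B_cons
      have e3 : (-1, 0) :: combWord A T B N c =
          (-1, 0) :: (A' ++ u :: (t, 0) :: ((0, -d) :: (nest (-1) k l ++ [(0, d)]) ++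
            (t', 0) :: v :: (B' ++ (N ++ [c])))) := by
        simp [combWord, hTk, hA', hB']
      rw [e3] at hch
      have := isChain_flip hch (Or.inl ⟨hu.1, hu.2.ne', ht'.ne', rfl⟩)
        (Or.inr ⟨ht.ne', rfl, hv.1, hv.2.ne⟩)
      have := h.flip_T (t₁ := t') (t₂ := t) hμ ht' ht hk hl hTk hj (add_comm _ _)
        (by simpa [hrev, hA', hB'] using this)
      simpa [hrev, hTk] using this
  have hWT : W = T ++ W' := by simpa using hWA
  subst hWT
  rcases hw.split (X := A ++ (T ++ B)) (Y := N ++ [c]) (by simp [combWord])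
      (by simpa [add_assoc] using mem_lidPoints h.rightBottom_mem K) with
    ⟨C, hB, rfl⟩ | ⟨W'', hWB, hW''⟩
  · -- the pocket lies in the right stairs
    have hB : B = W' ++ (b₁ :: (M ++ [b₂]) ++ C) := by simpa using hB
    obtain ⟨B', d, hd, -⟩ := h.exists_B_append
    subst hd
    -- The last edge of `B` joins two hull vertices; hence it follows the pocket and supplies the
    -- edge `q` needed there.
    obtain ⟨D, hD, hD'⟩ | ⟨D, hD, hD'⟩ := hw.split (X := A ++ (T ++ B')) (Y := d :: (N ++ [c]))
      (by simp [combWord]) (by simpa [add_assoc] using mem_lidPoints h.rightTop_mem K)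
    · have hC : C = D ++ [d] := by
        have : C ++ (N ++ [c]) = (D ++ [d]) ++ (N ++ [c]) := by simpa using hD'
        exact List.append_cancel_right this
      subst hC
      obtain ⟨q, C', hC'⟩ := List.exists_cons_of_ne_nil (l := D ++ [d]) (by simp)
      rw [hC'] at hB ⊢
      have := h.flip_B (W := W') (b₁ := b₁) (M := M) (b₂ := b₂) (q := q) (C := C') hμ
        (by simpa using hB) (hint (by simpa using hl1)) (hint (by simpa using hr1))
      simpa using this
    · exfalso
      have : (b₁ :: (M ++ [b₂]) ++ C).length ≤ 1 := by
        have h1 := congrArg List.length hD'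
        simp at h1 ⊢
        omega
      simp at this
  have hW'B : W' = B ++ W'' := by simpa using hWB
  subst hW'B
  -- the pocket is the notch
  obtain ⟨D, hD, hD'⟩ | ⟨D, hD, hD'⟩ := hw.split (X := A ++ (T ++ (B ++ N))) (Y := [c])
    (by simp [combWord]) (by
      have := mem_lidPoints h.bottomRight_mem K
      rw [← h.sum_eq] at this
      simpa [add_assoc] using this)
  · have hN : N = W'' ++ (b₁ :: (M ++ [b₂]) ++ D) := by simpa using hD
    rcases h.notch with ⟨rfl, -⟩ | ⟨u, hu, hβ, hN'⟩
    · simp at hN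
    · have hlenN := congrArg List.length hN
      simp [hN'] at hlenN
      obtain rfl : W'' = [] := List.length_eq_zero_iff.1 (by omega)
      obtain rfl : D = [] := List.length_eq_zero_iff.1 (by omega)
      obtain rfl : M = [] := List.length_eq_zero_iff.1 (by omega)
      have hN2 : N = [b₁, b₂] := by simpa using hN
      subst hN2
      have := h.flip_N hμ
      simpa [hD'] using this
  · exfalso
    have := congrArg List.length hD'
    simp at this
    omega

end Shape

/-! ### Existence of pockets, and the number of flipturns -/

theorem exists_last_good {S : Set Point} (h0 : (0 : Point) ∈ S) (u : List Point) :
    ∃ u₁ u₂, u = u₁ ++ u₂ ∧ u₁.sum ∈ S ∧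
      ∀ c d, u₂ = c ++ d → c ≠ [] → (u₁ ++ c).sum ∉ S := by
  induction u using List.reverseRecOn with
  | nil => exact ⟨[], [], rfl, h0, fun c d h hc => absurd (List.append_eq_nil_iff.1 h.symm).1 hc⟩
  | append_singleton u e ih =>
    obtain ⟨u₁, u₂, rfl, h1, h2⟩ := ih
    by_cases h : (u₁ ++ u₂ ++ [e]).sum ∈ S
    · exact ⟨_, [], (List.append_nil _).symm, h,
        fun c d h hc => absurd (List.append_eq_nil_iff.1 h.symm).1 hc⟩
    · refine ⟨u₁, u₂ ++ [e], by simp, h1, fun c d hcd hc => ?_⟩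
      rcases List.eq_nil_or_concat' d with rfl | ⟨d, f, rfl⟩
      · rw [List.append_nil] at hcd
        rwa [← hcd, ← List.append_assoc]
      · rw [← List.append_assoc] at hcd
        exact h2 c d (List.append_inj' hcd rfl).1 hc

theorem exists_first_good {S : Set Point} (x : Point) (v : List Point) (hx : x ∉ S)
    (h : x + v.sum ∈ S) : ∃ v₁ v₂, v = v₁ ++ v₂ ∧ v₁ ≠ [] ∧ x + v₁.sum ∈ S ∧
      ∀ c d, v₁ = c ++ d → d ≠ [] → x + c.sum ∉ S := by
  induction v generalizing x with
  | nil => exact absurd (by simpa using h) hx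
  | cons e v ih =>
    by_cases he : x + e ∈ S
    · refine ⟨[e], v, rfl, by simp, by simpa, fun c d hcd hd => ?_⟩
      cases c with
      | nil => simpa
      | cons f c => simp at hcd; exact absurd hcd.2.2 hd
    · obtain ⟨v₁, v₂, rfl, h1, h2, h3⟩ := ih (x + e) he (by simpa [add_assoc] using h)
      refine ⟨e :: v₁, v₂, rfl, by simp, by simpa [add_assoc] using h2, fun c d hcd hd => ?_⟩
      cases c with
      | nil => simpa
      | cons f c =>
        simp at hcd
        have := h3 c d hcd.2 hd
        rw [List.sum_cons, ← add_assoc, ← hcd.1]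
        exact this

/-- A closed polygon with a vertex that is not a lid point has a pocket. -/
theorem exists_pocketWord {S : Set Point} {w u v : List Point} (h0 : (0 : Point) ∈ S)
    (hs : w.sum = 0) (hw : w = u ++ v) (hu : u.sum ∉ S) :
    ∃ w₁ w₂ w₃, IsPocketWord S 0 w w₁ w₂ w₃ := by
  obtain ⟨u₁, u₂, rfl, h1, h2⟩ := exists_last_good h0 u
  obtain ⟨v₁, v₂, rfl, h3, h4, h5⟩ := exists_first_good (S := S) _ v hu
    (by rw [← List.sum_append, ← hw, hs]; exact h0)
  have hu₂ : u₂ ≠ [] := by rintro rfl; simp [h1] at hu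
  have l1 := List.length_pos_of_ne_nil h3
  have l2 := List.length_pos_of_ne_nil hu₂
  refine ⟨u₁, u₂ ++ v₁, v₂, by simp [hw], by simp; omega, by simpa,
    by simpa [add_assoc] using h4, fun c d hcd hc hd => ?_⟩
  rw [zero_add]
  rcases List.append_eq_append_iff.1 hcd with ⟨e, rfl, he⟩ | ⟨e, rfl, he⟩
  · rw [← List.append_assoc, List.sum_append]
    exact h5 e d he hd
  · exact h2 c e rfl hc

namespace Shape

variable {A T B N : List Point} {c : Point} {j μ : ℕ} {β : ℝ}

/-- A positive `μ` means that there is a notch, a gap in the top, or a staircase with more than one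
edge; each of these has a vertex already known to be interior. -/
theorem exists_interior (h : Shape A T B N c j β)
    (hμ : A.length + B.length + 6 * j + N.length = μ + 2) (hpos : 0 < μ) :
    ∃ u v, combWord A T B N c = u ++ v ∧ v ≠ [] ∧
      u.sum ∈ interior (hull (path 0 (combWord A T B N c))) := by
  have hch := h.chain
  rcases h.notch with ⟨rfl, -⟩ | ⟨u, hu, hβ, rfl⟩
  · rcases h.top with ⟨rfl, k, hk, hTk⟩ | ⟨t, t', d, k, l, ht, ht', hk, -, hl, hT, hj⟩
    · obtain ⟨u, A', rfl, hu, -⟩ := h.exists_A_cons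
      obtain ⟨d, B', rfl, hd⟩ := h.exists_B_cons
      rcases A' with _ | ⟨r, A'⟩
      · rcases B' with _ | ⟨r, B'⟩
        · simp at hμ; omega
        · have hr : IsR r := by
            have e : (-1, 0) :: combWord [u] T (d :: r :: B') [] c =
              ((-1, 0) :: u :: T) ++ d :: r :: (B' ++ [c]) := by simp [combWord]
            rw [e] at hch
            exact (alt_of_isChain_append hch).symm.isR_of_down (h.dirB r (by simp)) hd.1
          exact ⟨_, r :: (B' ++ [c]), by simp [combWord], by simp,
            h.interior_of_B (X := []) rfl hd hr⟩
      · have hr : IsR r :=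
          (alt_of_isChain_append (X := [(-1, 0)]) hch).symm.isR_of_up (h.dirA r (by simp)) hu.1
        rcases A' with _ | ⟨v, A'⟩
        · exfalso
          obtain ⟨A'', v, hA, hv⟩ := h.exists_A_append
          have : r = v := by
            have := congrArg List.getLast? hA
            simpa using this
          subst this
          exact hr.1.ne' hv.1
        · have hv : IsU v := by
            have := alt_of_isChain_append (X := [(-1, 0), u]) hch
            exact this.symm.isU (h.dirA v (by simp)) hr.2
          exact ⟨_, v :: (A' ++ (T ++ (d :: B' ++ [c]))), by simp [combWord], by simp,
            h.interior_of_A (X := [u]) rfl hr hv⟩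
    · exact ⟨_, nest (-1) k l ++ (0, d) :: (t', 0) :: (B ++ [c]), by simp [combWord, hT],
        by simp, h.interior_of_T (X := [(0, -d)]) (Y := nest (-1) k l ++ [(0, d)]) ht ht' hk hl
        (by simp [hT]) (by simp) (by simp) (by simp)⟩
  · exact ⟨_, [(0, -β), c], by simp [combWord], by simp, h.interior_of_N⟩

/-- Both staircases are nonempty, so the weight 2 leaves one vertical edge on each side, a single
top edge and no notch: a rectangle. -/
theorem isConvexPolygon (h : Shape A T B N c j β)
    (hμ : A.length + B.length + 6 * j + N.length = 2) :
    IsConvexPolygon (path 0 (combWord A T B N c)) := by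
  obtain ⟨u, A', rfl, hu, -⟩ := h.exists_A_cons
  obtain ⟨d, B', rfl, hd⟩ := h.exists_B_cons
  simp at hμ
  obtain rfl : j = 0 := by omega
  obtain rfl : A' = [] := List.length_eq_zero_iff.1 (by omega)
  obtain rfl : B' = [] := List.length_eq_zero_iff.1 (by omega)
  obtain rfl : N = [] := List.length_eq_zero_iff.1 (by omega)
  intro q hq
  rcases h.mem_path_combWord.1 hq with hq | hq | hq | hq | rfl
  · obtain rfl : q = 0 := by simpa using hq
    exact h.zero_mem
  · rcases h.top with ⟨-, k, hk, rfl⟩ | ⟨t, t', d, k, l, ht, ht', hk, -, hl, hT, hj⟩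
    · obtain rfl : q = u := by simpa using hq
      exact h.head_mem
    · omega
  · have := h.topRight_mem
    simp at hq this
    rwa [hq]
  · simp at hq
  · exact h.bottomRight_mem

end Shape

open List in
theorem hull_congr {P Q : List Point} (h : P ~r Q) : hull P = hull Q := by
  simp only [hull, h.mem_iff]

theorem State.step {K : Kind} {P Q : List Point} {μ : ℕ} (h : State P μ) (hs : Step K P Q) :
    ∃ μ', μ = μ' + 2 ∧ State Q μ' := by
  obtain ⟨A, T, B, N, c, j, β, h, hμ, hP⟩ := h
  obtain ⟨w₁, w₂, w₃, hw, hQ⟩ := hs.exists_pocketWord hP h.sum_zero (mem_lidPoints h.zero_mem K)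
  obtain ⟨μ', hμ', A, T, B, N, c, j, β, h', hl, hrot⟩ := h.step_word hμ hw
  exact ⟨μ', hμ', A, T, B, N, c, j, β, h', hl, hQ.trans hrot⟩

theorem State.exists_step {K : Kind} {P : List Point} {μ : ℕ} (h : State P μ) (hpos : 0 < μ) :
    ∃ Q, Step K P Q := by
  obtain ⟨A, T, B, N, c, j, β, h, hμ, hP⟩ := h
  obtain ⟨u, v, huv, -, hi⟩ := h.exists_interior hμ hpos
  obtain ⟨w₁, w₂, w₃, hw⟩ := exists_pocketWord (mem_lidPoints h.zero_mem K) h.sum_zero huv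
    (not_mem_lidPoints hi K)
  refine hw.step hP h.sum_zero ?_
  -- A pocket starting at the origin would pass over the upper end of the first edge, a hull vertex.
  rintro rfl
  obtain ⟨u₀, A', rfl, -, -⟩ := h.exists_A_cons
  have hlen := hw.two_le
  obtain ⟨D, hD, -⟩ | ⟨D, hD, -⟩ := hw.split (X := [u₀]) (Y := combWord A' T B N c) rfl
    (by simpa using mem_lidPoints h.head_mem K)
  · have := congrArg List.length hD
    simp at this; omega
  · simp at hD

theorem State.not_isConvexPolygon {P : List Point} {μ : ℕ} (h : State P μ) (hpos : 0 < μ) :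
    ¬ IsConvexPolygon P := by
  obtain ⟨A, T, B, N, c, j, β, h, hμ, hP⟩ := h
  obtain ⟨u, v, huv, hv, hi⟩ := h.exists_interior hμ hpos
  intro hc
  have := hc _ (hP.mem_iff.2 (sum_mem_path huv hv))
  rw [hullVertices, hull_congr hP] at this
  exact not_mem_interior_of_mem_hullVertices this hi

theorem State.isConvexPolygon {P : List Point} (h : State P 0) : IsConvexPolygon P := by
  obtain ⟨A, T, B, N, c, j, β, h, hμ, hP⟩ := h
  intro p hp
  have := h.isConvexPolygon hμ p (hP.mem_iff.1 hp)
  rwa [hullVertices, hull_congr hP]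

/-- All convexifying flipturn sequences have the same length. -/
theorem State.length_eq {K : Kind} {P Q : List Point} {l t : ℕ} (hs : FlipturnSeq K l P Q)
    (h : State P (2 * t)) (hc : IsConvexPolygon Q) : l = t := by
  induction hs generalizing t with
  | refl P =>
    by_contra hne
    exact h.not_isConvexPolygon (by omega) hc
  | step hPQ _ ih =>
    obtain ⟨μ', hμ', h'⟩ := h.step hPQ
    obtain rfl : μ' = 2 * (t - 1) := by omega
    have := ih h' hc
    omega

theorem State.exists_seq {K : Kind} {P : List Point} {t : ℕ} (h : State P (2 * t)) :
    ∃ Q, FlipturnSeq K t P Q ∧ IsConvexPolygon Q := by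
  induction t generalizing P with
  | zero => exact ⟨P, .refl P, h.isConvexPolygon⟩
  | succ t ih =>
    obtain ⟨R, hR⟩ := h.exists_step (K := K) (by omega)
    obtain ⟨μ', hμ', h'⟩ := h.step hR
    obtain rfl : μ' = 2 * t := by omega
    obtain ⟨Q, hQ, hc⟩ := ih h'
    exact ⟨Q, .step hR hQ, hc⟩

/-! ### A concrete comb with unit columns -/

/-- The heights of the columns of a symmetric comb with `k` teeth. -/
noncomputable def combHeight (k j : ℕ) : ℝ :=
  if Even j then 2 * k - (min j (2 * k - 2 - j) : ℕ) else 1 + (min j (2 * k - 2 - j) : ℕ)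

theorem isSymmetricComb_combHeight {k : ℕ} (hk : 0 < k) :
    IsSymmetricComb k (fun j => (j : ℝ)) (combHeight k) where
  x_lt j _ := by simp
  h_pos j hj := by
    unfold combHeight
    have : min j (2 * k - 2 - j) < 2 * k := by omega
    have : ((min j (2 * k - 2 - j) : ℕ) : ℝ) < 2 * k := by exact_mod_cast this
    split_ifs
    · linarith
    · positivity
  gap_lt_tooth i hi j hj h1 h2 := by
    have h3 : ¬ Even i := Nat.not_even_iff_odd.2 h1
    simp only [combHeight, if_neg h3, if_pos h2]
    have : 1 + min i (2 * k - 2 - i) + min j (2 * k - 2 - j) < 2 * k := by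
      obtain ⟨a, rfl⟩ := h1
      obtain ⟨b, rfl⟩ := h2
      omega
    have : (1 : ℝ) + (min i (2 * k - 2 - i) : ℕ) + (min j (2 * k - 2 - j) : ℕ) < 2 * k := by
      exact_mod_cast this
    linarith
  x_symm i j h := by
    rw [← h]
    push_cast
    ring
  h_symm i j h := by
    have h1 : min i (2 * k - 2 - i) = min j (2 * k - 2 - j) := by omega
    have h2 : Even i ↔ Even j := by
      have : Even (i + j) := by rw [h]; exact ⟨k - 1, by omega⟩
      exact Nat.even_add.1 this
    simp only [combHeight, h1, h2]
  tooth_anti j h1 h2 := by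
    have h3 : Even (j + 2) := h1.add (by decide)
    simp only [combHeight, if_pos h1, if_pos h3]
    have : min j (2 * k - 2 - j) < min (j + 2) (2 * k - 2 - (j + 2)) := by omega
    have : ((min j (2 * k - 2 - j) : ℕ) : ℝ) < (min (j + 2) (2 * k - 2 - (j + 2)) : ℕ) := by
      exact_mod_cast this
    linarith
  gap_mono j h1 h2 := by
    have h3 : ¬ Even (j + 2) := by
      rw [Nat.not_even_iff_odd]; exact h1.add_even (by decide)
    have h4 : ¬ Even j := Nat.not_even_iff_odd.2 h1
    simp only [combHeight, if_neg h4, if_neg h3]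
    have : min j (2 * k - 2 - j) < min (j + 2) (2 * k - 2 - (j + 2)) := by omega
    have : ((min j (2 * k - 2 - j) : ℕ) : ℝ) < (min (j + 2) (2 * k - 2 - (j + 2)) : ℕ) := by
      exact_mod_cast this
    linarith

/-- Columns of width one, with steps of heights `2 * m`, ..., `4`, `2`. -/
def evenSteps : ℕ → List (ℝ × ℝ)
  | 0 => []
  | m + 1 => (1, 2 * (m + 1)) :: evenSteps m

theorem length_evenSteps (m : ℕ) : (evenSteps m).length = m := by
  induction m with
  | zero => rfl
  | succ m ih => simp [evenSteps, ih]

theorem nested_evenSteps {D : ℝ} (m : ℕ) (h : 2 * m < D) : Nested D (evenSteps m) := by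
  induction m generalizing D with
  | zero => simpa [evenSteps, Nested] using h
  | succ m ih =>
    push_cast at h
    exact ⟨one_pos, h, ih (by linarith)⟩

theorem length_nest (σ c : ℝ) (l : List (ℝ × ℝ)) : (nest σ c l).length = 4 * l.length + 1 := by
  induction l generalizing σ with
  | nil => rfl
  | cons a l ih => simp [nest, ih]; ring

theorem sum_nest_evenSteps_fst (σ : ℝ) (m : ℕ) :
    (nest σ 1 (evenSteps m)).sum.1 = 2 * m + 1 := by
  induction m generalizing σ with
  | zero => simp [evenSteps, nest]
  | succ m ih => simp [evenSteps, nest, ih]; ring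

/-- The upper boundary of a comb is the walk given by `nest`. -/
theorem flatMap_eq_path (f : ℕ → ℝ) (s m : ℕ) (σ : ℝ)
    (hsymm : ∀ i ≤ 2 * m, f (s + i) = f (s + (2 * m - i)))
    (hstep : ∀ i < m, f (s + i + 1) - f (s + i) = -(σ * (-1) ^ i * (2 * (m - i)))) :
    (List.range' s (2 * m + 1)).flatMap (fun j : ℕ => [((j : ℝ), f j), (((j + 1 : ℕ) : ℝ), f j)]) =
      path ((s : ℝ), f s) (nest σ 1 (evenSteps m)) ++ [((s : ℝ) + 2 * m + 1, f s)] := by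
  induction m generalizing s σ with
  | zero => simp [evenSteps, nest, List.range'_succ]
  | succ m ih =>
    have h1 : f (s + 1) = f s - σ * (2 * (m + 1)) := by
      have := hstep 0 (by omega)
      simp at this
      linarith
    have h2 : f (s + 1 + (2 * m + 1)) = f s := by
      have := hsymm 0 (by omega)
      rw [Nat.add_zero] at this
      rw [this]
      congr 1
      omega
    have h3 : List.range' s (2 * (m + 1) + 1) =
        s :: (List.range' (s + 1) (2 * m + 1) ++ [s + 1 + (2 * m + 1)]) := by
      rw [show 2 * (m + 1) + 1 = (2 * m + 1 + 1) + 1 by ring, List.range'_succ,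
        List.range'_concat]
      simp
    -- The first and the last column are split off; the steps of the remaining block begin in the
    -- opposite direction, hence `-σ`.
    rw [h3, List.flatMap_cons, List.flatMap_append, ih (s + 1) (-σ)]
    · have h4 := sum_nest_evenSteps_fst (-σ) m
      have h5 := sum_nest_snd (-σ) 1 (evenSteps m)
      simp only [evenSteps, nest, path_cons, path_append, List.flatMap_cons, List.flatMap_nil,
        path_nil, h2]
      have e1 : ((s : ℝ), f s) + (1, 0) = (((s + 1 : ℕ) : ℝ), f s) := by simp
      have e2 : (((s + 1 : ℕ) : ℝ), f s) + (0, -(σ * (2 * (m + 1)))) =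
          (((s + 1 : ℕ) : ℝ), f (s + 1)) := by rw [h1]; simp; ring
      have e3 : (((s + 1 : ℕ) : ℝ), f (s + 1)) + (nest (-σ) 1 (evenSteps m)).sum =
          (((s + 1 : ℕ) : ℝ) + 2 * m + 1, f (s + 1)) := by
        ext
        · simp [h4]; ring
        · simp [h5]
      rw [e1, e2, e3, h1]
      simp
      ring_nf
      simp
    · intro i hi
      have := hsymm (i + 1) (by omega)
      rw [show s + 1 + i = s + (i + 1) by ring, this]
      congr 1
      omega
    · intro i hi
      have := hstep (i + 1) (by omega)
      rw [show s + 1 + i = s + (i + 1) by ring, this]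
      push_cast
      ring

theorem combHeight_symm (m i : ℕ) (hi : i ≤ 2 * m) :
    combHeight (m + 1) (0 + i) = combHeight (m + 1) (0 + (2 * m - i)) :=
  (isSymmetricComb_combHeight m.succ_pos).h_symm _ _ (by omega)

/-- In the left half teeth have height `2 * (m + 1) - i` and gaps `1 + i`, so the steps go
alternately down and up by `2 * m`, `2 * m - 2`, ..., `2`. -/
theorem combHeight_step (m i : ℕ) (hi : i < m) :
    combHeight (m + 1) (0 + i + 1) - combHeight (m + 1) (0 + i) =
      -(1 * (-1) ^ i * (2 * (m - i))) := by
  have h1 : min i (2 * (m + 1) - 2 - i) = i := by omega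
  have h2 : min (i + 1) (2 * (m + 1) - 2 - (i + 1)) = i + 1 := by omega
  rw [zero_add]
  unfold combHeight
  rw [h1, h2]
  rcases Nat.even_or_odd i with h | h
  · rw [if_pos h, if_neg (by simpa [Nat.even_add_one] using h), h.neg_one_pow]
    push_cast
    ring
  · rw [if_neg (Nat.not_even_iff_odd.2 h), if_pos h.add_one, h.neg_one_pow]
    push_cast
    ring

theorem combHeight_zero (k : ℕ) : combHeight k 0 = 2 * k := by
  simp [combHeight]

/-- The vertices of the comb, by the word of edge vectors of its upper boundary. -/
theorem combChain_eq (m : ℕ) : combChain (m + 1) (fun j => (j : ℝ)) (combHeight (m + 1)) =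
    (0, 0) :: (path (0, 2 * (m + 1)) (nest 1 1 (evenSteps m)) ++
      [(2 * (m : ℝ) + 1, 2 * ((m : ℝ) + 1))]) := by
  have h := flatMap_eq_path (combHeight (m + 1)) 0 m 1 (combHeight_symm m) (combHeight_step m)
  rw [← List.range_eq_range', combHeight_zero] at h
  rw [combChain, show 2 * (m + 1) - 1 = 2 * m + 1 by omega]
  simp only [Nat.cast_zero, zero_add, Nat.cast_add, Nat.cast_one] at h ⊢
  rw [h]

theorem isChain_nest {σ c D : ℝ} {l : List (ℝ × ℝ)} {v v' : Point} (hσ : σ ≠ 0) (hc : 0 < c)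
    (hl : Nested D l) (hv : v.1 = 0) (hv0 : v.2 ≠ 0) (hv' : v'.1 = 0) (hv'0 : v'.2 ≠ 0) :
    (v :: (nest σ c l ++ [v'])).IsChain Alt := by
  induction l generalizing σ D v v' with
  | nil => simp [nest, Alt, *, hc.ne']
  | cons a l ih =>
    obtain ⟨t, d⟩ := a
    have ht : t ≠ 0 := hl.1.ne'
    have hd : d ≠ 0 := hl.2.2.pos.ne'
    have := ih (σ := -σ) (v := (0, -(σ * d))) (v' := (0, σ * d)) (neg_ne_zero.2 hσ) hl.2.2 rfl
      (by simp [*]) rfl (by simp [*])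
    rw [nest, List.cons_append, List.cons_append, List.isChain_cons_cons, List.isChain_cons_cons]
    refine ⟨Or.inl ⟨hv, hv0, ht, rfl⟩, Or.inr ⟨ht, rfl, rfl, by simp [*]⟩, ?_⟩
    rw [List.append_assoc, List.cons_append, ← List.cons_append, List.isChain_split]
    refine ⟨this, ?_⟩
    simp [Alt, *]

theorem shape_plain (m : ℕ) : Shape [(0, 2 * (m + 1))] (nest 1 1 (evenSteps m))
    [(0, -(2 * (m + 1)))] [] (-(2 * m + 1), 0) m 0 where
  sum_zero := by
    ext
    · simp [combWord, sum_nest_evenSteps_fst]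
    · simp [combWord, sum_nest_snd]
  chain := by
    have h := isChain_nest (σ := 1) (c := 1) (v := (0, 2 * (m + 1))) (v' := (0, -(2 * (m + 1))))
      one_ne_zero one_pos (nested_evenSteps m (lt_add_one _)) rfl (by positivity) rfl
      (by simp; positivity)
    rw [combWord, List.singleton_append, List.isChain_cons_cons, ← List.cons_append,
      List.singleton_append, List.isChain_split]
    refine ⟨Or.inr ⟨by simp, rfl, rfl, by positivity⟩, h, ?_⟩
    have : (m : ℝ) + 1 ≠ 0 := by positivity
    have : -(1 : ℝ) + -(2 * m) ≠ 0 := by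
      have : (0 : ℝ) ≤ m := by positivity
      linarith
    simp [Alt, *]
  dirA e he := by
    obtain rfl : e = _ := by simpa using he
    exact Or.inr ⟨rfl, by positivity⟩
  dirB e he := by
    obtain rfl : e = _ := by simpa using he
    exact Or.inr ⟨rfl, by simp; positivity⟩
  lt_head e he := by
    obtain rfl : _ = e := by simpa using he
    positivity
  top := by
    have := isTop_nest (c := 1) (D := 2 * (m + 1)) one_pos
      (nested_evenSteps m (by linarith))
    rw [length_evenSteps] at this
    simpa using this
  notch := Or.inl ⟨rfl, rfl⟩
  left := by
    have hm : (0 : ℝ) ≤ m := by positivity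
    exact ⟨by simp only; linarith, rfl⟩

/-- The notch has width `1 / 2` and height `1`. The largest step is `2 * m`, less than the height `2
* (m + 1) - 1` of the top line above the notch. -/
theorem shape_notched (m : ℕ) : Shape [(0, 2 * (m + 1))] (nest 1 1 (evenSteps m))
    [(0, 1 - 2 * (m + 1))] [(-(1 / 2), 0), (0, -1)] (-(2 * m + 1 / 2), 0) m 1 where
  sum_zero := by
    ext
    · simp [combWord, sum_nest_evenSteps_fst]; ring
    · simp [combWord, sum_nest_snd]; ring
  chain := by
    have hm : (0 : ℝ) ≤ m := by positivity
    have h1 : 1 - 2 * ((m : ℝ) + 1) ≠ 0 := by linarith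
    have h := isChain_nest (σ := 1) (c := 1) (v := (0, 2 * (m + 1)))
      (v' := (0, 1 - 2 * (m + 1))) one_ne_zero one_pos (nested_evenSteps m (lt_add_one _)) rfl
      (by positivity) rfl h1
    rw [combWord, List.singleton_append, List.isChain_cons_cons, ← List.cons_append,
      List.singleton_append, List.isChain_split]
    refine ⟨Or.inr ⟨by simp, rfl, rfl, by positivity⟩, h, ?_⟩
    have h2 : -(2 * (m : ℝ) + 1 / 2) ≠ 0 := by linarith
    simp only [List.cons_append, List.nil_append, List.isChain_cons_cons]
    refine ⟨Or.inl ⟨rfl, h1, by simp, rfl⟩, Or.inr ⟨by simp, rfl, rfl, by simp⟩,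
      Or.inl ⟨rfl, by simp, h2, rfl⟩, by simp⟩
  dirA e he := by
    obtain rfl : e = _ := by simpa using he
    exact Or.inr ⟨rfl, by positivity⟩
  dirB e he := by
    have hm : (0 : ℝ) ≤ m := by positivity
    obtain rfl : e = _ := by simpa using he
    exact Or.inr ⟨rfl, by simp only; linarith⟩
  lt_head e he := by
    have hm : (0 : ℝ) ≤ m := by positivity
    obtain rfl : _ = e := by simpa using he
    simp only
    linarith
  top := by
    have := isTop_nest (c := 1) (D := 2 * (m + 1) - 1) one_pos
      (nested_evenSteps m (by linarith))
    rw [length_evenSteps] at this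
    simpa using this
  notch := Or.inr ⟨1 / 2, by norm_num, one_pos, by simp⟩
  left := by
    have hm : (0 : ℝ) ≤ m := by positivity
    exact ⟨by simp only; linarith, rfl⟩

theorem path_plain (m : ℕ) :
    combChain (m + 1) (fun j => (j : ℝ)) (combHeight (m + 1)) ++ [(2 * (m : ℝ) + 1, 0)] =
      path 0 (combWord [(0, 2 * (m + 1))] (nest 1 1 (evenSteps m)) [(0, -(2 * (m + 1)))] []
        (-(2 * m + 1), 0)) := by
  have h : (0, 2 * ((m : ℝ) + 1)) + (nest 1 1 (evenSteps m)).sum =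
      (2 * (m : ℝ) + 1, 2 * ((m : ℝ) + 1)) := by
    ext <;> simp [sum_nest_evenSteps_fst, sum_nest_snd]
  rw [combChain_eq]
  simp [combWord, path_append, h]

theorem path_notched (m : ℕ) :
    combChain (m + 1) (fun j => (j : ℝ)) (combHeight (m + 1)) ++
      [(2 * (m : ℝ) + 1, 1), (2 * (m : ℝ) + 1 - 1 / 2, 1), (2 * (m : ℝ) + 1 - 1 / 2, 0)] =
      path 0 (combWord [(0, 2 * (m + 1))] (nest 1 1 (evenSteps m)) [(0, 1 - 2 * (m + 1))]
        [(-(1 / 2), 0), (0, -1)] (-(2 * m + 1 / 2), 0)) := by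
  have h : (0, 2 * ((m : ℝ) + 1)) + (nest 1 1 (evenSteps m)).sum =
      (2 * (m : ℝ) + 1, 2 * ((m : ℝ) + 1)) := by
    ext <;> simp [sum_nest_evenSteps_fst, sum_nest_snd]
  rw [combChain_eq]
  simp [combWord, path_append, h, sub_eq_add_neg]

/-! ### Turns and directions of the edges -/

theorem Shape.turn_ne {A T B N : List Point} {c : Point} {j : ℕ} {β : ℝ}
    (h : Shape A T B N c j β) :
    ∀ x ∈ corners (path 0 (combWord A T B N c)), turn x.1 x.2.1 x.2.2 ≠ 0 := by
  have e : combWord A T B N c = (A ++ (T ++ (B ++ N))) ++ [c] := by simp [combWord]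
  have hs := h.sum_zero
  have hch := isChain_cons_of_isL h.left h.chain
  rw [e] at hs hch ⊢
  rw [corners_path hs]
  have key : ∀ (w : List Point) (e p : Point), (e :: w).IsChain Alt →
      ∀ x ∈ pathCorners e p w, turn x.1 x.2.1 x.2.2 ≠ 0 := by
    intro w
    induction w with
    | nil => simp [pathCorners]
    | cons f w ih =>
      intro e p hc x hx
      rw [List.isChain_cons_cons] at hc
      rcases List.mem_cons.1 hx with rfl | hx
      · rw [turn_eq]
        exact hc.1.cross_ne
      · exact ih f _ hc.2 x hx
  exact key _ _ _ hch

theorem Shape.orthogonal {A T B N : List Point} {c : Point} {j : ℕ} {β : ℝ}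
    (h : Shape A T B N c j β) :
    ∀ e ∈ edges (path 0 (combWord A T B N c)), e.1.1 = e.2.1 ∨ e.1.2 = e.2.2 := by
  intro e he
  have hmem := sub_mem_of_mem_edges h.sum_zero he
  obtain ⟨u, v, huv⟩ := List.append_of_mem hmem
  have hch := h.chain
  rw [huv] at hch
  have : (e.2 - e.1).1 = 0 ∨ (e.2 - e.1).2 = 0 := by
    rcases List.eq_nil_or_concat' u with rfl | ⟨u, f, rfl⟩
    · rcases (List.isChain_cons_cons.1 hch).1 with h | h
      · exact Or.inr h.2.2.2
      · exact Or.inl h.2.2.1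
    · rw [List.append_assoc, ← List.cons_append] at hch
      rcases alt_of_isChain_append hch with h | h
      · exact Or.inr h.2.2.2
      · exact Or.inl h.2.2.1
  rcases this with h | h
  · exact Or.inl (sub_eq_zero.1 h).symm
  · exact Or.inr (sub_eq_zero.1 h).symm

/-! ### Simplicity of the concrete polygons -/

theorem mem_uIcc_of_mem_segment {p q x : Point} (h : x ∈ segment ℝ p q) :
    x.1 ∈ Set.uIcc p.1 q.1 ∧ x.2 ∈ Set.uIcc p.2 q.2 := by
  rw [← segment_eq_uIcc, ← segment_eq_uIcc]
  obtain ⟨s, t, hs, ht, hst, rfl⟩ := h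
  exact ⟨⟨s, t, hs, ht, hst, rfl⟩, ⟨s, t, hs, ht, hst, rfl⟩⟩

/-- Two edges have no more than a common endpoint in common. -/
def MeetInEndpoint (e f : Point × Point) : Prop :=
  segment ℝ e.1 e.2 ∩ segment ℝ f.1 f.2 ⊆ {e.1, e.2} ∩ {f.1, f.2}

theorem MeetInEndpoint.symm {e f : Point × Point} (h : MeetInEndpoint e f) :
    MeetInEndpoint f e := fun x hx => by
  have := h ⟨hx.2, hx.1⟩
  exact ⟨this.2, this.1⟩

theorem meetInEndpoint_of {e f : Point × Point} (p : Point)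
    (h : ∀ x : Point, x.1 ∈ Set.uIcc e.1.1 e.2.1 → x.2 ∈ Set.uIcc e.1.2 e.2.2 →
      x.1 ∈ Set.uIcc f.1.1 f.2.1 → x.2 ∈ Set.uIcc f.1.2 f.2.2 → x.1 = p.1 ∧ x.2 = p.2)
    (he : p = e.1 ∨ p = e.2) (hf : p = f.1 ∨ p = f.2) : MeetInEndpoint e f := by
  rintro x ⟨hx, hx'⟩
  obtain ⟨h1, h2⟩ := mem_uIcc_of_mem_segment hx
  obtain ⟨h3, h4⟩ := mem_uIcc_of_mem_segment hx'
  obtain ⟨h5, h6⟩ := h x h1 h2 h3 h4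
  obtain rfl : x = p := Prod.ext h5 h6
  exact ⟨he, hf⟩

theorem meetInEndpoint_of_disjoint {e f : Point × Point}
    (h : ∀ x : Point, x.1 ∈ Set.uIcc e.1.1 e.2.1 → x.2 ∈ Set.uIcc e.1.2 e.2.2 →
      x.1 ∈ Set.uIcc f.1.1 f.2.1 → x.2 ∈ Set.uIcc f.1.2 f.2.2 → False) : MeetInEndpoint e f := by
  rintro x ⟨hx, hx'⟩
  obtain ⟨h1, h2⟩ := mem_uIcc_of_mem_segment hx
  obtain ⟨h3, h4⟩ := mem_uIcc_of_mem_segment hx'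
  exact (h x h1 h2 h3 h4).elim

/-- The vertical edge at the abscissa `j` of a chain over unit columns. -/
def vEdge (g : ℕ → ℝ) (j : ℕ) : Point × Point := ((j, g j), (j, g (j + 1)))

/-- The horizontal edge over the column from `j` to `j + 1` of a chain over unit columns. -/
def hEdge (g : ℕ → ℝ) (j : ℕ) : Point × Point := ((j, g (j + 1)), ((j + 1 : ℕ), g (j + 1)))

/-- A chain over `n` unit columns that starts at the abscissa `s`. -/
def skyline (g : ℕ → ℝ) (s n : ℕ) : List Point :=
  (List.range' s (n + 1)).flatMap fun j : ℕ => [((j : ℝ), g j), ((j : ℝ), g (j + 1))]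

theorem skyline_succ (g : ℕ → ℝ) (s n : ℕ) : skyline g s (n + 1) =
    ((s : ℝ), g s) :: ((s : ℝ), g (s + 1)) :: skyline g (s + 1) n := by
  rw [skyline, List.range'_succ, List.flatMap_cons]
  rfl

/-- The same vertices in two groupings: by columns, as in `combChain`, and by abscissas, where each
pair spans a vertical edge. -/
theorem skyline_eq (g : ℕ → ℝ) (s n : ℕ) :
    ((s : ℝ), g s) :: ((List.range' s n).flatMap
      (fun j : ℕ => [((j : ℝ), g (j + 1)), (((j + 1 : ℕ) : ℝ), g (j + 1))]) ++
      [(((s + n : ℕ) : ℝ), g (s + n + 1))]) = skyline g s n := by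
  induction n generalizing s with
  | zero => simp [skyline]
  | succ n ih =>
    rw [skyline_succ, ← ih (s + 1), List.range'_succ, List.flatMap_cons, show s + 1 + n = s + (n + 1) by ring]
    simp

theorem mem_zip_skyline {g : ℕ → ℝ} {R : List Point} {z : Point} {E : Point × Point} {s n : ℕ}
    (h : E ∈ (skyline g s n ++ R).zip ((skyline g s n ++ R).tail ++ [z])) :
    (∃ j ≤ s + n, E = vEdge g j) ∨ (∃ j < s + n, E = hEdge g j) ∨
      E ∈ ((((s + n : ℕ) : ℝ), g (s + n + 1)) :: R).zip (R ++ [z]) := by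
  induction n generalizing s with
  | zero =>
    simp only [skyline, List.range'_succ, List.range'_zero, List.flatMap_cons, List.flatMap_nil,
      List.append_nil, List.cons_append, List.nil_append, List.tail_cons, List.zip_cons_cons,
      List.mem_cons] at h
    rcases h with rfl | h
    · exact Or.inl ⟨s, le_rfl, rfl⟩
    · exact Or.inr (Or.inr h)
  | succ n ih =>
    have e2 : skyline g (s + 1) n = (((s + 1 : ℕ) : ℝ), g (s + 1)) ::
        (skyline g (s + 1) n).tail := by
      rw [skyline, List.range'_succ, List.flatMap_cons]
      rfl
    have ih := ih (s := s + 1)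
    rw [show s + 1 + n = s + (n + 1) by ring] at ih
    rw [skyline_succ] at h
    simp only [List.cons_append, List.tail_cons, List.zip_cons_cons, List.mem_cons] at h
    rcases h with rfl | h
    · exact Or.inl ⟨s, by omega, rfl⟩
    · rw [e2] at h
      simp only [List.cons_append, List.zip_cons_cons, List.mem_cons] at h
      rcases h with rfl | h
      · exact Or.inr (Or.inl ⟨s, by omega, rfl⟩)
      · refine ih ?_
        rw [e2]
        simpa using h

theorem vEdge_meet_vEdge {g : ℕ → ℝ} {i j : ℕ} (h : i ≠ j) :
    MeetInEndpoint (vEdge g i) (vEdge g j) := by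
  refine meetInEndpoint_of_disjoint fun x h1 _ h2 _ => h ?_
  simp only [vEdge, Set.uIcc_self, Set.mem_singleton_iff] at h1 h2
  exact_mod_cast h1.symm.trans h2

theorem hEdge_meet_hEdge {g : ℕ → ℝ} {n i j : ℕ} (hg : ∀ j ≤ n, g j ≠ g (j + 1)) (hij : i < j)
    (hj : j < n) : MeetInEndpoint (hEdge g i) (hEdge g j) := by
  refine meetInEndpoint_of_disjoint fun x h1 h2 h3 h4 => ?_
  simp only [hEdge, Set.uIcc_self, Set.mem_singleton_iff, Set.mem_uIcc] at h1 h2 h3 h4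
  push_cast at h1 h3
  have h5 : (j : ℝ) ≤ i + 1 := by
    rcases h1 with h1 | h1 <;> rcases h3 with h3 | h3 <;> linarith
  have h6 : j ≤ i + 1 := by exact_mod_cast h5
  obtain rfl : j = i + 1 := by omega
  exact hg (i + 1) (by omega) (h2.symm.trans h4)

/-- The abscissa `i` meets the column from `j` to `j + 1` only at its two boundaries, and there the
height `g (j + 1)` is that of a common endpoint. -/
theorem vEdge_meet_hEdge {g : ℕ → ℝ} {i j : ℕ} : MeetInEndpoint (vEdge g i) (hEdge g j) := by
  by_cases h : i = j ∨ i = j + 1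
  · refine meetInEndpoint_of ((i : ℝ), g (j + 1)) (fun x h1 _ _ h2 => ?_) ?_ ?_
    · simp only [vEdge, hEdge, Set.uIcc_self, Set.mem_singleton_iff] at h1 h2
      exact ⟨h1, h2⟩
    · rcases h with rfl | rfl <;> simp [vEdge]
    · rcases h with rfl | rfl <;> simp [hEdge]
  · refine meetInEndpoint_of_disjoint fun x h1 _ h3 _ => h ?_
    simp only [vEdge, hEdge, Set.uIcc_self, Set.mem_singleton_iff, Set.mem_uIcc] at h1 h3
    rw [h1] at h3
    have h4 : j ≤ i ∧ i ≤ j + 1 := by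
      rcases h3 with h3 | h3
      · exact_mod_cast h3
      · have : j + 1 ≤ i ∧ i ≤ j := by exact_mod_cast h3
        omega
    omega

theorem nodup_skyline {g : ℕ → ℝ} {s n : ℕ} (hg : ∀ j ≤ s + n, g j ≠ g (j + 1)) :
    (skyline g s n).Nodup := by
  rw [skyline, List.nodup_flatMap]
  constructor
  · intro j hj
    rw [List.mem_range'_1] at hj
    simpa using hg j (by omega)
  · refine (List.nodup_range').imp fun {i j} hij => ?_
    intro x hx hx'
    simp only [List.mem_cons, List.not_mem_nil, or_false] at hx hx'
    have h1 : x.1 = i := by rcases hx with rfl | rfl <;> rfl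
    have h2 : x.1 = j := by rcases hx' with rfl | rfl <;> rfl
    exact hij (by exact_mod_cast h1.symm.trans h2)

/-- The edges of a closed polygon that begins with a chain over unit columns meet at most in
common endpoints if this holds for those outside the chain. -/
theorem pairwise_edges_skyline {g : ℕ → ℝ} {n : ℕ} {R : List Point}
    (hg : ∀ j ≤ n, g j ≠ g (j + 1)) (hnd : (skyline g 0 n ++ R).Nodup)
    (hv : ∀ E ∈ (((n : ℝ), g (n + 1)) :: R).zip (R ++ [(0, g 0)]), ∀ j ≤ n,
      MeetInEndpoint (vEdge g j) E)
    (hh : ∀ E ∈ (((n : ℝ), g (n + 1)) :: R).zip (R ++ [(0, g 0)]), ∀ j < n,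
      MeetInEndpoint (hEdge g j) E)
    (hR : ∀ E ∈ (((n : ℝ), g (n + 1)) :: R).zip (R ++ [(0, g 0)]),
      ∀ F ∈ (((n : ℝ), g (n + 1)) :: R).zip (R ++ [(0, g 0)]), E ≠ F → MeetInEndpoint E F) :
    (edges (skyline g 0 n ++ R)).Pairwise fun e f =>
      segment ℝ e.1 e.2 ∩ segment ℝ f.1 f.2 ⊆ {e.1, e.2} ∩ {f.1, f.2} := by
  -- The starting points are distinct, so the edges are too; it then suffices to compare unequal
  -- edges, regardless of their positions in the list.
  have hnd' : (edges (skyline g 0 n ++ R)).Nodup := by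
    refine List.Nodup.of_map Prod.fst ?_
    rwa [edges, List.map_fst_zip (by simp)]
  have hmem : ∀ E ∈ edges (skyline g 0 n ++ R), (∃ j ≤ n, E = vEdge g j) ∨
      (∃ j < n, E = hEdge g j) ∨ E ∈ (((n : ℝ), g (n + 1)) :: R).zip (R ++ [(0, g 0)]) := by
    intro E hE
    have e : edges (skyline g 0 n ++ R) =
        (skyline g 0 n ++ R).zip ((skyline g 0 n ++ R).tail ++ [(0, g 0)]) := by
      rw [edges]
      congr 1
      rw [← skyline_eq]
      simp
    rw [e] at hE
    simpa using mem_zip_skyline hE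
  refine hnd'.pairwise_of_forall_ne fun E hE F hF hEF => ?_
  change MeetInEndpoint E F
  rcases hmem E hE with ⟨i, hi, rfl⟩ | ⟨i, hi, rfl⟩ | hE
  · rcases hmem F hF with ⟨j, hj, rfl⟩ | ⟨j, hj, rfl⟩ | hF
    · exact vEdge_meet_vEdge fun h => hEF (by rw [h])
    · exact vEdge_meet_hEdge
    · exact hv F hF i hi
  · rcases hmem F hF with ⟨j, hj, rfl⟩ | ⟨j, hj, rfl⟩ | hF
    · exact vEdge_meet_hEdge.symm
    · rcases lt_trichotomy i j with h | rfl | h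
      · exact hEdge_meet_hEdge hg h hj
      · exact absurd rfl hEF
      · exact (hEdge_meet_hEdge hg h hi).symm
    · exact hh F hF i hi
  · rcases hmem F hF with ⟨j, hj, rfl⟩ | ⟨j, hj, rfl⟩ | hF
    · exact (hv E hE j hj).symm
    · exact (hh E hE j hj).symm
    · exact hR E hE F hF hEF

/-- The heights of the horizontal edges of a comb over `n` unit columns, with the height `0` on
the left and the height `ρ` on the right. -/
noncomputable def outline (n : ℕ) (h : ℕ → ℝ) (ρ : ℝ) : ℕ → ℝ
  | 0 => 0
  | j + 1 => if j < n then h j else ρ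

section Outline

variable {n : ℕ} {h : ℕ → ℝ} {ρ : ℝ}

theorem outline_ne (hn : 0 < n) (hρ : 0 ≤ ρ) (hh : ∀ j < n, ρ < h j)
    (hne : ∀ j, j + 1 < n → h j ≠ h (j + 1)) : ∀ j ≤ n, outline n h ρ j ≠ outline n h ρ (j + 1) := by
  rintro (_ | j) hj
  · have := hh 0 hn
    simp only [outline, if_pos hn]
    exact (hρ.trans_lt this).ne
  · simp only [outline, if_pos (show j < n by omega)]
    split_ifs with h1
    · exact hne j h1
    · exact (hh j (by omega)).ne'

theorem combChain_append_eq_skyline {k : ℕ} (h : ℕ → ℝ) (ρ : ℝ) :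
    combChain k (fun j => (j : ℝ)) h ++ [(((2 * k - 1 : ℕ) : ℝ), ρ)] =
      skyline (outline (2 * k - 1) h ρ) 0 (2 * k - 1) := by
  rw [← skyline_eq, combChain, List.cons_append, ← List.range_eq_range']
  simp only [outline, zero_add, lt_irrefl, if_false, Nat.cast_zero]
  congr 2
  rw [List.flatMap_congr]
  intro j hj
  rw [List.mem_range] at hj
  simp [hj]

theorem outline_vEdge_pos (hh : ∀ j < n, ρ < h j) {j : ℕ} (hj0 : 0 < j) (hj : j < n)
    {y : ℝ} (hy : y ∈ Set.uIcc (outline n h ρ j) (outline n h ρ (j + 1))) : ρ < y := by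
  obtain ⟨j, rfl⟩ := Nat.exists_eq_succ_of_ne_zero hj0.ne'
  simp only [outline, if_pos hj, if_pos (show j < n by omega),
    Set.mem_uIcc] at hy
  have h1 := hh j (by omega)
  have h2 := hh (j + 1) hj
  rcases hy with hy | hy <;> linarith

theorem outline_hEdge_pos (hh : ∀ j < n, ρ < h j) {j : ℕ} (hj : j < n) :
    ρ < outline n h ρ (j + 1) := by
  simpa only [outline, if_pos hj] using hh j hj

theorem outline_last_mem (hn : 0 < n) (hh : ∀ j < n, ρ < h j)
    {y : ℝ} (hy : y ∈ Set.uIcc (outline n h ρ n) (outline n h ρ (n + 1))) : ρ ≤ y := by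
  obtain ⟨j, rfl⟩ := Nat.exists_eq_succ_of_ne_zero hn.ne'
  simp only [Nat.succ_eq_add_one, outline, lt_irrefl, if_false, if_pos (show j < j + 1 by omega),
    Set.mem_uIcc] at hy
  have h1 := hh j (by omega)
  rcases hy with hy | hy <;> linarith

theorem outline_last : outline n h ρ (n + 1) = ρ := by simp [outline]

theorem pairwise_edges_plain (hn : 0 < n) (hh : ∀ j < n, 0 < h j)
    (hne : ∀ j, j + 1 < n → h j ≠ h (j + 1)) :
    (skyline (outline n h 0) 0 n).Nodup ∧ (edges (skyline (outline n h 0) 0 n)).Pairwise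
      fun e f => segment ℝ e.1 e.2 ∩ segment ℝ f.1 f.2 ⊆ {e.1, e.2} ∩ {f.1, f.2} := by
  have hg := outline_ne hn le_rfl hh hne
  have hnd : (skyline (outline n h 0) 0 n).Nodup := nodup_skyline (by simpa using hg)
  refine ⟨hnd, ?_⟩
  have := pairwise_edges_skyline (R := []) hg (by simpa using hnd) ?_ ?_ ?_
  · simpa using this
  · intro E hE j hj
    obtain rfl : E = (((n : ℝ), 0), (0, 0)) := by simpa [outline] using hE
    rcases Nat.eq_zero_or_pos j with rfl | hj0
    · refine meetInEndpoint_of (0, 0) (fun x h1 _ _ h4 => ?_) (by simp [vEdge, outline])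
        (by simp)
      simp [vEdge] at h1 h4
      exact ⟨h1, h4⟩
    rcases hj.lt_or_eq with hj' | rfl
    · refine meetInEndpoint_of_disjoint fun x _ h2 _ h4 => ?_
      have := outline_vEdge_pos hh hj0 hj' h2
      simp at h4
      linarith
    · refine meetInEndpoint_of ((j : ℝ), 0) (fun x h1 _ _ h4 => ?_)
        (by simp [vEdge, outline]) (by simp)
      simp [vEdge] at h1 h4
      exact ⟨h1, h4⟩
  · intro E hE j hj
    obtain rfl : E = (((n : ℝ), 0), (0, 0)) := by simpa [outline] using hE
    refine meetInEndpoint_of_disjoint fun x _ h2 _ h4 => ?_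
    have := outline_hEdge_pos hh hj
    simp [hEdge] at h2 h4
    linarith
  · intro E hE F hF hEF
    simp at hE hF
    exact absurd (hE.trans hF.symm) hEF

theorem pairwise_edges_notched (hn : 0 < n) (hh : ∀ j < n, 1 < h j)
    (hne : ∀ j, j + 1 < n → h j ≠ h (j + 1)) :
    (skyline (outline n h 1) 0 n ++ [((n : ℝ) - 1 / 2, 1), ((n : ℝ) - 1 / 2, 0)]).Nodup ∧
      (edges (skyline (outline n h 1) 0 n ++
        [((n : ℝ) - 1 / 2, 1), ((n : ℝ) - 1 / 2, 0)])).Pairwise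
      fun e f => segment ℝ e.1 e.2 ∩ segment ℝ f.1 f.2 ⊆ {e.1, e.2} ∩ {f.1, f.2} := by
  have hg := outline_ne hn zero_le_one hh hne
  have hn1 : (1 : ℝ) ≤ n := by exact_mod_cast hn
  -- The vertical edge of the notch has a half-integral abscissa and so avoids all vertical edges of
  -- the chain.
  have hint : ∀ j : ℕ, (j : ℝ) ≠ n - 1 / 2 := fun j hj => by
    have : (2 * j + 1 : ℝ) = 2 * n := by linarith
    have : 2 * j + 1 = 2 * n := by exact_mod_cast this
    omega
  have hnd : (skyline (outline n h 1) 0 n ++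
      [((n : ℝ) - 1 / 2, 1), ((n : ℝ) - 1 / 2, 0)]).Nodup := by
    refine (nodup_skyline (by simpa using hg)).append (by simp) fun x hx hx' => ?_
    rw [skyline, List.mem_flatMap] at hx
    obtain ⟨j, -, hj⟩ := hx
    simp only [List.mem_cons, List.not_mem_nil, or_false] at hj hx'
    have h1 : x.1 = j := by rcases hj with rfl | rfl <;> rfl
    have h2 : x.1 = n - 1 / 2 := by rcases hx' with rfl | rfl <;> rfl
    exact hint j (h1.symm.trans h2)
  refine ⟨hnd, pairwise_edges_skyline hg hnd ?_ ?_ ?_⟩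
  · intro E hE j hj
    rw [outline_last] at hE
    simp only [outline, List.cons_append, List.nil_append, List.zip_cons_cons, List.mem_cons,
      List.zip_nil_left, List.not_mem_nil, or_false] at hE
    rcases hE with rfl | rfl | rfl
    · rcases hj.lt_or_eq with hj' | rfl
      · refine meetInEndpoint_of_disjoint fun x h1 _ h3 _ => ?_
        simp only [vEdge, Set.uIcc_self, Set.mem_singleton_iff, Set.mem_uIcc] at h1 h3
        have : ((j + 1 : ℕ) : ℝ) ≤ n := by exact_mod_cast hj'
        push_cast at this
        rcases h3 with h3 | h3 <;> linarith
      · refine meetInEndpoint_of ((j : ℝ), 1) (fun x h1 _ _ h4 => ?_)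
          (by simp [vEdge, outline]) (by simp)
        simp [vEdge] at h1 h4
        exact ⟨h1, h4⟩
    · refine meetInEndpoint_of_disjoint fun x h1 _ h3 _ => hint j ?_
      simp only [vEdge, Set.uIcc_self, Set.mem_singleton_iff] at h1 h3
      exact h1.symm.trans h3
    · rcases Nat.eq_zero_or_pos j with rfl | hj0
      · refine meetInEndpoint_of (0, 0) (fun x h1 _ _ h4 => ?_) (by simp [vEdge, outline])
          (by simp)
        simp [vEdge] at h1 h4
        exact ⟨h1, h4⟩
      · refine meetInEndpoint_of_disjoint fun x _ h2 _ h4 => ?_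
        simp only [Set.uIcc_self, Set.mem_singleton_iff] at h4
        rcases hj.lt_or_eq with hj' | rfl
        · linarith [outline_vEdge_pos hh hj0 hj' h2]
        · linarith [outline_last_mem hn hh h2]
  · intro E hE j hj
    have h0 := outline_hEdge_pos hh hj
    rw [outline_last] at hE
    simp only [outline, List.cons_append, List.nil_append, List.zip_cons_cons, List.mem_cons,
      List.zip_nil_left, List.not_mem_nil, or_false] at hE
    rcases hE with rfl | rfl | rfl
    all_goals
      refine meetInEndpoint_of_disjoint fun x _ h2 _ h4 => ?_
      simp only [hEdge, Set.uIcc_self, Set.mem_singleton_iff, Set.mem_uIcc] at h2 h4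
    · linarith
    · rcases h4 with h4 | h4 <;> linarith
    · linarith
  · have h12 : MeetInEndpoint (((n : ℝ), 1), ((n : ℝ) - 1 / 2, 1))
        (((n : ℝ) - 1 / 2, 1), ((n : ℝ) - 1 / 2, 0)) := by
      refine meetInEndpoint_of ((n : ℝ) - 1 / 2, 1) (fun x _ h2 h3 _ => ?_) (by simp) (by simp)
      simp only [Set.uIcc_self, Set.mem_singleton_iff] at h2 h3
      exact ⟨h3, h2⟩
    have h13 : MeetInEndpoint (((n : ℝ), 1), ((n : ℝ) - 1 / 2, 1))
        (((n : ℝ) - 1 / 2, 0), (0, 0)) := by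
      refine meetInEndpoint_of_disjoint fun x _ h2 _ h4 => ?_
      simp only [Set.uIcc_self, Set.mem_singleton_iff] at h2 h4
      linarith
    have h23 : MeetInEndpoint (((n : ℝ) - 1 / 2, 1), ((n : ℝ) - 1 / 2, 0))
        (((n : ℝ) - 1 / 2, 0), (0, 0)) := by
      refine meetInEndpoint_of ((n : ℝ) - 1 / 2, 0) (fun x h1 _ _ h4 => ?_) (by simp) (by simp)
      simp only [Set.uIcc_self, Set.mem_singleton_iff] at h1 h4
      exact ⟨h1, h4⟩
    intro E hE F hF hEF
    rw [outline_last] at hE hF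
    simp only [outline, List.cons_append, List.nil_append, List.zip_cons_cons, List.mem_cons,
      List.zip_nil_left, List.not_mem_nil, or_false] at hE hF
    rcases hE with rfl | rfl | rfl <;> rcases hF with rfl | rfl | rfl
    · exact absurd rfl hEF
    · exact h12
    · exact h13
    · exact h12.symm
    · exact absurd rfl hEF
    · exact h23
    · exact h13.symm
    · exact h23.symm
    · exact absurd rfl hEF

end Outline

/-! ### The extremal polygons -/

theorem combHeight_ne {k j : ℕ} (hk : 0 < k) (hj : j + 1 < 2 * k - 1) :
    combHeight k j ≠ combHeight k (j + 1) := by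
  have h := (isSymmetricComb_combHeight hk).gap_lt_tooth
  rcases Nat.even_or_odd j with h1 | h1
  · exact (h (j + 1) hj j (by omega) h1.add_one h1).ne'
  · exact (h j (by omega) (j + 1) hj h1 h1.add_one).ne

theorem one_lt_combHeight {k j : ℕ} (hj : j < 2 * k - 1) : 1 < combHeight k j := by
  unfold combHeight
  split_ifs with h
  · have : 1 + min j (2 * k - 2 - j) < 2 * k := by omega
    have : (1 : ℝ) + (min j (2 * k - 2 - j) : ℕ) < 2 * k := by exact_mod_cast this
    linarith
  · have : 0 < min j (2 * k - 2 - j) := by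
      rw [Nat.not_even_iff_odd] at h
      obtain ⟨a, rfl⟩ := h
      omega
    have : (0 : ℝ) < (min j (2 * k - 2 - j) : ℕ) := by exact_mod_cast this
    linarith

/-- One vertex list in three descriptions: `combChain` for the definition of a comb, `combWord` for
the invariant, turns and directions, `skyline` for simplicity. The weight is `1 + 1 + 6 * m`. -/
theorem exists_plain (m : ℕ) : ∃ P, IsOrthogonalGon (4 * m + 4) P ∧ IsPlainComb (m + 1) P ∧
    State P (6 * m) := by
  have hk : 2 * (m + 1) - 1 = 2 * m + 1 := by omega
  have hS := shape_plain m
  have hP := path_plain m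
  have hsky := combChain_append_eq_skyline (k := m + 1) (combHeight (m + 1)) 0
  rw [hk] at hsky
  push_cast at hsky
  have hpw := pairwise_edges_plain (n := 2 * m + 1) (h := combHeight (m + 1)) (by omega)
    (fun j hj => one_pos.trans (one_lt_combHeight (by omega)))
    fun j hj => combHeight_ne m.succ_pos (by omega)
  have hlen := congrArg List.length hP
  refine ⟨combChain (m + 1) (fun j => (j : ℝ)) (combHeight (m + 1)) ++ [(2 * (m : ℝ) + 1, 0)],
    ⟨⟨?_, ?_, ?_, ?_⟩, ?_, ?_⟩, ?_, ?_⟩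
  · rw [hP]; simp [combWord]
  · rw [hsky]; exact hpw.1
  · rw [hP]; exact hS.turn_ne
  · rw [hsky]; exact hpw.2
  · rw [hP]; simp [combWord, length_nest, length_evenSteps]
  · rw [hP]; exact hS.orthogonal
  · exact ⟨_, _, isSymmetricComb_combHeight m.succ_pos, by rw [hk]; simp⟩
  · exact ⟨_, _, _, _, _, _, _, hS, by simp; ring, by rw [hP]⟩

theorem exists_notched (m : ℕ) : ∃ P, IsOrthogonalGon (4 * m + 6) P ∧ IsNotchedComb (m + 1) P ∧
    State P (6 * m + 2) := by
  have hk : 2 * (m + 1) - 1 = 2 * m + 1 := by omega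
  have hk' : 2 * (m + 1) - 2 = 2 * m := by omega
  have hS := shape_notched m
  have hP := path_notched m
  have hsky := combChain_append_eq_skyline (k := m + 1) (combHeight (m + 1)) 1
  rw [hk] at hsky
  push_cast at hsky
  have hpw := pairwise_edges_notched (n := 2 * m + 1) (h := combHeight (m + 1)) (by omega)
    (fun j hj => one_lt_combHeight (by omega))
    fun j hj => combHeight_ne m.succ_pos (by omega)
  push_cast at hpw
  rw [← hsky, List.append_assoc] at hpw
  refine ⟨combChain (m + 1) (fun j => (j : ℝ)) (combHeight (m + 1)) ++
    [(2 * (m : ℝ) + 1, 1), (2 * (m : ℝ) + 1 - 1 / 2, 1), (2 * (m : ℝ) + 1 - 1 / 2, 0)],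
    ⟨⟨?_, hpw.1, ?_, hpw.2⟩, ?_, ?_⟩, ?_, ?_⟩
  · rw [hP]; simp [combWord]
  · rw [hP]; exact hS.turn_ne
  · rw [hP]; simp [combWord, length_nest, length_evenSteps]
  · rw [hP]; exact hS.orthogonal
  · refine ⟨_, _, 1 / 2, 1, isSymmetricComb_combHeight m.succ_pos, by norm_num, ?_, one_pos,
      fun j hj => one_lt_combHeight hj, ?_⟩
    · rw [hk, hk']; push_cast; linarith
    · rw [hk]; simp
  · exact ⟨_, _, _, _, _, _, _, hS, by simp; ring, by rw [hP]⟩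

theorem State.forall_kind {P : List Point} {t : ℕ} (h : State P (2 * t)) (K : Kind) :
    (∃ Q, FlipturnSeq K t P Q ∧ IsConvexPolygon Q) ∧
      ∀ l Q, FlipturnSeq K l P Q → IsConvexPolygon Q → l = t :=
  ⟨h.exists_seq, fun _ _ hs hc => h.length_eq hs hc⟩

end Flipturn

theorem mainTheorem4 (n : ℕ) (hn : 4 ≤ n) (hn_even : Even n) :
    ∃ P : List Flipturn.Point,
      Flipturn.IsOrthogonalGon n P ∧
      (4 ∣ n → Flipturn.IsPlainComb (n / 4) P) ∧
      (¬ 4 ∣ n → Flipturn.IsNotchedComb (n / 4) P) ∧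
      ∀ K : Flipturn.Kind,
        (∃ Q : List Flipturn.Point,
          Flipturn.FlipturnSeq K (3 * (n - 4) / 4) P Q ∧ Flipturn.IsConvexPolygon Q) ∧
        ∀ (l : ℕ) (Q : List Flipturn.Point),
          Flipturn.FlipturnSeq K l P Q → Flipturn.IsConvexPolygon Q →
            l = 3 * (n - 4) / 4 := by
  by_cases h4 : 4 ∣ n
  · obtain ⟨m, rfl⟩ : ∃ m, n = 4 * m + 4 := ⟨n / 4 - 1, by omega⟩
    obtain ⟨P, h1, h2, h3⟩ := Flipturn.exists_plain m
    have e1 : (4 * m + 4) / 4 = m + 1 := by omega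
    have e2 : 3 * (4 * m + 4 - 4) / 4 = 3 * m := by omega
    rw [show 6 * m = 2 * (3 * m) by ring] at h3
    rw [e1, e2]
    exact ⟨P, h1, fun _ => h2, fun h => absurd h4 h, h3.forall_kind⟩
  · obtain ⟨m, rfl⟩ : ∃ m, n = 4 * m + 6 := by
      obtain ⟨r, rfl⟩ := hn_even
      exact ⟨(r + r) / 4 - 1, by omega⟩
    obtain ⟨P, h1, h2, h3⟩ := Flipturn.exists_notched m
    have e1 : (4 * m + 6) / 4 = m + 1 := by omega
    have e2 : 3 * (4 * m + 6 - 4) / 4 = 3 * m + 1 := by omega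
    rw [show 6 * m + 2 = 2 * (3 * m + 1) by ring] at h3
    rw [e1, e2]
    exact ⟨P, h1, fun h => absurd h h4, fun _ => h2, h3.forall_kind⟩
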